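/- Let $\mathcal L_+=\{(\omega,\boldsymbol k):-\omega^2+|\boldsymbol k|^2=0,\ \omega>0\}$ be the forward light cone, identified with $\mathbb R^3\setminus\{0\}$ by $(|\boldsymbol k|,\boldsymbol k)\leftrightarrow \boldsymbol k$. A smooth action $\Sigma$ of a Lie group $G$ by fibrewise linear maps on a smooth complex vector bundle $E\to\mathcal L_+$, covering an action $\sigma$ on $\mathcal L_+$, is called *external* if $\sigma_{g_1}k=\sigma_{g_2}k$ implies $\Sigma_{g_1}v=\Sigma_{g_2}v$ for all $v\in E(k)$ (equivalently, the stabilizer of each $k$ acts trivially on $E(k)$). (1) Let $E\to\mathcal L_+$ be a smooth complex vector bundle of rank $r$ which carries an external $\mathrm{SO}(3)$ action covering the standard action $\sigma_R\boldsymbol k=R\boldsymbol k$. Then $E$ is a trivial bundle, i.e. isomorphic to $\mathcal L_+\times\mathbb C^r$ as a smooth complex vector bundle. (2) Let $E\to\mathcal L_+$ be a massless particle, i.e. a Hermitian smooth vector bundle of finite nonzero rank with a smooth unitary irreducible (no proper nonzero invariant smooth subbundle) action $\Sigma$ of the proper orthochronous Poincaré group $\mathrm{ISO}^+(3,1)$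 that covers the standard action on $\mathcal L_+$ (Lorentz transformations act by $k\mapsto\Lambda k$, translations trivially), such that the inhomogeneous elements $\mathbb R^2$ of the little groups $\mathrm{ISO}(2)=\mathbb R^2\rtimes \mathrm{SO}(2)$ act trivially. Then there is exactly one integer $h$, the helicity, such that for all $k$ and $\theta$ the rotation by $\theta$ about the direction of $\boldsymbol k$ acts on $E(k)$ as $e^{-ih\theta}$. Write $R_m(t)$ for the rotation by $t$ about the $m$-th axis; the generators of an $\mathrm{SO}(3)$ action $\Sigma'$ on $E$ covering the standard one are the operators $(L_m\psi)(k)=i\frac{d}{dt}\big|_{t=0}\Sigma'_{R_m(t)}\,\psi(R_m(-t)k)$ on sections, and the total angular momentum $\boldsymbol J$ is the generator of the restriction of $\Sigma$ to $\mathrm{SO}(3)$. An *external OAM operator* is a triple $\boldsymbol L=(L_1,L_2,L_3)$ that generates an external smooth $\mathrm{SO}(3)$ action on $E$ covering the standard one and is a vector operator, i.e. $[L_m,J_n]=i\sum_p\epsilon_{mnp}L_p$ on smooth sections. Then the particle admits an external OAM operator if and only if $h=0$. Likewise, $E$ carries an external smooth $\mathrm{SO}(3)$ action covering the standard one (with no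 vector operator condition) if and only if $h=0$. -/

import Mathlib

open Bundle Matrix
open scoped Manifold ContDiff

noncomputable section

namespace MasslessParticles

/-! ### Momentum space of a massless particle -/

/-- Three-dimensional Euclidean space of spatial momenta. -/
abbrev Space : Type := EuclideanSpace ℝ (Fin 3)

/-- The forward light cone `{(ω, k) : -ω² + |k|² = 0, ω > 0}`, parametrized by the spatial part `k`,
as the open submanifold `ℝ³ ∖ {0}` of `ℝ³`. -/
def lightCone : TopologicalSpace.Opens Space := ⟨{0}ᶜ, isOpen_compl_singleton⟩

/-- The type of points of the forward light cone. -/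
abbrev LightCone : Type := lightCone

theorem LightCone.ne_zero (k : LightCone) : (k : Space) ≠ 0 := k.2

/-- Index type of Minkowski space: `Sum.inl ()` is the time index, `Sum.inr i` a space index. -/
abbrev SpacetimeIndex : Type := Unit ⊕ Fin 3

/-- The Minkowski metric, of signature `(-,+,+,+)`. -/
def minkowski : Matrix SpacetimeIndex SpacetimeIndex ℝ := fromBlocks (-1) 0 0 1

/-- The four-momentum `(|k|, k)` of a point of the light cone. -/
def fourMomentum (k : LightCone) : SpacetimeIndex → ℝ :=
  Sum.elim (fun _ => ‖(k : Space)‖) (fun i => (k : Space) i)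

/-! ### The rotation group -/

/-- The rotation group `SO(3)`. -/
abbrev SO3 : Type := Matrix.specialOrthogonalGroup (Fin 3) ℝ

theorem SO3.transpose_mul (R : SO3) : (R : Matrix (Fin 3) (Fin 3) ℝ)ᵀ * R.1 = 1 := by
  have h := (Matrix.mem_specialOrthogonalGroup_iff.1 R.2).1
  exact (Matrix.mem_orthogonalGroup_iff' (Fin 3) ℝ).1 h

theorem SO3.mul_transpose (R : SO3) : (R : Matrix (Fin 3) (Fin 3) ℝ) * R.1ᵀ = 1 := by
  have h := (Matrix.mem_specialOrthogonalGroup_iff.1 R.2).1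
  exact (Matrix.mem_orthogonalGroup_iff (Fin 3) ℝ).1 h

theorem SO3.det_eq (R : SO3) : (R : Matrix (Fin 3) (Fin 3) ℝ).det = 1 :=
  (Matrix.mem_specialOrthogonalGroup_iff.1 R.2).2

/-- The standard action of rotations on the light cone: `R • k` is the matrix product `R k`. -/
instance : MulAction SO3 LightCone where
  smul R k := ⟨WithLp.toLp 2 ((R : Matrix (Fin 3) (Fin 3) ℝ) *ᵥ (WithLp.ofLp (k : Space))), by
    intro h
    have h0 : (R : Matrix (Fin 3) (Fin 3) ℝ) *ᵥ (WithLp.ofLp (k : Space)) = 0 := by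
      simpa using h
    have h1 := congrArg (fun v => (R : Matrix (Fin 3) (Fin 3) ℝ)ᵀ *ᵥ v) h0
    simp only [mulVec_mulVec, SO3.transpose_mul, one_mulVec, mulVec_zero] at h1
    exact k.ne_zero (by simpa using h1)⟩
  one_smul k := by
    apply Subtype.ext
    change WithLp.toLp 2 (((1 : SO3) : Matrix (Fin 3) (Fin 3) ℝ) *ᵥ _) = _
    simp
  mul_smul R S k := by
    apply Subtype.ext
    change WithLp.toLp 2 (((R * S : SO3) : Matrix (Fin 3) (Fin 3) ℝ) *ᵥ _) =
      WithLp.toLp 2 ((R : Matrix (Fin 3) (Fin 3) ℝ) *ᵥ ((S : Matrix (Fin 3) (Fin 3) ℝ) *ᵥ _))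
    simp [mulVec_mulVec]

/-- Rodrigues' formula: the matrix of `v ↦ cos θ v + sin θ (n × v) + (1 - cos θ) (n · v) n`. -/
def rodrigues (n : Fin 3 → ℝ) (θ : ℝ) : Matrix (Fin 3) (Fin 3) ℝ :=
  Real.cos θ • (1 : Matrix (Fin 3) (Fin 3) ℝ)
    + Real.sin θ • !![0, -n 2, n 1; n 2, 0, -n 0; -n 1, n 0, 0]
    + (1 - Real.cos θ) • vecMulVec n n

theorem rodrigues_mem (n : Fin 3 → ℝ) (hn : n 0 ^ 2 + n 1 ^ 2 + n 2 ^ 2 = 1) (θ : ℝ) :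
    rodrigues n θ ∈ Matrix.specialOrthogonalGroup (Fin 3) ℝ := by
  have hc := Real.sin_sq_add_cos_sq θ
  rw [Matrix.mem_specialOrthogonalGroup_iff, Matrix.mem_orthogonalGroup_iff]
  generalize hcv : Real.cos θ = c at hc
  generalize hsv : Real.sin θ = s at hc
  constructor
  · ext i j
    fin_cases i <;> fin_cases j <;>
      simp [rodrigues, hcv, hsv, Matrix.mul_apply, Fin.sum_univ_three, vecMulVec_apply] <;> grind
  · simp [rodrigues, hcv, hsv, Matrix.det_fin_three, vecMulVec_apply]
    grind

/-- The (right-handed) rotation by the angle `θ` about the direction of `k`. -/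
def rotationAbout (k : LightCone) (θ : ℝ) : SO3 :=
  ⟨rodrigues (WithLp.ofLp (‖(k : Space)‖⁻¹ • (k : Space))) θ, rodrigues_mem _ (by
    have h : ‖(‖(k : Space)‖⁻¹ • (k : Space))‖ = 1 := by
      rw [norm_smul, norm_inv, norm_norm, inv_mul_cancel₀ (norm_ne_zero_iff.2 k.ne_zero)]
    have h2 := EuclideanSpace.norm_sq_eq (‖(k : Space)‖⁻¹ • (k : Space))
    rw [h, Fin.sum_univ_three, one_pow] at h2
    simpa only [Real.norm_eq_abs, sq_abs] using h2.symm) θ⟩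

/-- The `m`-th coordinate vector of `ℝ³`, as a point of the light cone. -/
def axis (m : Fin 3) : LightCone :=
  ⟨EuclideanSpace.single m 1, by
    intro h
    have := congrArg (fun v : Space => v m) h
    simp at this⟩

/-! ### The Poincaré group -/

theorem minkowski_mul_self : minkowski * minkowski = 1 := by
  simp [minkowski, fromBlocks_multiply]

theorem mul_minkowski_mul_transpose {A : Matrix SpacetimeIndex SpacetimeIndex ℝ}
    (hA : Aᵀ * minkowski * A = minkowski) : A * minkowski * Aᵀ = minkowski := by
  have h1 : (minkowski * Aᵀ * minkowski) * A = 1 := by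
    rw [Matrix.mul_assoc, Matrix.mul_assoc, ← Matrix.mul_assoc Aᵀ, hA, minkowski_mul_self]
  have h2 := mul_eq_one_comm.1 h1
  calc A * minkowski * Aᵀ = A * minkowski * Aᵀ * (minkowski * minkowski) := by
        rw [minkowski_mul_self, Matrix.mul_one]
    _ = (A * (minkowski * Aᵀ * minkowski)) * minkowski := by simp only [Matrix.mul_assoc]
    _ = minkowski := by rw [h2, Matrix.one_mul]

theorem minkowski_sandwich (A : Matrix SpacetimeIndex SpacetimeIndex ℝ) :
    (Aᵀ * minkowski * A) (Sum.inl ()) (Sum.inl ()) =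
      -(A (Sum.inl ()) (Sum.inl ())) ^ 2 + ∑ i, (A (Sum.inr i) (Sum.inl ())) ^ 2 := by
  simp only [minkowski, Matrix.mul_apply, Fintype.sum_sum_type, Finset.univ_unique,
    Finset.sum_singleton, transpose_apply, fromBlocks_apply₁₁, fromBlocks_apply₁₂,
    fromBlocks_apply₂₁, fromBlocks_apply₂₂, Matrix.zero_apply, Matrix.neg_apply,
    Matrix.one_apply, mul_zero, Finset.sum_const_zero, add_zero, zero_add, mul_ite,
    mul_one, Finset.sum_ite_eq', Finset.mem_univ, if_true]
  simp [sq]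

theorem future_pairing_pos (a x : SpacetimeIndex → ℝ) (ha0 : 0 < a (Sum.inl ()))
    (ha : ∑ i, a (Sum.inr i) ^ 2 < a (Sum.inl ()) ^ 2) (hx0 : 0 < x (Sum.inl ()))
    (hx : ∑ i, x (Sum.inr i) ^ 2 ≤ x (Sum.inl ()) ^ 2) :
    0 < ∑ μ, a μ * x μ := by
  rw [Fintype.sum_sum_type]
  simp only [Finset.univ_unique, Finset.sum_singleton]
  change 0 < a (Sum.inl ()) * x (Sum.inl ()) + _
  have hcs := Finset.sum_mul_sq_le_sq_mul_sq Finset.univ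
    (fun i => a (Sum.inr i)) (fun i => x (Sum.inr i))
  have hnn : 0 ≤ ∑ i, a (Sum.inr i) ^ 2 := Finset.sum_nonneg fun i _ => sq_nonneg _
  have hlt : (∑ i, a (Sum.inr i) * x (Sum.inr i)) ^ 2 <
      (a (Sum.inl ()) * x (Sum.inl ())) ^ 2 := by
    have h1 : (∑ i, a (Sum.inr i) ^ 2) * ∑ i, x (Sum.inr i) ^ 2 ≤
        (∑ i, a (Sum.inr i) ^ 2) * x (Sum.inl ()) ^ 2 := mul_le_mul_of_nonneg_left hx hnn
    have h2 : (∑ i, a (Sum.inr i) ^ 2) * x (Sum.inl ()) ^ 2 <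
        a (Sum.inl ()) ^ 2 * x (Sum.inl ()) ^ 2 := mul_lt_mul_of_pos_right ha (by positivity)
    rw [mul_pow]
    linarith
  have := abs_lt_of_sq_lt_sq hlt (mul_pos ha0 hx0).le
  linarith [(abs_lt.1 (abs_lt_of_sq_lt_sq hlt (mul_pos ha0 hx0).le)).1]

theorem lorentz_future {A : Matrix SpacetimeIndex SpacetimeIndex ℝ}
    (hA : Aᵀ * minkowski * A = minkowski) (hA0 : 0 < A (Sum.inl ()) (Sum.inl ()))
    (x : SpacetimeIndex → ℝ) (hx0 : 0 < x (Sum.inl ()))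
    (hx : ∑ i, x (Sum.inr i) ^ 2 ≤ x (Sum.inl ()) ^ 2) : 0 < (A *ᵥ x) (Sum.inl ()) := by
  refine future_pairing_pos (fun μ => A (Sum.inl ()) μ) x hA0 ?_ hx0 hx
  have h := minkowski_sandwich Aᵀ
  rw [transpose_transpose, mul_minkowski_mul_transpose hA] at h
  simp only [transpose_apply] at h
  have h' : minkowski (Sum.inl ()) (Sum.inl ()) = -1 := by simp [minkowski]
  rw [h'] at h
  linarith

/-- The proper orthochronous Lorentz group `SO⁺(3,1)`. -/
def lorentzGroup : Subgroup (Matrix.SpecialLinearGroup SpacetimeIndex ℝ) where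
  carrier := {Λ | (Λ.1)ᵀ * minkowski * Λ.1 = minkowski ∧ 0 < Λ.1 (Sum.inl ()) (Sum.inl ())}
  one_mem' := by simp
  mul_mem' := by
    rintro A B ⟨hA, hA0⟩ ⟨hB, hB0⟩
    refine ⟨?_, ?_⟩
    · calc (A.1 * B.1)ᵀ * minkowski * (A.1 * B.1)
          = B.1ᵀ * (A.1ᵀ * minkowski * A.1) * B.1 := by
            rw [transpose_mul]; simp only [Matrix.mul_assoc]
        _ = minkowski := by rw [hA, hB]
    · have h := minkowski_sandwich B.1
      have h' : minkowski (Sum.inl ()) (Sum.inl ()) = -1 := by simp [minkowski]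
      rw [hB, h'] at h
      exact lorentz_future hA hA0 (fun μ => B.1 μ (Sum.inl ())) hB0 (by linarith)
  inv_mem' := by
    rintro A ⟨hA, hA0⟩
    have h1 : (minkowski * A.1ᵀ * minkowski) * A.1 = 1 := by
      rw [Matrix.mul_assoc, Matrix.mul_assoc, ← Matrix.mul_assoc A.1ᵀ, hA, minkowski_mul_self]
    have h2 : A.1 * (A⁻¹).1 = 1 := congrArg Subtype.val (mul_inv_cancel A)
    have h3 : (A⁻¹).1 = minkowski * A.1ᵀ * minkowski := by
      calc (A⁻¹).1 = ((minkowski * A.1ᵀ * minkowski) * A.1) * (A⁻¹).1 := by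
            rw [h1, Matrix.one_mul]
        _ = _ := by rw [Matrix.mul_assoc, h2, Matrix.mul_one]
    refine ⟨?_, ?_⟩
    · have h4 : (A⁻¹).1ᵀ * A.1ᵀ = 1 := by rw [← transpose_mul, h2, transpose_one]
      calc (A⁻¹).1ᵀ * minkowski * (A⁻¹).1
          = (A⁻¹).1ᵀ * (A.1ᵀ * minkowski * A.1) * (A⁻¹).1 := by rw [hA]
        _ = ((A⁻¹).1ᵀ * A.1ᵀ) * minkowski * (A.1 * (A⁻¹).1) := by
            simp only [Matrix.mul_assoc]
        _ = minkowski := by rw [h4, h2, Matrix.one_mul, Matrix.mul_one]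
    · rw [h3]
      simpa [minkowski, Matrix.mul_apply, Fintype.sum_sum_type, Matrix.one_apply] using hA0

/-- The type of proper orthochronous Lorentz transformations. -/
abbrev Lorentz : Type := lorentzGroup

/-- The matrix of a Lorentz transformation. -/
def Lorentz.mat (Λ : Lorentz) : Matrix SpacetimeIndex SpacetimeIndex ℝ := Λ.1.1

theorem Lorentz.mat_one : Lorentz.mat 1 = 1 := rfl

theorem Lorentz.mat_mul (Λ Λ' : Lorentz) : Lorentz.mat (Λ * Λ') = Λ.mat * Λ'.mat := rfl

theorem Lorentz.preserves (Λ : Lorentz) : Λ.matᵀ * minkowski * Λ.mat = minkowski := Λ.2.1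

theorem Lorentz.pos (Λ : Lorentz) : 0 < Λ.mat (Sum.inl ()) (Sum.inl ()) := Λ.2.2

/-- The proper orthochronous Poincaré group `ISO⁺(3,1)`: pairs of a spacetime translation `a` and a
Lorentz transformation `Λ`, acting on Minkowski space by `x ↦ Λ x + a`. -/
@[ext] structure Poincare where
  /-- the translation part -/
  trans : SpacetimeIndex → ℝ
  /-- the Lorentz part -/
  lor : Lorentz

instance : Group Poincare where
  mul g h := ⟨g.trans + g.lor.mat *ᵥ h.trans, g.lor * h.lor⟩
  one := ⟨0, 1⟩
  inv g := ⟨-((g.lor⁻¹).mat *ᵥ g.trans), g.lor⁻¹⟩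
  mul_assoc g h l := by
    apply Poincare.ext
    · change (g.trans + g.lor.mat *ᵥ h.trans) + (g.lor * h.lor).mat *ᵥ l.trans =
        g.trans + g.lor.mat *ᵥ (h.trans + h.lor.mat *ᵥ l.trans)
      rw [Lorentz.mat_mul, mulVec_add, mulVec_mulVec, add_assoc]
    · exact mul_assoc g.lor h.lor l.lor
  one_mul g := by
    apply Poincare.ext
    · change (0 : SpacetimeIndex → ℝ) + (1 : Lorentz).mat *ᵥ g.trans = g.trans
      rw [Lorentz.mat_one, one_mulVec, zero_add]
    · exact one_mul g.lor
  mul_one g := by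
    apply Poincare.ext
    · change g.trans + g.lor.mat *ᵥ (0 : SpacetimeIndex → ℝ) = g.trans
      rw [mulVec_zero, add_zero]
    · exact mul_one g.lor
  inv_mul_cancel g := by
    apply Poincare.ext
    · change -((g.lor⁻¹).mat *ᵥ g.trans) + (g.lor⁻¹).mat *ᵥ g.trans = 0
      exact neg_add_cancel _
    · exact inv_mul_cancel g.lor

theorem fourMomentum_null (k : LightCone) :
    ∑ i, fourMomentum k (Sum.inr i) ^ 2 = fourMomentum k (Sum.inl ()) ^ 2 := by
  simp [fourMomentum, EuclideanSpace.norm_sq_eq]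

theorem fourMomentum_pos (k : LightCone) : 0 < fourMomentum k (Sum.inl ()) :=
  norm_pos_iff.2 k.ne_zero

theorem minkowski_quadratic (x : SpacetimeIndex → ℝ) :
    x ⬝ᵥ (minkowski *ᵥ x) = -(x (Sum.inl ())) ^ 2 + ∑ i, x (Sum.inr i) ^ 2 := by
  simp only [minkowski, dotProduct, Matrix.mulVec, Fintype.sum_sum_type, Finset.univ_unique,
    Finset.sum_singleton, fromBlocks_apply₁₁, fromBlocks_apply₁₂, fromBlocks_apply₂₁,
    fromBlocks_apply₂₂, Matrix.zero_apply, Matrix.neg_apply, Matrix.one_apply, zero_mul,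
    Finset.sum_const_zero, add_zero, zero_add, ite_mul, one_mul, Finset.sum_ite_eq,
    Finset.mem_univ, if_true]
  simp [sq]

theorem Lorentz.null (Λ : Lorentz) (k : LightCone) :
    ∑ i, (Λ.mat *ᵥ fourMomentum k) (Sum.inr i) ^ 2 =
      (Λ.mat *ᵥ fourMomentum k) (Sum.inl ()) ^ 2 := by
  have h1 := minkowski_quadratic (Λ.mat *ᵥ fourMomentum k)
  have h2 := minkowski_quadratic (fourMomentum k)
  have h3 : (Λ.mat *ᵥ fourMomentum k) ⬝ᵥ (minkowski *ᵥ (Λ.mat *ᵥ fourMomentum k)) =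
      fourMomentum k ⬝ᵥ (minkowski *ᵥ fourMomentum k) := by
    conv_rhs => rw [← Λ.preserves]
    rw [← mulVec_mulVec, ← mulVec_mulVec, dotProduct_mulVec (fourMomentum k) Λ.matᵀ,
      vecMul_transpose]
  have h4 := fourMomentum_null k
  linarith

theorem Lorentz.future (Λ : Lorentz) (k : LightCone) :
    0 < (Λ.mat *ᵥ fourMomentum k) (Sum.inl ()) :=
  lorentz_future Λ.preserves Λ.pos _ (fourMomentum_pos k) (fourMomentum_null k).le

/-- The point of the light cone with four-momentum `Λ (|k|, k)`. -/
def lorentzAct (Λ : Lorentz) (k : LightCone) : LightCone :=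
  ⟨WithLp.toLp 2 (fun i => (Λ.mat *ᵥ fourMomentum k) (Sum.inr i)), by
    intro h
    have h0 : ∀ i, (Λ.mat *ᵥ fourMomentum k) (Sum.inr i) = 0 := fun i =>
      congrArg (fun v : Space => v i) h
    have h1 := Λ.null k
    simp only [h0] at h1
    have h2 := Λ.future k
    have h3 : 0 < (Λ.mat *ᵥ fourMomentum k) (Sum.inl ()) ^ 2 := by positivity
    rw [← h1] at h3
    simp at h3⟩

theorem fourMomentum_lorentzAct (Λ : Lorentz) (k : LightCone) :
    fourMomentum (lorentzAct Λ k) = Λ.mat *ᵥ fourMomentum k := by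
  funext μ
  rcases μ with ⟨⟩ | i
  · change ‖(lorentzAct Λ k : Space)‖ = _
    rw [EuclideanSpace.norm_eq, ← Real.sqrt_sq (Λ.future k).le, ← Λ.null k]
    simp [lorentzAct]
  · rfl

theorem fourMomentum_injective : Function.Injective fourMomentum := by
  intro k k' h
  apply Subtype.ext
  ext i
  exact congrFun h (Sum.inr i)

/-- The standard action of the Poincaré group on the light cone: Lorentz transformations act by
matrix multiplication on four-momenta, and translations act trivially. -/
instance : MulAction Poincare LightCone where
  smul g k := lorentzAct g.lor k
  one_smul k := fourMomentum_injective (by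
    change fourMomentum (lorentzAct 1 k) = _
    rw [fourMomentum_lorentzAct, Lorentz.mat_one, one_mulVec])
  mul_smul g h k := fourMomentum_injective (by
    change fourMomentum (lorentzAct (g.lor * h.lor) k) =
      fourMomentum (lorentzAct g.lor (lorentzAct h.lor k))
    rw [fourMomentum_lorentzAct, fourMomentum_lorentzAct, fourMomentum_lorentzAct,
      Lorentz.mat_mul, mulVec_mulVec])

theorem Poincare.fourMomentum_smul (g : Poincare) (k : LightCone) :
    fourMomentum (g • k) = g.lor.mat *ᵥ fourMomentum k := fourMomentum_lorentzAct g.lor k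

/-- The inclusion `SO(3) → ISO⁺(3,1)` of the spatial rotations. -/
def rotationHom : SO3 →* Poincare where
  toFun R := ⟨0, ⟨⟨fromBlocks 1 0 0 R.1, by
    rw [det_fromBlocks_zero₂₁, R.det_eq, det_one, mul_one]⟩, by
    refine ⟨?_, by simp⟩
    simp [minkowski, fromBlocks_transpose, fromBlocks_multiply, R.transpose_mul]⟩⟩
  map_one' := by
    apply Poincare.ext
    · rfl
    · apply Subtype.ext
      apply Subtype.ext
      exact fromBlocks_one
  map_mul' R S := by
    apply Poincare.ext
    · change (0 : SpacetimeIndex → ℝ) = 0 + _ *ᵥ 0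
      rw [mulVec_zero, add_zero]
    · apply Subtype.ext
      apply Subtype.ext
      change fromBlocks 1 0 0 (R.1 * S.1) = fromBlocks 1 0 0 R.1 * fromBlocks 1 0 0 S.1
      simp [fromBlocks_multiply]

theorem rotationHom_smul (R : SO3) (k : LightCone) : rotationHom R • k = R • k := by
  apply Subtype.ext
  ext i
  change (fromBlocks 1 0 0 R.1 *ᵥ fourMomentum k) (Sum.inr i) = (R.1 *ᵥ _) i
  simp [fromBlocks_mulVec, fourMomentum, Function.comp_def]

/-- A realization of a group as a set of points of a Euclidean space `ℝ^ι`; for the (closed) matrix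
groups below, the smooth structure of the group is the one induced by these coordinates. -/
class LieCoordinates (G : Type) where
  /-- the index type of the coordinates -/
  Idx : Type
  /-- the coordinates of a group element -/
  coord : G → Idx → ℝ

/-- The coordinates on `SO(3)` are the matrix entries. -/
instance : LieCoordinates SO3 where
  Idx := Fin 3 × Fin 3
  coord R p := R.1 p.1 p.2

/-- The coordinates on `ISO⁺(3,1)` are the components of the translation and the matrix entries of
the Lorentz transformation. -/
instance : LieCoordinates Poincare where
  Idx := SpacetimeIndex ⊕ SpacetimeIndex × SpacetimeIndex
  coord g := Sum.elim g.trans (fun p => g.lor.mat p.1 p.2)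

/-- A map from the open subset `U` of a Euclidean space to the group `G` is smooth if all its
coordinates are. -/
def SmoothInto {G : Type} [LieCoordinates G] {m : ℕ} (γ : EuclideanSpace ℝ (Fin m) → G)
    (U : Set (EuclideanSpace ℝ (Fin m))) : Prop :=
  ∀ i : LieCoordinates.Idx G, ContDiffOn ℝ ∞ (fun u => LieCoordinates.coord (γ u) i) U

/-! ### Smooth complex vector bundles over the light cone

A smooth complex vector bundle of rank `r` over the light cone is a family `E` of complex vector
spaces with a fibre bundle structure of model fibre `ℂ^r` whose trivializations are fibrewise
`ℂ`-linear and have smooth transition functions. -/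

/-- The model fibre of a bundle of rank `r`. -/
abbrev Fiber (r : ℕ) : Type := EuclideanSpace ℂ (Fin r)

/-- The model with corners of the total space of a bundle of rank `r` over the light cone. -/
abbrev totalModel (r : ℕ) :
    ModelWithCorners ℝ (Space × Fiber r) (ModelProd Space (Fiber r)) :=
  𝓘(ℝ, Space).prod 𝓘(ℝ, Fiber r)

section Bundles

universe u

variable (r : ℕ) (E : LightCone → Type u)
  [∀ k, AddCommGroup (E k)] [∀ k, Module ℂ (E k)] [∀ k, TopologicalSpace (E k)]
  [TopologicalSpace (TotalSpace (Fiber r) E)] [FiberBundle (Fiber r) E]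

/-- The bundle is (smoothly) trivial: it is isomorphic to the product bundle `L₊ × ℂ^r`, by a
fibrewise `ℂ`-linear diffeomorphism of total spaces over the identity of the base. -/
def IsTrivialBundle : Prop :=
  ∃ φ : ∀ k, E k ≃ₗ[ℂ] Fiber r,
    ContMDiff (totalModel r) (𝓘(ℝ, Space).prod 𝓘(ℝ, Fiber r)) ∞
      (fun v : TotalSpace (Fiber r) E => ((v.1, φ v.1 v.2) : LightCone × Fiber r)) ∧
    ContMDiff (𝓘(ℝ, Space).prod 𝓘(ℝ, Fiber r)) (totalModel r) ∞
      (fun p : LightCone × Fiber r => (⟨p.1, (φ p.1).symm p.2⟩ : TotalSpace (Fiber r) E))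

/-- A section of the bundle is smooth on a set. -/
def SmoothSectionOn (ψ : ∀ k, E k) (U : Set LightCone) : Prop :=
  ContMDiffOn 𝓘(ℝ, Space) (totalModel r) ∞
    (fun k => (⟨k, ψ k⟩ : TotalSpace (Fiber r) E)) U

/-- A family of linear subspaces of the fibres is a smooth subbundle: near every point it is spanned
by a smooth frame, of a fixed length (the rank). -/
def IsSubbundle (W : ∀ k, Submodule ℂ (E k)) : Prop :=
  ∃ d : ℕ, ∀ k₀ : LightCone, ∃ U : Set LightCone, IsOpen U ∧ k₀ ∈ U ∧
    ∃ s : Fin d → ∀ k, E k, (∀ i, SmoothSectionOn r E (s i) U) ∧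
      ∀ k ∈ U, LinearIndependent ℂ (fun i => s i k) ∧
        Submodule.span ℂ (Set.range fun i => s i k) = W k

/-- A smooth action `Σ` of the group `G` on the bundle `E` by fibrewise linear maps, covering the
given action of `G` on the light cone. -/
structure BundleAction (G : Type) [Group G] [MulAction G LightCone] [LieCoordinates G] where
  /-- the action on the total space -/
  act : G → TotalSpace (Fiber r) E → TotalSpace (Fiber r) E
  act_one : ∀ v, act 1 v = v
  act_mul : ∀ g h v, act (g * h) v = act g (act h v)
  /-- `act g` maps the fibre at `k` linearly to the fibre at `g • k` -/
  linear : ∀ (g : G) (k : LightCone), ∃ T : E k →ₗ[ℂ] E (g • k),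
    ∀ v : E k, act g ⟨k, v⟩ = ⟨g • k, T v⟩
  /-- the map `G × E → E` is smooth -/
  smooth : ∀ (m : ℕ) (U : Set (EuclideanSpace ℝ (Fin m))) (γ : EuclideanSpace ℝ (Fin m) → G),
    IsOpen U → SmoothInto γ U →
      ContMDiffOn (𝓘(ℝ, EuclideanSpace ℝ (Fin m)).prod (totalModel r)) (totalModel r) ∞
        (fun p : EuclideanSpace ℝ (Fin m) × TotalSpace (Fiber r) E => act (γ p.1) p.2)
        (U ×ˢ Set.univ)

variable {r E}

/-- The action is external: group elements that act in the same way on a base point `k` act in the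
same way on the fibre at `k`. -/
def BundleAction.IsExternal {G : Type} [Group G] [MulAction G LightCone] [LieCoordinates G]
    (A : BundleAction r E G) : Prop :=
  ∀ (g₁ g₂ : G) (k : LightCone), g₁ • k = g₂ • k → ∀ v : E k, A.act g₁ ⟨k, v⟩ = A.act g₂ ⟨k, v⟩

/-- The infinitesimal generators of a rotation action: the operators on sections
`(L_m ψ)(k) = i d/dt|₀ Σ_{R_m(t)} ψ(R_m(-t) k)`, where `R_m(t)` is the rotation by `t` about the
`m`-th axis. The curve differentiated lies in the fibre `E k`; its derivative is computed in a
linear chart of that fibre. -/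
def BundleAction.generator (A : BundleAction r E SO3) (m : Fin 3) (ψ : ∀ k, E k) : ∀ k, E k :=
  fun k => Complex.I • (trivializationAt (Fiber r) E k).symm k
    (deriv (fun t : ℝ => (trivializationAt (Fiber r) E k
      (A.act (rotationAbout (axis m) t)
        ⟨rotationAbout (axis m) (-t) • k, ψ (rotationAbout (axis m) (-t) • k)⟩)).2) 0)

/-- The restriction of an action of the Poincaré group to the spatial rotations. -/
def BundleAction.rotations (A : BundleAction r E Poincare) : BundleAction r E SO3 where
  act R := A.act (rotationHom R)
  act_one v := by rw [map_one, A.act_one]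
  act_mul R S v := by rw [map_mul, A.act_mul]
  linear R k := by
    have h := A.linear (rotationHom R) k
    rw [rotationHom_smul] at h
    exact h
  smooth m U γ hU hγ := by
    refine A.smooth m U (fun u => rotationHom (γ u)) hU ?_
    rintro (μ | ⟨⟨⟩ | i, ⟨⟩ | j⟩)
    · exact contDiffOn_const (c := (0 : ℝ))
    · exact contDiffOn_const (c := (1 : ℝ))
    · exact contDiffOn_const (c := (0 : ℝ))
    · exact contDiffOn_const (c := (0 : ℝ))
    · exact hγ (i, j)

variable (r E)

/-- A massless particle: a unitary irreducible representation of `ISO⁺(3,1)` on a nonzero Hermitian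
vector bundle of finite rank over the light cone, covering the standard action, such that the
inhomogeneous elements (null rotations) of the little groups act trivially. -/
structure MasslessParticle extends BundleAction r E Poincare where
  rank_pos : 0 < r
  /-- the Hermitian inner product on the fibres -/
  metric : ∀ k, InnerProductSpace.Core ℂ (E k)
  /-- the Hermitian inner product is smooth -/
  metric_smooth : ContMDiff (totalModel r) 𝓘(ℝ, ℝ) ∞
    (fun v : TotalSpace (Fiber r) E => ((metric v.1).inner v.2 v.2).re)
  /-- the action preserves the Hermitian inner product -/
  unitary : ∀ (g : Poincare) (k : LightCone) (v w : E k) (v' w' : E (g • k)),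
    act g ⟨k, v⟩ = ⟨g • k, v'⟩ → act g ⟨k, w⟩ = ⟨g • k, w'⟩ →
      (metric (g • k)).inner v' w' = (metric k).inner v w
  /-- there are no proper nonzero invariant subbundles -/
  irreducible : ∀ W : ∀ k, Submodule ℂ (E k), IsSubbundle r E W →
    (∀ (g : Poincare) (k : LightCone), ∀ v ∈ W k, (act g ⟨k, v⟩).2 ∈ W (act g ⟨k, v⟩).1) →
      (∀ k, W k = ⊥) ∨ (∀ k, W k = ⊤)
  /-- The little group `{Λ | Λ p = p}` of a null vector `p` is isomorphic to `ISO(2) = ℝ² ⋊ SO(2)`;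
  its inhomogeneous part `ℝ²` consists of the `Λ` that act trivially on the plane `p^⊥ / ℝ p`. -/
  inhomogeneous_trivial : ∀ (k : LightCone) (Λ : Lorentz),
    Λ.mat *ᵥ fourMomentum k = fourMomentum k →
    (∀ a : SpacetimeIndex → ℝ, fourMomentum k ⬝ᵥ (minkowski *ᵥ a) = 0 →
      ∃ c : ℝ, Λ.mat *ᵥ a - a = c • fourMomentum k) →
    ∀ v : E k, act ⟨0, Λ⟩ ⟨k, v⟩ = ⟨k, v⟩

variable {r E}

/-- The total angular momentum operators `J_1, J_2, J_3` of a massless particle: the generators of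
the spatial rotations. -/
def MasslessParticle.angularMomentum (P : MasslessParticle r E) (m : Fin 3) :
    (∀ k, E k) → ∀ k, E k :=
  P.toBundleAction.rotations.generator m

/-- The particle has helicity `h`: the rotation by `θ` about the direction of the momentum `k` acts
on the fibre at `k` as `exp(-i h θ)` (so that `J · k/|k| = h`). -/
def MasslessParticle.HasHelicity (P : MasslessParticle r E) (h : ℤ) : Prop :=
  ∀ (k : LightCone) (θ : ℝ) (v : E k),
    P.act (rotationHom (rotationAbout k θ)) ⟨k, v⟩ =
      ⟨k, Complex.exp (-(Complex.I * h * θ)) • v⟩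

/-- `V` is a vector operator for the particle: `[V_m, J_n] = i ε_{mnp} V_p` on smooth sections
(`ε_{mnp}` is the `p`-th component of `e_m × e_n`). -/
def MasslessParticle.IsVectorOperator (P : MasslessParticle r E)
    (V : Fin 3 → (∀ k, E k) → ∀ k, E k) : Prop :=
  ∀ (m n : Fin 3) (ψ : ∀ k, E k), SmoothSectionOn r E ψ Set.univ → ∀ k,
    V m (P.angularMomentum n ψ) k - P.angularMomentum n (V m ψ) k =
      Complex.I • ∑ p : Fin 3,
        (((crossProduct (Pi.single m 1) (Pi.single n 1) : Fin 3 → ℝ) p : ℝ) : ℂ) • V p ψ k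

/-- `L = (L_1, L_2, L_3)` is an external orbital angular momentum operator of the particle: a vector
operator which generates an external `SO(3)` action on the bundle that covers the standard rotation
action on the light cone. -/
def MasslessParticle.IsExternalOAM (P : MasslessParticle r E)
    (L : Fin 3 → (∀ k, E k) → ∀ k, E k) : Prop :=
  (∃ A : BundleAction r E SO3, A.IsExternal ∧ ∀ m, L m = A.generator m) ∧ P.IsVectorOperator L

end Bundles

end MasslessParticles

end

open MasslessParticles

open Bundle Matrix
open scoped Manifold ContDiff

set_option linter.unusedSectionVars false

noncomputable section

namespace MasslessParticles

/-! ### Rotations attached to quaternions -/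

/-! Triviality. The ray `axisRay` meets every sphere `|k| = const` once, and the bundle has a smooth
frame along this curve (`exists_frame_along`). An external rotation action carries the frame from
the ray to every `k`. The result does not depend on the rotation chosen, so local smooth choices of
rotations (`exists_smooth_rotation`) show that it is smooth. A global frame trivializes the bundle
(`isTrivialBundle_of_frame`).

Helicity. A subspace of one fibre that is invariant under the stabilizer spreads to an invariant
subbundle, so by irreducibility the stabilizer acts irreducibly (`MasslessParticle.eq_bot_or_top`).
Modulo null rotations, which act trivially, the stabilizer consists of translations and rotations
about the momentum. Conjugating translations by null rotations shows that transverse translations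
act trivially too, and then everything that remains commutes. As in Schur's lemma the stabilizer
acts by scalars, the rank is one, and the rotations about the momentum give a smooth character of
the circle, that is, an integer `h`. A Lorentz transformation carries the third axis to any other
momentum and intertwines the rotations about the two, so `h` is the same everywhere.

Necessity of `h = 0`. Let `A` be an external action and `B` the rotations of the particle. For `v ≠
0` over the third axis, `R ↦ B(R)⁻¹ A(R) v` is a nowhere zero map from `SO(3)` into one complex
line. On rotations by `θ` about the third axis `A` is the identity, so the map is `exp(i h θ) v`.
The loop run through twice extends to a family of rotations over the plane (`planeRotation`), so its
winding number `2 h` vanishes (`winding_eq_zero`).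

Sufficiency. If `h = 0`, every Lorentz transformation fixing a momentum acts trivially on its fibre,
so the rotations of the particle are external. Their generator is the total angular momentum, a
vector operator by the commutation relations of `SO(3)` (`SmoothOnSO3.commutator`).

Quaternions supply the rotations throughout: they give rational, hence smooth, families, and
conjugation merely rotates their vector part. -/

/-- The squared norm of the quaternion `(w, x)`. -/
def quatNormSq (w : ℝ) (x : Fin 3 → ℝ) : ℝ := w ^ 2 + x 0 ^ 2 + x 1 ^ 2 + x 2 ^ 2

/-- The matrix of the rotation attached to the nonzero quaternion `(w, x)`. -/
def quatMatrix (w : ℝ) (x : Fin 3 → ℝ) : Matrix (Fin 3) (Fin 3) ℝ :=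
  (quatNormSq w x)⁻¹ • ((w ^ 2 - x 0 ^ 2 - x 1 ^ 2 - x 2 ^ 2) • (1 : Matrix (Fin 3) (Fin 3) ℝ)
    + (2 * w) • !![0, -x 2, x 1; x 2, 0, -x 0; -x 1, x 0, 0] + (2 : ℝ) • vecMulVec x x)

theorem quatMatrix_mem {w : ℝ} {x : Fin 3 → ℝ} (h : quatNormSq w x ≠ 0) :
    quatMatrix w x ∈ Matrix.specialOrthogonalGroup (Fin 3) ℝ := by
  rw [Matrix.mem_specialOrthogonalGroup_iff, Matrix.mem_orthogonalGroup_iff]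
  have hN : (quatNormSq w x)⁻¹ * (w ^ 2 + x 0 ^ 2 + x 1 ^ 2 + x 2 ^ 2) = 1 :=
    inv_mul_cancel₀ h
  generalize hM : (quatNormSq w x)⁻¹ = N at hN
  constructor
  · ext i j
    fin_cases i <;> fin_cases j <;>
      simp [quatMatrix, hM, Matrix.mul_apply, Fin.sum_univ_three, vecMulVec_apply] <;> grind
  · simp only [quatMatrix, hM, Matrix.det_fin_three, vecMulVec_apply, Matrix.smul_apply,
      Matrix.add_apply, Matrix.one_apply, smul_eq_mul]
    simp
    -- The determinant of the unnormalized matrix is the cube of the squared norm.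
    have h3 : N ^ 3 * (w ^ 2 + x 0 ^ 2 + x 1 ^ 2 + x 2 ^ 2) ^ 3 = 1 := by
      rw [← mul_pow, hN, one_pow]
    linear_combination h3

open Classical in
/-- The rotation attached to the quaternion `(w, x)`, by convention `1` if the quaternion is `0`. -/
def quatRotation (w : ℝ) (x : Fin 3 → ℝ) : SO3 :=
  if h : quatNormSq w x ≠ 0 then ⟨quatMatrix w x, quatMatrix_mem h⟩ else 1

theorem quatRotation_val {w : ℝ} {x : Fin 3 → ℝ} (h : quatNormSq w x ≠ 0) :
    (quatRotation w x).1 = quatMatrix w x := by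
  rw [quatRotation, dif_pos h]

theorem SO3.ext {R S : SO3} (h : R.1 = S.1) : R = S := Subtype.ext h

theorem SO3.coe_inv (R : SO3) : (R⁻¹).1 = R.1ᵀ := by
  have h : R.1 * (R⁻¹).1 = 1 := congrArg Subtype.val (mul_inv_cancel R)
  calc (R⁻¹).1 = (R.1ᵀ * R.1) * (R⁻¹).1 := by rw [R.transpose_mul, Matrix.one_mul]
    _ = R.1ᵀ := by rw [Matrix.mul_assoc, h, Matrix.mul_one]

theorem SO3.adjugate_eq (R : SO3) : R.1.adjugate = R.1ᵀ := by
  have h : R.1 * R.1.adjugate = 1 := by rw [Matrix.mul_adjugate, R.det_eq, one_smul]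
  calc R.1.adjugate = (R.1ᵀ * R.1) * R.1.adjugate := by rw [R.transpose_mul, Matrix.one_mul]
    _ = R.1ᵀ := by rw [Matrix.mul_assoc, h, Matrix.mul_one]

/-- The matrix of `v ↦ x × v`. -/
def crossMatrix (x : Fin 3 → ℝ) : Matrix (Fin 3) (Fin 3) ℝ :=
  !![0, -x 2, x 1; x 2, 0, -x 0; -x 1, x 0, 0]

/-- Rotations preserve the cross product. The transpose of `R` is its adjugate, so each entry of `R`
equals its own cofactor, and every entry of the identity is a combination of these nine relations.
-/
theorem SO3.conj_crossMatrix (R : SO3) (x : Fin 3 → ℝ) :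
    R.1 * crossMatrix x * R.1ᵀ = crossMatrix (R.1 *ᵥ x) := by
  have h := R.adjugate_eq
  rw [Matrix.adjugate_fin_three] at h
  have h' := fun i j => congrFun (congrFun h i) j
  have h00 := h' 0 0
  have h01 := h' 0 1
  have h02 := h' 0 2
  have h10 := h' 1 0
  have h11 := h' 1 1
  have h12 := h' 1 2
  have h20 := h' 2 0
  have h21 := h' 2 1
  have h22 := h' 2 2
  clear h h'
  simp [Matrix.transpose_apply] at h00 h01 h02 h10 h11 h12 h20 h21 h22
  ext i j
  fin_cases i <;> fin_cases j <;>
    simp [crossMatrix, Matrix.mul_apply, Fin.sum_univ_three, Matrix.mulVec, dotProduct]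
  · ring
  · linear_combination - x 0 * h02 - x 1 * h12 - x 2 * h22
  · linear_combination x 0 * h01 + x 1 * h11 + x 2 * h21
  · linear_combination x 0 * h02 + x 1 * h12 + x 2 * h22
  · ring
  · linear_combination - x 0 * h00 - x 1 * h10 - x 2 * h20
  · linear_combination - x 0 * h01 - x 1 * h11 - x 2 * h21
  · linear_combination x 0 * h00 + x 1 * h10 + x 2 * h20
  · ring

theorem SO3.dotProduct_mulVec_self (R : SO3) (x : Fin 3 → ℝ) :
    (R.1 *ᵥ x) ⬝ᵥ (R.1 *ᵥ x) = x ⬝ᵥ x := by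
  rw [Matrix.dotProduct_mulVec, Matrix.vecMul_mulVec, R.transpose_mul,
    Matrix.vecMul_one]

theorem quatNormSq_eq (w : ℝ) (x : Fin 3 → ℝ) : quatNormSq w x = w ^ 2 + x ⬝ᵥ x := by
  simp [quatNormSq, dotProduct, Fin.sum_univ_three]; ring

theorem quatMatrix_eq (w : ℝ) (x : Fin 3 → ℝ) :
    quatMatrix w x = (quatNormSq w x)⁻¹ • ((w ^ 2 - x ⬝ᵥ x) • (1 : Matrix (Fin 3) (Fin 3) ℝ)
      + (2 * w) • crossMatrix x + (2 : ℝ) • vecMulVec x x) := by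
  have h : w ^ 2 - x ⬝ᵥ x = w ^ 2 - x 0 ^ 2 - x 1 ^ 2 - x 2 ^ 2 := by
    simp [dotProduct, Fin.sum_univ_three]; ring
  rw [quatMatrix, crossMatrix, h]

theorem quatNormSq_mulVec (R : SO3) (w : ℝ) (x : Fin 3 → ℝ) :
    quatNormSq w (R.1 *ᵥ x) = quatNormSq w x := by
  rw [quatNormSq_eq, quatNormSq_eq, R.dotProduct_mulVec_self]

/-- Rotations fix the scalars, `crossMatrix` and `vecMulVec` are equivariant, and these are the
three ingredients of `quatMatrix`. The convention at the zero quaternion is compatible, since both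
sides are then `1`. -/
theorem quatRotation_conj (R : SO3) (w : ℝ) (x : Fin 3 → ℝ) :
    R * quatRotation w x * R⁻¹ = quatRotation w (R.1 *ᵥ x) := by
  by_cases h : quatNormSq w x ≠ 0
  · apply SO3.ext
    have h' : quatNormSq w (R.1 *ᵥ x) ≠ 0 := by rwa [quatNormSq_mulVec]
    change R.1 * (quatRotation w x).1 * (R⁻¹).1 = _
    rw [quatRotation_val h, quatRotation_val h', quatMatrix_eq, quatMatrix_eq, SO3.coe_inv,
      quatNormSq_mulVec, R.dotProduct_mulVec_self, ← R.conj_crossMatrix]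
    simp only [Matrix.mul_smul, Matrix.smul_mul, Matrix.mul_add, Matrix.add_mul, Matrix.mul_one,
      R.mul_transpose, Matrix.mul_vecMulVec, Matrix.vecMulVec_mul, Matrix.vecMul_transpose]
  · have h' : ¬ quatNormSq w (R.1 *ᵥ x) ≠ 0 := by rwa [quatNormSq_mulVec]
    rw [quatRotation, quatRotation, dif_neg h, dif_neg h', mul_one, mul_inv_cancel]

theorem SO3.ofLp_smul (R : SO3) (k : LightCone) :
    WithLp.ofLp ((R • k : LightCone) : Space) = R.1 *ᵥ WithLp.ofLp (k : Space) := rfl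

theorem Space.norm_sq (x : Space) : ‖x‖ ^ 2 = WithLp.ofLp x ⬝ᵥ WithLp.ofLp x := by
  rw [EuclideanSpace.norm_sq_eq]
  simp [dotProduct, sq]

theorem SO3.norm_smul (R : SO3) (k : LightCone) : ‖((R • k : LightCone) : Space)‖ = ‖(k : Space)‖ := by
  rw [← sq_eq_sq₀ (norm_nonneg _) (norm_nonneg _), Space.norm_sq, Space.norm_sq, SO3.ofLp_smul,
    R.dotProduct_mulVec_self]

/-- The direction of `k`, a unit vector. -/
def LightCone.dir (k : LightCone) : Fin 3 → ℝ := WithLp.ofLp (‖(k : Space)‖⁻¹ • (k : Space))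

theorem LightCone.dir_eq (k : LightCone) : k.dir = ‖(k : Space)‖⁻¹ • WithLp.ofLp (k : Space) := rfl

theorem LightCone.norm_ne_zero (k : LightCone) : ‖(k : Space)‖ ≠ 0 := norm_ne_zero_iff.2 k.ne_zero

theorem LightCone.dir_dotProduct (k : LightCone) : k.dir ⬝ᵥ k.dir = 1 := by
  rw [LightCone.dir_eq, smul_dotProduct, dotProduct_smul, ← Space.norm_sq]
  have := k.norm_ne_zero
  simp only [smul_eq_mul]
  field_simp

theorem LightCone.dir_smul (R : SO3) (k : LightCone) : (R • k).dir = R.1 *ᵥ k.dir := by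
  rw [LightCone.dir_eq, LightCone.dir_eq, SO3.norm_smul, SO3.ofLp_smul, Matrix.mulVec_smul]

theorem quatNormSq_half (n : Fin 3 → ℝ) (hn : n ⬝ᵥ n = 1) (θ : ℝ) :
    quatNormSq (Real.cos (θ / 2)) (Real.sin (θ / 2) • n) = 1 := by
  rw [quatNormSq_eq, smul_dotProduct, dotProduct_smul, hn]
  simp only [smul_eq_mul]
  linear_combination Real.sin_sq_add_cos_sq (θ / 2)

theorem rotationAbout_eq (k : LightCone) (θ : ℝ) :
    rotationAbout k θ = quatRotation (Real.cos (θ / 2)) (Real.sin (θ / 2) • k.dir) := by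
  apply SO3.ext
  have h1 := quatNormSq_half k.dir k.dir_dotProduct θ
  rw [quatRotation_val (by rw [h1]; exact one_ne_zero), quatMatrix_eq, h1]
  change rodrigues k.dir θ = _
  rw [rodrigues, smul_dotProduct, dotProduct_smul, k.dir_dotProduct]
  have hc : Real.cos θ = Real.cos (θ / 2) ^ 2 - Real.sin (θ / 2) ^ 2 := by
    rw [← Real.cos_two_mul', mul_div_cancel₀ _ two_ne_zero]
  have hs : Real.sin θ = 2 * Real.sin (θ / 2) * Real.cos (θ / 2) := by
    rw [← Real.sin_two_mul, mul_div_cancel₀ _ two_ne_zero]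
  have hh := Real.sin_sq_add_cos_sq (θ / 2)
  rw [hc, hs]
  generalize Real.cos (θ / 2) = c at *
  generalize Real.sin (θ / 2) = s at *
  generalize k.dir = n
  have h2 : 1 - (c ^ 2 - s ^ 2) = 2 * s * s := by linear_combination -hh
  rw [h2]
  ext i j
  fin_cases i <;> fin_cases j <;> simp [crossMatrix, vecMulVec_apply] <;> ring

theorem rotationAbout_conj (R : SO3) (k : LightCone) (θ : ℝ) :
    R * rotationAbout k θ * R⁻¹ = rotationAbout (R • k) θ := by
  rw [rotationAbout_eq, rotationAbout_eq, quatRotation_conj, LightCone.dir_smul,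
    Matrix.mulVec_smul]

/-- Used to divide a half-angle quaternion by its cosine, which puts it in the form `(1, tan(t/2)
n)`. -/
theorem quatRotation_smul {w : ℝ} {x : Fin 3 → ℝ} {c : ℝ} (hc : c ≠ 0) :
    quatRotation (c * w) (c • x) = quatRotation w x := by
  have h : quatNormSq (c * w) (c • x) = c ^ 2 * quatNormSq w x := by
    simp [quatNormSq]; ring
  by_cases h0 : quatNormSq w x ≠ 0
  · have h1 : quatNormSq (c * w) (c • x) ≠ 0 := by rw [h]; positivity
    apply SO3.ext
    rw [quatRotation_val h0, quatRotation_val h1, quatMatrix, quatMatrix, h]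
    ext i j
    fin_cases i <;> fin_cases j <;> simp [vecMulVec_apply] <;> field_simp
  · have h1 : ¬ quatNormSq (c * w) (c • x) ≠ 0 := by
      push Not at h0 ⊢
      rw [h, h0, mul_zero]
    rw [quatRotation, quatRotation, dif_neg h0, dif_neg h1]

/-- The half turn about the bisector of two vectors of the same length exchanges them. -/
theorem quatRotation_half_turn {x y : Fin 3 → ℝ} (h : x ⬝ᵥ x = y ⬝ᵥ y) (hxy : x + y ≠ 0) :
    (quatRotation 0 (x + y)).1 *ᵥ x = y := by
  have h0 : quatNormSq 0 (x + y) ≠ 0 := by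
    rw [quatNormSq_eq]
    simpa using fun h => hxy (dotProduct_self_eq_zero.1 h)
  rw [quatRotation_val h0, quatMatrix_eq, quatNormSq_eq]
  have h1 : (x + y) ⬝ᵥ (x + y) ≠ 0 := fun h => hxy (dotProduct_self_eq_zero.1 h)
  have h2 : (x + y) ⬝ᵥ (x + y) = 2 * ((x + y) ⬝ᵥ x) := by
    simp only [add_dotProduct, dotProduct_add]
    rw [dotProduct_comm x y]
    linarith
  simp only [Matrix.smul_mulVec, Matrix.add_mulVec, Matrix.one_mulVec, mul_zero, zero_smul,
    add_zero, Matrix.vecMulVec_mulVec]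
  generalize hD : (x + y) ⬝ᵥ (x + y) = D at *
  have h3 : (x + y) ⬝ᵥ x = D / 2 := by linarith
  rw [h3]
  ext i
  simp
  field_simp
  ring

/-! ### Smoothness of maps into the groups and into the light cone -/

/-- The chart of an open subset is its inclusion, so smoothness can be tested in the ambient space.
-/
theorem contMDiffWithinAt_lightCone_iff {F H M : Type*} [NormedAddCommGroup F] [NormedSpace ℝ F]
    [TopologicalSpace H] {I : ModelWithCorners ℝ F H} [TopologicalSpace M] [ChartedSpace H M]
    {f : M → LightCone} {s : Set M} {x : M} :
    ContMDiffWithinAt I 𝓘(ℝ, Space) ∞ f s x ↔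
      ContMDiffWithinAt I 𝓘(ℝ, Space) ∞ (fun y => (f y : Space)) s x := by
  rw [contMDiffWithinAt_iff_target]
  exact ⟨fun h => h.2, fun h =>
    ⟨Topology.IsInducing.subtypeVal.continuousWithinAt_iff.2 h.continuousWithinAt, h⟩⟩

theorem contMDiff_lightCone_coe :
    ContMDiff 𝓘(ℝ, Space) 𝓘(ℝ, Space) ∞ (fun k : LightCone => (k : Space)) :=
  contMDiff_subtype_val

theorem SmoothInto.mono {G : Type} [LieCoordinates G] {m : ℕ} {γ : EuclideanSpace ℝ (Fin m) → G}
    {U V : Set (EuclideanSpace ℝ (Fin m))} (h : SmoothInto γ U) (hVU : V ⊆ U) : SmoothInto γ V :=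
  fun i => (h i).mono hVU

theorem smoothInto_const {G : Type} [LieCoordinates G] {m : ℕ} (g : G)
    (U : Set (EuclideanSpace ℝ (Fin m))) : SmoothInto (fun _ => g) U :=
  fun _ => contDiffOn_const

theorem SmoothInto.mul_SO3 {m : ℕ} {γ δ : EuclideanSpace ℝ (Fin m) → SO3}
    {U : Set (EuclideanSpace ℝ (Fin m))} (hγ : SmoothInto γ U) (hδ : SmoothInto δ U) :
    SmoothInto (fun u => γ u * δ u) U := by
  rintro ⟨i, j⟩
  change ContDiffOn ℝ ∞ (fun u => ((γ u).1 * (δ u).1) i j) U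
  simp only [Matrix.mul_apply]
  exact ContDiffOn.sum fun l _ => (hγ (i, l)).mul (hδ (l, j))

theorem SmoothInto.inv_SO3 {m : ℕ} {γ : EuclideanSpace ℝ (Fin m) → SO3}
    {U : Set (EuclideanSpace ℝ (Fin m))} (hγ : SmoothInto γ U) :
    SmoothInto (fun u => (γ u)⁻¹) U := by
  rintro ⟨i, j⟩
  change ContDiffOn ℝ ∞ (fun u => ((γ u)⁻¹).1 i j) U
  simp only [SO3.coe_inv]
  exact hγ (j, i)

theorem SmoothInto.mul_poincare {m : ℕ} {γ δ : EuclideanSpace ℝ (Fin m) → Poincare}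
    {U : Set (EuclideanSpace ℝ (Fin m))} (hγ : SmoothInto γ U) (hδ : SmoothInto δ U) :
    SmoothInto (fun u => γ u * δ u) U := by
  rintro (μ | ⟨μ, ν⟩)
  · change ContDiffOn ℝ ∞ (fun u => (γ u).trans μ +
      ∑ l, (γ u).lor.mat μ l * (δ u).trans l) U
    exact (hγ (Sum.inl μ)).add
      (ContDiffOn.sum fun l _ => (hγ (Sum.inr (μ, l))).mul (hδ (Sum.inl l)))
  · change ContDiffOn ℝ ∞ (fun u => ((γ u).lor.mat * (δ u).lor.mat) μ ν) U
    simp only [Matrix.mul_apply]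
    exact ContDiffOn.sum fun l _ => (hγ (Sum.inr (μ, l))).mul (hδ (Sum.inr (l, ν)))

theorem SmoothInto.rotationHom {m : ℕ} {γ : EuclideanSpace ℝ (Fin m) → SO3}
    {U : Set (EuclideanSpace ℝ (Fin m))} (hγ : SmoothInto γ U) :
    SmoothInto (fun u => rotationHom (γ u)) U := by
  rintro (μ | ⟨⟨⟩ | i, ⟨⟩ | j⟩)
  · exact contDiffOn_const (c := (0 : ℝ))
  · exact contDiffOn_const (c := (1 : ℝ))
  · exact contDiffOn_const (c := (0 : ℝ))
  · exact contDiffOn_const (c := (0 : ℝ))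
  · exact hγ (i, j)

theorem smoothInto_quatRotation {m : ℕ} {w : EuclideanSpace ℝ (Fin m) → ℝ}
    {x : EuclideanSpace ℝ (Fin m) → Fin 3 → ℝ} {U : Set (EuclideanSpace ℝ (Fin m))}
    (hw : ContDiffOn ℝ ∞ w U) (hx : ∀ i, ContDiffOn ℝ ∞ (fun u => x u i) U)
    (h : ∀ u ∈ U, quatNormSq (w u) (x u) ≠ 0) :
    SmoothInto (fun u => quatRotation (w u) (x u)) U := by
  rintro ⟨i, j⟩
  have h0 := hx 0
  have h1 := hx 1
  have h2 := hx 2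
  have hN : ContDiffOn ℝ ∞ (fun u => quatNormSq (w u) (x u)) U := by
    unfold quatNormSq
    fun_prop
  have hM : ContDiffOn ℝ ∞ (fun u => quatMatrix (w u) (x u) i j) U := by
    unfold quatMatrix
    refine (hN.inv h).mul ?_
    fin_cases i <;> fin_cases j <;> simp [vecMulVec_apply] <;> fun_prop
  refine hM.congr fun u hu => ?_
  change (quatRotation (w u) (x u)).1 i j = _
  rw [quatRotation_val (h u hu)]

theorem smoothInto_rotationAbout {m : ℕ} (k : LightCone) {θ : EuclideanSpace ℝ (Fin m) → ℝ}
    {U : Set (EuclideanSpace ℝ (Fin m))} (hθ : ContDiffOn ℝ ∞ θ U) :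
    SmoothInto (fun u => rotationAbout k (θ u)) U := by
  simp only [rotationAbout_eq]
  refine smoothInto_quatRotation ?_ ?_ ?_
  · exact Real.contDiff_cos.comp_contDiffOn (hθ.div_const 2)
  · intro i
    exact (Real.contDiff_sin.comp_contDiffOn (hθ.div_const 2)).mul contDiffOn_const
  · intro u _
    rw [quatNormSq_half _ k.dir_dotProduct]
    exact one_ne_zero

/-! ### Local sections of the rotation group -/

/-- The point of the light cone with momentum `exp t` along the third axis. -/
def axisRay (t : ℝ) : LightCone :=
  ⟨Real.exp t • (axis 2 : Space), smul_ne_zero (Real.exp_ne_zero t) (axis 2).ne_zero⟩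

theorem norm_axis (m : Fin 3) : ‖(axis m : Space)‖ = 1 := by simp [axis]

theorem contMDiff_axisRay : ContMDiff 𝓘(ℝ, ℝ) 𝓘(ℝ, Space) ∞ axisRay := by
  intro t
  refine contMDiffWithinAt_lightCone_iff.2 ?_
  refine ContMDiff.contMDiffAt ?_
  exact (Real.contDiff_exp.smul contDiff_const).contMDiff

theorem contMDiff_log_norm :
    ContMDiff 𝓘(ℝ, Space) 𝓘(ℝ, ℝ) ∞ (fun k : LightCone => Real.log ‖(k : Space)‖) := by
  intro k
  have h : ContDiffAt ℝ ∞ (fun x : Space => Real.log ‖x‖) (k : Space) :=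
    (contDiffAt_norm ℝ k.ne_zero).log k.norm_ne_zero
  exact h.contMDiffAt.comp k contMDiff_lightCone_coe.contMDiffAt

/-- The half turn about `x + y` works unless `y = -x`. In that case two half turns are composed,
through an intermediate vector `z` of the same length with `z ≠ ± x`. -/
theorem exists_rotation_of_dotProduct_eq {x y : Fin 3 → ℝ} (hx : x ⬝ᵥ x = y ⬝ᵥ y) :
    ∃ R : SO3, R.1 *ᵥ x = y := by
  by_cases hxy : x + y = 0
  · by_cases hx0 : x = 0
    · refine ⟨1, ?_⟩
      have : y = 0 := by simpa [hx0] using hxy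
      simp [hx0, this]
    obtain ⟨z, hz, hxz⟩ : ∃ z : Fin 3 → ℝ, z ⬝ᵥ z = x ⬝ᵥ x ∧ x ≠ z ∧ x ≠ -z := by
      by_contra! hcon
      -- The candidates for `z` are two quarter turns of `x`. If each were `x` or `-x`, the first
      -- would kill `x 0` and `x 1`, the second `x 2`.
      have h1 := hcon ![x 1, -x 0, x 2] (by simp [dotProduct, Fin.sum_univ_three]; ring)
      have h2 := hcon ![x 0, x 2, -x 1] (by simp [dotProduct, Fin.sum_univ_three]; ring)
      apply hx0
      have hP : ∀ u v : Fin 3 → ℝ, u = v → u 0 = v 0 ∧ u 1 = v 1 ∧ u 2 = v 2 := by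
        rintro u v rfl
        simp
      have q1 : x 0 = 0 ∧ x 1 = 0 := by
        by_cases h : x = ![x 1, -x 0, x 2]
        · have := hP _ _ h
          simp at this
          constructor <;> linarith
        · have := hP _ _ (h1 h)
          simp at this
          constructor <;> linarith
      have q2 : x 2 = 0 := by
        by_cases h : x = ![x 0, x 2, -x 1]
        · have := hP _ _ h
          simp at this
          linarith
        · have := hP _ _ (h2 h)
          simp at this
          linarith
      ext i
      fin_cases i
      exacts [q1.1, q1.2, q2]
    refine ⟨quatRotation 0 (z + y) * quatRotation 0 (x + z), ?_⟩
    change ((quatRotation 0 (z + y)).1 * (quatRotation 0 (x + z)).1) *ᵥ x = y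
    rw [← Matrix.mulVec_mulVec, quatRotation_half_turn hz.symm, quatRotation_half_turn (hz.trans hx)]
    · intro h
      apply hxz.1
      have h' : z + y = x + y := h.trans hxy.symm
      exact (add_right_cancel h').symm
    · intro h
      exact hxz.2 (eq_neg_of_add_eq_zero_left h)
  · exact ⟨quatRotation 0 (x + y), quatRotation_half_turn hx hxy⟩

theorem LightCone.norm_smul_dir (k : LightCone) :
    ‖(k : Space)‖ • k.dir = WithLp.ofLp (k : Space) := by
  rw [LightCone.dir_eq, smul_smul, mul_inv_cancel₀ k.norm_ne_zero, one_smul]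

theorem ofLp_axisRay_log (k : LightCone) :
    WithLp.ofLp (axisRay (Real.log ‖(k : Space)‖) : Space) =
      ‖(k : Space)‖ • WithLp.ofLp (axis 2 : Space) := by
  change Real.exp _ • WithLp.ofLp (axis 2 : Space) = _
  rw [Real.exp_log (norm_pos_iff.2 k.ne_zero)]

/-- Near every point, there is a smooth choice of a rotation that carries the third axis to the
direction of `k`. -/
theorem exists_smooth_rotation (k₁ : LightCone) :
    ∃ (U : Set Space) (γ : Space → SO3), IsOpen U ∧ (k₁ : Space) ∈ U ∧ SmoothInto γ U ∧
      ∀ k : LightCone, (k : Space) ∈ U → γ k • axisRay (Real.log ‖(k : Space)‖) = k := by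
  obtain ⟨R, hR⟩ : ∃ R : SO3, R.1 *ᵥ WithLp.ofLp (axis 2 : Space) = k₁.dir := by
    apply exists_rotation_of_dotProduct_eq
    rw [k₁.dir_dotProduct, ← Space.norm_sq, norm_axis, one_pow]
  -- A fixed rotation `R` carries the third axis to the direction of `k₁`. The half turn about `v k`
  -- then carries `‖k‖ • k₁.dir` to `k`, and depends smoothly on `k` away from the ray opposite to
  -- `k₁`.
  let v : Space → Fin 3 → ℝ := fun k => ‖k‖ • k₁.dir + WithLp.ofLp k
  have hv : Continuous v := by fun_prop
  have hopen : IsOpen {k : Space | k ≠ 0 ∧ v k ≠ 0} :=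
    isOpen_ne.inter (isOpen_ne.preimage hv)
  refine ⟨{k | k ≠ 0 ∧ v k ≠ 0}, fun k => quatRotation 0 (v k) * R, hopen, ?_, ?_, ?_⟩
  · refine ⟨k₁.ne_zero, ?_⟩
    change ‖(k₁ : Space)‖ • k₁.dir + WithLp.ofLp (k₁ : Space) ≠ 0
    rw [k₁.norm_smul_dir, ← two_smul ℝ]
    refine smul_ne_zero two_ne_zero ?_
    simpa using k₁.ne_zero
  · refine SmoothInto.mul_SO3 (smoothInto_quatRotation contDiffOn_const ?_ ?_)
      (smoothInto_const R _)
    · intro i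
      refine ContDiffOn.add (ContDiffOn.mul ?_ contDiffOn_const) ?_
      · exact fun k hk => (contDiffAt_norm ℝ hk.1).contDiffWithinAt
      · exact (EuclideanSpace.proj i : Space →L[ℝ] ℝ).contDiff.contDiffOn
    · intro k hk
      rw [quatNormSq_eq]
      simpa using fun h => hk.2 (dotProduct_self_eq_zero.1 h)
  · intro k hk
    apply Subtype.ext
    apply WithLp.ofLp_injective
    rw [mul_smul, SO3.ofLp_smul, SO3.ofLp_smul, ofLp_axisRay_log, Matrix.mulVec_smul, hR]
    refine quatRotation_half_turn ?_ hk.2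
    rw [smul_dotProduct, dotProduct_smul, k₁.dir_dotProduct, ← Space.norm_sq]
    simp [sq]

/-! ### Lorentz transformations -/

/-- The enumeration of the spacetime indices. -/
def spacetimeEquiv : Fin 4 ≃ SpacetimeIndex where
  toFun := ![Sum.inl (), Sum.inr 0, Sum.inr 1, Sum.inr 2]
  invFun := Sum.elim (fun _ => 0) ![1, 2, 3]
  left_inv i := by fin_cases i <;> rfl
  right_inv i := by
    rcases i with ⟨⟩ | i
    · rfl
    · fin_cases i <;> rfl

/-- A spacetime matrix given by its sixteen entries. -/
def spacetimeMatrix (A : Matrix (Fin 4) (Fin 4) ℝ) : Matrix SpacetimeIndex SpacetimeIndex ℝ :=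
  A.submatrix spacetimeEquiv.symm spacetimeEquiv.symm

theorem det_spacetimeMatrix (A : Matrix (Fin 4) (Fin 4) ℝ) : (spacetimeMatrix A).det = A.det :=
  Matrix.det_submatrix_equiv_self _ _

/-- The null rotations that fix the momentum along the third axis. -/
def nullRotationMatrix (u v : ℝ) : Matrix SpacetimeIndex SpacetimeIndex ℝ :=
  spacetimeMatrix !![1 + (u ^ 2 + v ^ 2) / 2, u, v, -((u ^ 2 + v ^ 2) / 2);
    u, 1, 0, -u;
    v, 0, 1, -v;
    (u ^ 2 + v ^ 2) / 2, u, v, 1 - (u ^ 2 + v ^ 2) / 2]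

/-- The boost of rapidity `t` along the third axis. -/
def boostMatrix (t : ℝ) : Matrix SpacetimeIndex SpacetimeIndex ℝ :=
  spacetimeMatrix !![Real.cosh t, 0, 0, Real.sinh t;
    0, 1, 0, 0;
    0, 0, 1, 0;
    Real.sinh t, 0, 0, Real.cosh t]

theorem det_fin_four (A : Matrix (Fin 4) (Fin 4) ℝ) :
    A.det = A 0 0 * (A 1 1 * A 2 2 * A 3 3 - A 1 1 * A 2 3 * A 3 2 - A 1 2 * A 2 1 * A 3 3
        + A 1 2 * A 2 3 * A 3 1 + A 1 3 * A 2 1 * A 3 2 - A 1 3 * A 2 2 * A 3 1)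
      - A 0 1 * (A 1 0 * A 2 2 * A 3 3 - A 1 0 * A 2 3 * A 3 2 - A 1 2 * A 2 0 * A 3 3
        + A 1 2 * A 2 3 * A 3 0 + A 1 3 * A 2 0 * A 3 2 - A 1 3 * A 2 2 * A 3 0)
      + A 0 2 * (A 1 0 * A 2 1 * A 3 3 - A 1 0 * A 2 3 * A 3 1 - A 1 1 * A 2 0 * A 3 3
        + A 1 1 * A 2 3 * A 3 0 + A 1 3 * A 2 0 * A 3 1 - A 1 3 * A 2 1 * A 3 0)
      - A 0 3 * (A 1 0 * A 2 1 * A 3 2 - A 1 0 * A 2 2 * A 3 1 - A 1 1 * A 2 0 * A 3 2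
        + A 1 1 * A 2 2 * A 3 0 + A 1 2 * A 2 0 * A 3 1 - A 1 2 * A 2 1 * A 3 0) := by
  rw [Matrix.det_succ_row_zero]
  simp only [Fin.sum_univ_succ, Matrix.det_fin_three, Matrix.submatrix_apply]
  simp [Fin.succAbove, Fin.lt_def]
  ring

/-- The Lorentz transformation with a given matrix. -/
def Lorentz.ofMatrix (A : Matrix SpacetimeIndex SpacetimeIndex ℝ)
    (hA : Aᵀ * minkowski * A = minkowski) (h0 : 0 < A (Sum.inl ()) (Sum.inl ()))
    (hdet : A.det = 1) : Lorentz :=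
  ⟨⟨A, hdet⟩, hA, h0⟩

theorem Lorentz.ext {Λ Λ' : Lorentz} (h : Λ.mat = Λ'.mat) : Λ = Λ' :=
  Subtype.ext (Subtype.ext h)

theorem minkowski_eq : minkowski = spacetimeMatrix (Matrix.diagonal ![-1, 1, 1, 1]) := by
  ext i j
  rcases i with ⟨⟩ | i <;> rcases j with ⟨⟩ | j
  · simp [minkowski, spacetimeMatrix, spacetimeEquiv]
  · fin_cases j <;> simp [minkowski, spacetimeMatrix, spacetimeEquiv, Matrix.diagonal]
  · fin_cases i <;> simp [minkowski, spacetimeMatrix, spacetimeEquiv, Matrix.diagonal]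
  · fin_cases i <;> fin_cases j <;>
      simp [minkowski, spacetimeMatrix, spacetimeEquiv, Matrix.diagonal]

theorem spacetimeMatrix_preserves {A : Matrix (Fin 4) (Fin 4) ℝ}
    (h : Aᵀ * Matrix.diagonal ![-1, 1, 1, 1] * A = Matrix.diagonal ![-1, 1, 1, 1]) :
    (spacetimeMatrix A)ᵀ * minkowski * spacetimeMatrix A = minkowski := by
  rw [minkowski_eq, spacetimeMatrix, spacetimeMatrix, Matrix.transpose_submatrix,
    Matrix.submatrix_mul_equiv, Matrix.submatrix_mul_equiv, h]

/-- The null rotations that fix the momentum along the third axis. -/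
def nullRotation (u v : ℝ) : Lorentz :=
  Lorentz.ofMatrix (nullRotationMatrix u v)
    (spacetimeMatrix_preserves (by
      ext i j
      fin_cases i <;> fin_cases j <;>
        simp [Matrix.mul_apply, Fin.sum_univ_four, Matrix.diagonal] <;> ring))
    (by
      change 0 < 1 + (u ^ 2 + v ^ 2) / 2
      positivity)
    (by
      rw [nullRotationMatrix, det_spacetimeMatrix, det_fin_four]
      simp
      ring)

/-- The boost of rapidity `t` along the third axis. -/
def boost (t : ℝ) : Lorentz :=
  Lorentz.ofMatrix (boostMatrix t)
    (spacetimeMatrix_preserves (by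
      have h := Real.cosh_sq t
      ext i j
      fin_cases i <;> fin_cases j <;>
        simp [Matrix.mul_apply, Fin.sum_univ_four, Matrix.diagonal] <;> linarith))
    (Real.cosh_pos t)
    (by
      rw [boostMatrix, det_spacetimeMatrix, det_fin_four]
      have h := Real.cosh_sq t
      simp
      linarith)

theorem smoothInto_boost {m : ℕ} {θ : EuclideanSpace ℝ (Fin m) → ℝ}
    {U : Set (EuclideanSpace ℝ (Fin m))} (hθ : ContDiffOn ℝ ∞ θ U) :
    SmoothInto (fun u => (⟨0, boost (θ u)⟩ : Poincare)) U := by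
  have hc : ContDiffOn ℝ ∞ (fun u => Real.cosh (θ u)) U := Real.contDiff_cosh.comp_contDiffOn hθ
  have hs : ContDiffOn ℝ ∞ (fun u => Real.sinh (θ u)) U := Real.contDiff_sinh.comp_contDiffOn hθ
  have h0 : ContDiffOn ℝ ∞ (fun _ : EuclideanSpace ℝ (Fin m) => (0 : ℝ)) U := contDiffOn_const
  have h1 : ContDiffOn ℝ ∞ (fun _ : EuclideanSpace ℝ (Fin m) => (1 : ℝ)) U := contDiffOn_const
  rintro (μ | ⟨⟨⟩ | i, ⟨⟩ | j⟩)
  · exact h0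
  · exact hc
  · fin_cases j
    exacts [h0, h0, hs]
  · fin_cases i
    exacts [h0, h0, hs]
  · fin_cases i <;> fin_cases j
    exacts [h1, h0, h0, h0, h1, h0, h0, h0, hc]

theorem fourMomentum_axis_two : fourMomentum (axis 2) = Sum.elim (fun _ => 1) ![0, 0, 1] := by
  funext μ
  rcases μ with ⟨⟩ | i
  · exact norm_axis 2
  · fin_cases i <;> simp [fourMomentum, axis]

theorem mulVec_spacetime (A : Matrix SpacetimeIndex SpacetimeIndex ℝ) (x : SpacetimeIndex → ℝ)
    (μ : SpacetimeIndex) :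
    (A *ᵥ x) μ = A μ (Sum.inl ()) * x (Sum.inl ()) + A μ (Sum.inr 0) * x (Sum.inr 0)
      + A μ (Sum.inr 1) * x (Sum.inr 1) + A μ (Sum.inr 2) * x (Sum.inr 2) := by
  simp [Matrix.mulVec, dotProduct, Fintype.sum_sum_type, Fin.sum_univ_three]
  ring

theorem spacetime_funext {x y : SpacetimeIndex → ℝ} (ht : x (Sum.inl ()) = y (Sum.inl ()))
    (h0 : x (Sum.inr 0) = y (Sum.inr 0)) (h1 : x (Sum.inr 1) = y (Sum.inr 1))
    (h2 : x (Sum.inr 2) = y (Sum.inr 2)) : x = y := by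
  funext μ
  rcases μ with ⟨⟩ | i
  · exact ht
  · fin_cases i
    exacts [h0, h1, h2]

theorem boost_smul_axis (t : ℝ) : (⟨0, boost t⟩ : Poincare) • axis 2 = axisRay t := by
  apply fourMomentum_injective
  rw [Poincare.fourMomentum_smul, fourMomentum_axis_two]
  have hn : ‖(axisRay t : Space)‖ = Real.exp t := by
    change ‖Real.exp t • (axis 2 : Space)‖ = _
    rw [norm_smul, norm_axis, mul_one, Real.norm_eq_abs, abs_of_pos (Real.exp_pos t)]
  have hr : ∀ i, fourMomentum (axisRay t) (Sum.inr i) = Real.exp t * (axis 2 : Space) i :=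
    fun i => rfl
  apply spacetime_funext
  · change _ = ‖(axisRay t : Space)‖
    rw [hn, mulVec_spacetime]
    change Real.cosh t * 1 + 0 * 0 + 0 * 0 + Real.sinh t * 1 = _
    rw [← Real.cosh_add_sinh]; ring
  · rw [hr, mulVec_spacetime]
    change 0 * 1 + 1 * 0 + 0 * 0 + 0 * 1 = _
    simp [axis]
  · rw [hr, mulVec_spacetime]
    change 0 * 1 + 0 * 0 + 1 * 0 + 0 * 1 = _
    simp [axis]
  · rw [hr, mulVec_spacetime]
    change Real.sinh t * 1 + 0 * 0 + 0 * 0 + Real.cosh t * 1 = _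
    simp [axis, ← Real.cosh_add_sinh]

theorem rotationHom_mat (R : SO3) : (rotationHom R).lor.mat = fromBlocks 1 0 0 R.1 := rfl

theorem axis_two_dir : (axis 2).dir = ![0, 0, 1] := by
  rw [LightCone.dir_eq, norm_axis]
  ext i
  fin_cases i <;> simp [axis]

theorem rotationAbout_axis_two (θ : ℝ) : (rotationAbout (axis 2) θ).1 =
    !![Real.cos θ, -Real.sin θ, 0; Real.sin θ, Real.cos θ, 0; 0, 0, 1] := by
  change rodrigues (axis 2).dir θ = _
  rw [axis_two_dir]
  ext i j
  fin_cases i <;> fin_cases j <;> simp [rodrigues]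

theorem rotation_mat (θ : ℝ) : (rotationHom (rotationAbout (axis 2) θ)).lor.mat =
    spacetimeMatrix !![1, 0, 0, 0; 0, Real.cos θ, -Real.sin θ, 0; 0, Real.sin θ, Real.cos θ, 0;
      0, 0, 0, 1] := by
  rw [rotationHom_mat, rotationAbout_axis_two]
  ext i j
  rcases i with ⟨⟩ | i <;> rcases j with ⟨⟩ | j
  · rfl
  · fin_cases j <;> rfl
  · fin_cases i <;> rfl
  · fin_cases i <;> fin_cases j <;> rfl

/-- The two matrices act on complementary planes: time and third axis for the boost, first and
second axes for the rotation. -/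
theorem boost_comm_rotation (t θ : ℝ) :
    (⟨0, boost t⟩ : Poincare) * rotationHom (rotationAbout (axis 2) θ) =
      rotationHom (rotationAbout (axis 2) θ) * ⟨0, boost t⟩ := by
  apply Poincare.ext
  · change (0 : SpacetimeIndex → ℝ) + _ *ᵥ 0 = 0 + _ *ᵥ 0
    simp
  · apply Lorentz.ext
    change boostMatrix t * (rotationHom (rotationAbout (axis 2) θ)).lor.mat =
      (rotationHom (rotationAbout (axis 2) θ)).lor.mat * boostMatrix t
    rw [rotation_mat, boostMatrix, spacetimeMatrix, spacetimeMatrix, Matrix.submatrix_mul_equiv,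
      Matrix.submatrix_mul_equiv]
    congr 1
    ext i j
    fin_cases i <;> fin_cases j <;> simp [Matrix.mul_apply, Fin.sum_univ_four]

/-! ### The little group of the momentum along the third axis -/

/-- `Λ` is an inhomogeneous element (a null rotation) of the little group of `k`. -/
def Lorentz.IsNullRotation (Λ : Lorentz) (k : LightCone) : Prop :=
  Λ.mat *ᵥ fourMomentum k = fourMomentum k ∧
    ∀ a : SpacetimeIndex → ℝ, fourMomentum k ⬝ᵥ (minkowski *ᵥ a) = 0 →
      ∃ c : ℝ, Λ.mat *ᵥ a - a = c • fourMomentum k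

theorem pairing_axis_two (a : SpacetimeIndex → ℝ) :
    fourMomentum (axis 2) ⬝ᵥ (minkowski *ᵥ a) = - a (Sum.inl ()) + a (Sum.inr 2) := by
  rw [fourMomentum_axis_two]
  simp [dotProduct, Fintype.sum_sum_type, Fin.sum_univ_three, minkowski, Matrix.fromBlocks_mulVec,
    Matrix.neg_mulVec, Function.comp_def]

theorem nullRotation_isNullRotation (u v : ℝ) : (nullRotation u v).IsNullRotation (axis 2) := by
  -- Orthogonality to the momentum means that the time and third components of `a` agree, so the
  -- terms quadratic in `(u, v)` cancel and only the linear ones enter the coefficient.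
  refine ⟨?_, fun a ha => ⟨u * a (Sum.inr 0) + v * a (Sum.inr 1), ?_⟩⟩
  · rw [fourMomentum_axis_two]
    apply spacetime_funext <;> rw [mulVec_spacetime]
    · change (1 + (u ^ 2 + v ^ 2) / 2) * 1 + u * 0 + v * 0 + -((u ^ 2 + v ^ 2) / 2) * 1 = 1
      ring
    · change u * 1 + 1 * 0 + 0 * 0 + -u * 1 = 0
      ring
    · change v * 1 + 0 * 0 + 1 * 0 + -v * 1 = 0
      ring
    · change (u ^ 2 + v ^ 2) / 2 * 1 + u * 0 + v * 0 + (1 - (u ^ 2 + v ^ 2) / 2) * 1 = 1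
      ring
  · rw [pairing_axis_two] at ha
    rw [fourMomentum_axis_two]
    have h2 : a (Sum.inr 2) = a (Sum.inl ()) := by linarith
    apply spacetime_funext <;> rw [Pi.sub_apply, Pi.smul_apply, mulVec_spacetime, h2]
    · change (1 + (u ^ 2 + v ^ 2) / 2) * _ + u * _ + v * _ + -((u ^ 2 + v ^ 2) / 2) * _ - _ = _ * 1
      ring
    · change u * _ + 1 * _ + 0 * _ + -u * _ - _ = _ * 0
      ring
    · change v * _ + 0 * _ + 1 * _ + -v * _ - _ = _ * 0
      ring
    · change (u ^ 2 + v ^ 2) / 2 * _ + u * _ + v * _ + (1 - (u ^ 2 + v ^ 2) / 2) * _ - _ = _ * 1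
      ring

/-- The displacement of the time vector is odd in `(u, v)` in the transverse directions and even
along the momentum. This parity isolates the transverse translations in
`MasslessParticle.stabilizerRep_transverse`. -/
theorem nullRotation_mulVec_time (u v : ℝ) :
    (nullRotation u v).mat *ᵥ Sum.elim (fun _ => 1) ![0, 0, 0] - Sum.elim (fun _ => 1) ![0, 0, 0] =
      Sum.elim (fun _ => (u ^ 2 + v ^ 2) / 2) ![u, v, (u ^ 2 + v ^ 2) / 2] := by
  apply spacetime_funext <;> rw [Pi.sub_apply, mulVec_spacetime]
  · change (1 + (u ^ 2 + v ^ 2) / 2) * 1 + u * 0 + v * 0 + -((u ^ 2 + v ^ 2) / 2) * 0 - 1 = _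
    simp
  · change u * 1 + 1 * 0 + 0 * 0 + -u * 0 - 0 = u
    ring
  · change v * 1 + 0 * 0 + 1 * 0 + -v * 0 - 0 = v
    ring
  · change (u ^ 2 + v ^ 2) / 2 * 1 + u * 0 + v * 0 + (1 - (u ^ 2 + v ^ 2) / 2) * 0 - 0 = _
    simp

theorem exists_angle {c s : ℝ} (h : c ^ 2 + s ^ 2 = 1) : ∃ θ : ℝ, Real.cos θ = c ∧ Real.sin θ = s := by
  have hz : ‖(⟨c, s⟩ : ℂ)‖ = 1 := by
    rw [← sq_eq_sq₀ (norm_nonneg _) zero_le_one, Complex.sq_norm, Complex.normSq_mk]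
    linarith
  have h0 : (⟨c, s⟩ : ℂ) ≠ 0 := by
    intro h0
    rw [h0, norm_zero] at hz
    exact zero_ne_one hz
  refine ⟨Complex.arg ⟨c, s⟩, ?_, ?_⟩
  · rw [Complex.cos_arg h0, hz, div_one]
  · rw [Complex.sin_arg, hz, div_one]

theorem spacetime_det (A : Matrix SpacetimeIndex SpacetimeIndex ℝ) :
    A.det = (A.submatrix spacetimeEquiv spacetimeEquiv).det :=
  (Matrix.det_submatrix_equiv_self _ _).symm

/-- An element of the little group of the momentum along the third axis is the product of a null
rotation and a rotation about the third axis. -/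
theorem Lorentz.exists_decomposition {Λ : Lorentz}
    (hΛ : Λ.mat *ᵥ fourMomentum (axis 2) = fourMomentum (axis 2)) :
    ∃ (θ : ℝ) (N : Lorentz), Λ = N * (rotationHom (rotationAbout (axis 2) θ)).lor ∧
      N.IsNullRotation (axis 2) := by
  have hpres := Λ.preserves
  have hdet : Λ.mat.det = 1 := Λ.1.2
  -- Since `Λ` preserves the metric and fixes the momentum, its transpose fixes the lowered
  -- momentum. These row relations and the column relations `hcol` express the last row and column
  -- of `Λ` through the other entries.
  have hrow : ∀ ν, - Λ.mat (Sum.inl ()) ν + Λ.mat (Sum.inr 2) ν =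
      (minkowski *ᵥ fourMomentum (axis 2)) ν := by
    intro ν
    have h : Λ.matᵀ *ᵥ (minkowski *ᵥ fourMomentum (axis 2)) =
        minkowski *ᵥ fourMomentum (axis 2) := by
      conv_rhs => rw [← hpres]
      rw [← mulVec_mulVec, ← mulVec_mulVec, hΛ]
    rw [← h, mulVec_spacetime]
    simp [fourMomentum_axis_two, minkowski, Matrix.fromBlocks_mulVec, Matrix.neg_mulVec,
      Function.comp_def]
  have hη : ∀ μ ν, (Λ.matᵀ * minkowski * Λ.mat) μ ν = - Λ.mat (Sum.inl ()) μ * Λ.mat (Sum.inl ()) ν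
      + Λ.mat (Sum.inr 0) μ * Λ.mat (Sum.inr 0) ν + Λ.mat (Sum.inr 1) μ * Λ.mat (Sum.inr 1) ν
      + Λ.mat (Sum.inr 2) μ * Λ.mat (Sum.inr 2) ν := by
    intro μ ν
    simp [minkowski, Matrix.mul_apply, Fintype.sum_sum_type, Fin.sum_univ_three,
      Matrix.one_apply]
    ring
  rw [hpres] at hη
  have hcol : ∀ μ, Λ.mat μ (Sum.inl ()) + Λ.mat μ (Sum.inr 2) = fourMomentum (axis 2) μ := by
    intro μ
    conv_rhs => rw [← hΛ]
    rw [mulVec_spacetime, fourMomentum_axis_two]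
    simp
  rw [fourMomentum_axis_two] at hcol hrow
  have hrt := hrow (Sum.inl ())
  have hr0 := hrow (Sum.inr 0)
  have hr1 := hrow (Sum.inr 1)
  have hr2 := hrow (Sum.inr 2)
  have hct := hcol (Sum.inl ())
  have hc0 := hcol (Sum.inr 0)
  have hc1 := hcol (Sum.inr 1)
  have hc2 := hcol (Sum.inr 2)
  have h00 := hη (Sum.inr 0) (Sum.inr 0)
  have h01 := hη (Sum.inr 0) (Sum.inr 1)
  have h11 := hη (Sum.inr 1) (Sum.inr 1)
  clear hη hcol hrow
  rw [spacetime_det, det_fin_four] at hdet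
  simp only [Matrix.submatrix_apply, show spacetimeEquiv 0 = Sum.inl () from rfl,
    show spacetimeEquiv 1 = Sum.inr 0 from rfl, show spacetimeEquiv 2 = Sum.inr 1 from rfl,
    show spacetimeEquiv 3 = Sum.inr 2 from rfl] at hdet
  simp [minkowski, Matrix.fromBlocks_mulVec, Matrix.neg_mulVec, Function.comp_def]
    at hrt hr0 hr1 hr2 hct hc0 hc1 hc2 h00 h01 h11
  have e0 : Λ.mat (Sum.inr 2) (Sum.inr 0) = Λ.mat (Sum.inl ()) (Sum.inr 0) := by linarith
  have e1 : Λ.mat (Sum.inr 2) (Sum.inr 1) = Λ.mat (Sum.inl ()) (Sum.inr 1) := by linarith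
  have et : Λ.mat (Sum.inr 2) (Sum.inl ()) = Λ.mat (Sum.inl ()) (Sum.inl ()) - 1 := by linarith
  have e3 : Λ.mat (Sum.inr 2) (Sum.inr 2) = Λ.mat (Sum.inl ()) (Sum.inr 2) + 1 := by linarith
  have f3 : Λ.mat (Sum.inl ()) (Sum.inr 2) = 1 - Λ.mat (Sum.inl ()) (Sum.inl ()) := by linarith
  have g0 : Λ.mat (Sum.inr 0) (Sum.inr 2) = - Λ.mat (Sum.inr 0) (Sum.inl ()) := by linarith
  have g1 : Λ.mat (Sum.inr 1) (Sum.inr 2) = - Λ.mat (Sum.inr 1) (Sum.inl ()) := by linarith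
  rw [e0, e1, et, e3, f3, g0, g1] at hdet
  rw [e0] at h00
  rw [e0, e1] at h01
  rw [e1] at h11
  generalize ha : Λ.mat (Sum.inr 0) (Sum.inr 0) = a at *
  generalize hb : Λ.mat (Sum.inr 1) (Sum.inr 0) = b at *
  generalize ha' : Λ.mat (Sum.inr 0) (Sum.inr 1) = a' at *
  generalize hb' : Λ.mat (Sum.inr 1) (Sum.inr 1) = b' at *
  -- After the substitutions the determinant of `Λ` is that of its transverse 2 × 2 block, and the
  -- metric relations make the columns of the block orthonormal. The block is therefore a plane
  -- rotation, with cosine `a` and sine `b`.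
  have d : a * b' - a' * b = 1 := by linear_combination hdet
  have n1 : a ^ 2 + b ^ 2 = 1 := by linear_combination -h00
  have n2 : a * a' + b * b' = 0 := by linear_combination -h01
  have hb'' : b' = a := by linear_combination a * d - b' * n1 + b * n2
  have ha'' : a' = -b := by linear_combination -b * d - a' * n1 + a * n2
  obtain ⟨θ, hcos, hsin⟩ := exists_angle n1
  -- Undoing this rotation turns the transverse block into the identity, which leaves a null
  -- rotation.
  refine ⟨θ, Λ * (rotationHom (rotationAbout (axis 2) θ)).lor⁻¹, by simp, ?_⟩
  have hinv : (rotationHom (rotationAbout (axis 2) θ)).lor⁻¹ =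
      (rotationHom (rotationAbout (axis 2) (-θ))).lor := by
    rw [inv_eq_iff_mul_eq_one]
    apply Lorentz.ext
    rw [Lorentz.mat_mul, rotation_mat, rotation_mat, spacetimeMatrix, spacetimeMatrix,
      Matrix.submatrix_mul_equiv, Lorentz.mat_one]
    have h := Real.sin_sq_add_cos_sq θ
    have h1 : (!![1, 0, 0, 0; 0, Real.cos θ, -Real.sin θ, 0; 0, Real.sin θ, Real.cos θ, 0;
      0, 0, 0, 1] * !![1, 0, 0, 0; 0, Real.cos (-θ), -Real.sin (-θ), 0;
        0, Real.sin (-θ), Real.cos (-θ), 0; 0, 0, 0, 1] : Matrix (Fin 4) (Fin 4) ℝ) = 1 := by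
      ext i j
      fin_cases i <;> fin_cases j <;> simp [Matrix.mul_apply, Fin.sum_univ_four] <;> linarith
    rw [h1, Matrix.submatrix_one_equiv]
  rw [hinv]
  have hrot : ∀ x : SpacetimeIndex → ℝ, (rotationHom (rotationAbout (axis 2) (-θ))).lor.mat *ᵥ x =
      Sum.elim (fun _ => x (Sum.inl ())) ![a * x (Sum.inr 0) + b * x (Sum.inr 1),
        -b * x (Sum.inr 0) + a * x (Sum.inr 1), x (Sum.inr 2)] := by
    intro x
    rw [rotation_mat, Real.cos_neg, Real.sin_neg, hcos, hsin]
    apply spacetime_funext <;> rw [mulVec_spacetime]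
    · change 1 * _ + 0 * _ + 0 * _ + 0 * _ = x (Sum.inl ())
      ring
    · change 0 * _ + a * _ + -(-b) * _ + 0 * _ = a * x (Sum.inr 0) + b * x (Sum.inr 1)
      ring
    · change 0 * _ + (-b) * _ + a * _ + 0 * _ = -b * x (Sum.inr 0) + a * x (Sum.inr 1)
      ring
    · change 0 * _ + 0 * _ + 0 * _ + 1 * _ = x (Sum.inr 2)
      ring
  refine ⟨?_, fun x hx => ?_⟩
  · rw [Lorentz.mat_mul, ← mulVec_mulVec]
    have hp : (rotationHom (rotationAbout (axis 2) (-θ))).lor.mat *ᵥ fourMomentum (axis 2) =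
        fourMomentum (axis 2) := by
      rw [hrot, fourMomentum_axis_two]
      apply spacetime_funext <;> simp
    rw [hp, hΛ]
  · rw [pairing_axis_two] at hx
    have h2 : x (Sum.inr 2) = x (Sum.inl ()) := by linarith
    -- The coefficient pairs the transverse entries of the time row of `Λ` with the transverse part
    -- of `x` after the inverse rotation.
    refine ⟨Λ.mat (Sum.inl ()) (Sum.inr 0) * (a * x (Sum.inr 0) + b * x (Sum.inr 1)) +
      Λ.mat (Sum.inl ()) (Sum.inr 1) * (-b * x (Sum.inr 0) + a * x (Sum.inr 1)), ?_⟩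
    rw [Lorentz.mat_mul, ← mulVec_mulVec, hrot, fourMomentum_axis_two]
    apply spacetime_funext <;>
      rw [Pi.sub_apply, Pi.smul_apply, mulVec_spacetime] <;>
      simp [h2, ha, hb, ha', hb', hb'', ha'', e0, e1, et, e3, f3, g0, g1]
    · ring
    · linear_combination x (Sum.inr 0) * n1
    · linear_combination x (Sum.inr 1) * n1
    · ring

section BundleLemmas

universe u

variable {r : ℕ} {E : LightCone → Type u}
  [∀ k, AddCommGroup (E k)] [∀ k, Module ℂ (E k)] [∀ k, TopologicalSpace (E k)]
  [TopologicalSpace (TotalSpace (Fiber r) E)] [FiberBundle (Fiber r) E]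

/-! ### The linear maps of an action -/

section Action

variable {G : Type} [Group G] [MulAction G LightCone] [LieCoordinates G]

/-- The linear map `E k → E k'` by which a group element with `g • k = k'` acts. -/
def BundleAction.tr (A : BundleAction r E G) (g : G) {k k' : LightCone} (h : g • k = k') :
    E k →ₗ[ℂ] E k' :=
  h ▸ (A.linear g k).choose

theorem BundleAction.act_mk (A : BundleAction r E G) (g : G) {k k' : LightCone} (h : g • k = k')
    (v : E k) : A.act g ⟨k, v⟩ = ⟨k', A.tr g h v⟩ := by
  subst h
  exact (A.linear g k).choose_spec v

theorem BundleAction.tr_eq_of_act (A : BundleAction r E G) {g : G} {k k' : LightCone}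
    (h : g • k = k') {v : E k} {w : E k'} (hw : A.act g ⟨k, v⟩ = ⟨k', w⟩) : A.tr g h v = w := by
  rw [A.act_mk g h] at hw
  exact TotalSpace.mk_inj.1 hw

theorem BundleAction.tr_mul (A : BundleAction r E G) {g g' : G} {k k' k'' : LightCone}
    (h : g • k = k') (h' : g' • k' = k'') (v : E k) :
    A.tr (g' * g) (by rw [mul_smul, h, h']) v = A.tr g' h' (A.tr g h v) := by
  apply A.tr_eq_of_act
  rw [A.act_mul, A.act_mk g h, A.act_mk g' h']

theorem BundleAction.tr_one (A : BundleAction r E G) {k : LightCone} (h : (1 : G) • k = k)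
    (v : E k) : A.tr 1 h v = v := by
  apply A.tr_eq_of_act
  rw [A.act_one]

theorem BundleAction.tr_congr (A : BundleAction r E G) {g g' : G} (hg : g = g') {k k' : LightCone}
    (h : g • k = k') (h' : g' • k = k') (v : E k) : A.tr g h v = A.tr g' h' v := by
  subst hg
  rfl

/-- The linear isomorphism `E k → E k'` by which a group element with `g • k = k'` acts. -/
def BundleAction.trEquiv (A : BundleAction r E G) (g : G) {k k' : LightCone} (h : g • k = k') :
    E k ≃ₗ[ℂ] E k' :=
  LinearEquiv.ofLinearMap (A.tr g h) (A.tr g⁻¹ (by rw [← h, inv_smul_smul]))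
    (by
      ext v
      have := A.tr_mul (g := g⁻¹) (g' := g) (k'' := k') (k' := k) (k := k')
        (by rw [← h, inv_smul_smul]) h v
      rw [LinearMap.comp_apply, ← this, LinearMap.id_apply,
        A.tr_congr (mul_inv_cancel g) _ (one_smul G k'), A.tr_one])
    (by
      ext v
      have := A.tr_mul (g := g) (g' := g⁻¹) h (k'' := k) (by rw [← h, inv_smul_smul]) v
      rw [LinearMap.comp_apply, ← this, LinearMap.id_apply,
        A.tr_congr (inv_mul_cancel g) _ (one_smul G k), A.tr_one])

theorem BundleAction.trEquiv_apply (A : BundleAction r E G) (g : G) {k k' : LightCone}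
    (h : g • k = k') (v : E k) : A.trEquiv g h v = A.tr g h v := rfl

theorem BundleAction.act_proj (A : BundleAction r E G) (g : G) (v : TotalSpace (Fiber r) E) :
    (A.act g v).proj = g • v.proj := by
  rw [show v = ⟨v.proj, v.2⟩ from rfl, A.act_mk g rfl]

/-- Smoothness of `x ↦ γ(f x) · s(x)` for a smooth family `γ` of group elements and a smooth map `s`
into the total space. -/
theorem BundleAction.contMDiffOn_act (A : BundleAction r E G) {F H M : Type*}
    [NormedAddCommGroup F] [NormedSpace ℝ F] [TopologicalSpace H] {I : ModelWithCorners ℝ F H}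
    [TopologicalSpace M] [ChartedSpace H M] {m : ℕ} {U : Set (EuclideanSpace ℝ (Fin m))}
    {γ : EuclideanSpace ℝ (Fin m) → G} (hU : IsOpen U) (hγ : SmoothInto γ U) {S : Set M}
    {f : M → EuclideanSpace ℝ (Fin m)} {s : M → TotalSpace (Fiber r) E}
    (hf : ContMDiffOn I 𝓘(ℝ, EuclideanSpace ℝ (Fin m)) ∞ f S)
    (hs : ContMDiffOn I (totalModel r) ∞ s S) (hfS : ∀ x ∈ S, f x ∈ U) :
    ContMDiffOn I (totalModel r) ∞ (fun x => A.act (γ (f x)) (s x)) S :=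
  (A.smooth m U γ hU hγ).comp (hf.prodMk hs) fun x hx => ⟨hfS x hx, Set.mem_univ _⟩

end Action

/-! ### Linear coordinates, frames and a criterion for triviality -/

/-- The linear map `ℂ^r → E k` attached to a family of `r` vectors. -/
def frameMap {k : LightCone} (s : Fin r → E k) : Fiber r →ₗ[ℂ] E k :=
  (Fintype.linearCombination ℂ s) ∘ₗ (WithLp.linearEquiv 2 ℂ (Fin r → ℂ)).toLinearMap

theorem frameMap_apply {k : LightCone} (s : Fin r → E k) (w : Fiber r) :
    frameMap s w = ∑ i, w i • s i := rfl

theorem frameMap_injective {k : LightCone} {s : Fin r → E k} (hs : LinearIndependent ℂ s) :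
    Function.Injective (frameMap s) :=
  (linearIndependent_iff_injective_fintypeLinearCombination.1 hs).comp
    (WithLp.linearEquiv 2 ℂ (Fin r → ℂ)).injective

variable [VectorBundle ℂ (Fiber r) E]

variable (r E) in
/-- The linear coordinates on the fibre at `k` given by the preferred trivialization at `k`. -/
def coordAt (k : LightCone) : E k ≃ₗ[ℂ] Fiber r :=
  (trivializationAt (Fiber r) E k).linearEquivAt ℂ k (mem_baseSet_trivializationAt _ _ k)

theorem coordAt_apply (k : LightCone) (v : E k) :
    coordAt r E k v = (trivializationAt (Fiber r) E k ⟨k, v⟩).2 := rfl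

theorem coordAt_symm_apply (k : LightCone) (w : Fiber r) :
    (coordAt r E k).symm w = (trivializationAt (Fiber r) E k).symm k w := rfl

theorem finrank_fiber (k : LightCone) : Module.finrank ℂ (E k) = r := by
  simp [(coordAt r E k).finrank_eq]

/-- The linear isomorphism `ℂ^r → E k` attached to a frame. -/
def frameEquiv {k : LightCone} {s : Fin r → E k} (hs : LinearIndependent ℂ s) :
    Fiber r ≃ₗ[ℂ] E k :=
  haveI : FiniteDimensional ℂ (E k) := Module.Finite.equiv (coordAt r E k).symm
  LinearMap.linearEquivOfInjective (frameMap s) (frameMap_injective hs) (by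
    rw [finrank_fiber (r := r)]; simp)

theorem frameEquiv_apply {k : LightCone} {s : Fin r → E k} (hs : LinearIndependent ℂ s)
    (w : Fiber r) : frameEquiv hs w = ∑ i, w i • s i := by
  rw [← frameMap_apply]
  rfl

/-- The endomorphism of `ℂ^r` with given columns, depending linearly on the columns. -/
def columnsL (r : ℕ) : (Fin r → Fiber r) →L[ℂ] (Fiber r →L[ℂ] Fiber r) :=
  ∑ i, (ContinuousLinearMap.smulRightL ℂ (Fiber r) (Fiber r)
    (EuclideanSpace.proj i : Fiber r →L[ℂ] ℂ)).comp (ContinuousLinearMap.proj i)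

theorem columnsL_apply (a : Fin r → Fiber r) (w : Fiber r) :
    columnsL r a w = ∑ i, w i • a i := by
  simp [columnsL]

theorem trivialization_sum {k₀ k : LightCone}
    (hk : k ∈ (trivializationAt (Fiber r) E k₀).baseSet) {ι : Type*} (S : Finset ι) (c : ι → ℂ)
    (s : ι → E k) :
    (trivializationAt (Fiber r) E k₀ ⟨k, ∑ i ∈ S, c i • s i⟩).2 =
      ∑ i ∈ S, c i • (trivializationAt (Fiber r) E k₀ ⟨k, s i⟩).2 := by
  have h := map_sum ((trivializationAt (Fiber r) E k₀).linearEquivAt ℂ k hk)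
    (fun i => c i • s i) S
  simp only [map_smul] at h
  exact h

variable [VectorBundle ℝ (Fiber r) E] [ContMDiffVectorBundle ∞ (Fiber r) E 𝓘(ℝ, Space)]

/-- The isomorphism is the inverse of the frame map. Its smoothness is the point: in a
trivialization the frame map becomes an invertible matrix with smooth columns, and inversion of
matrices is smooth. -/
theorem isTrivialBundle_of_frame (s : Fin r → ∀ k, E k)
    (hs : ∀ i, SmoothSectionOn r E (s i) Set.univ)
    (hli : ∀ k, LinearIndependent ℂ fun i => s i k) : IsTrivialBundle r E := by
  have hs' : ∀ i (k₁ : LightCone), ContMDiffAt 𝓘(ℝ, Space) 𝓘(ℝ, Fiber r) ∞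
      (fun k => (trivializationAt (Fiber r) E k₁ ⟨k, s i k⟩).2) k₁ := by
    intro i k₁
    have h := contMDiffOn_univ.1 (hs i) k₁
    rw [contMDiffAt_totalSpace] at h
    exact h.2
  refine ⟨fun k => (frameEquiv (hli k)).symm, ?_, ?_⟩
  · intro v₁
    refine ContMDiffAt.prodMk (contMDiffAt_proj E) ?_
    let e := trivializationAt (Fiber r) E v₁.proj
    let a : LightCone → Fin r → Fiber r := fun k i => (e ⟨k, s i k⟩).2
    have hkey : ∀ k, ∀ hk : k ∈ e.baseSet, columnsL r (a k) =
        ((frameEquiv (hli k)).trans (e.linearEquivAt ℂ k hk)).toContinuousLinearEquiv := by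
      intro k hk
      ext1 w
      rw [columnsL_apply]
      change _ = e.linearEquivAt ℂ k hk (frameEquiv (hli k) w)
      rw [frameEquiv_apply]
      exact (trivialization_sum hk _ _ _).symm
    have hk₁ : v₁.proj ∈ e.baseSet := mem_baseSet_trivializationAt _ _ _
    have hsm : ContMDiffAt (totalModel r) 𝓘(ℝ, Fiber r) ∞
        (fun v : TotalSpace (Fiber r) E =>
          (columnsL r (a v.proj)).inverse (e v).2) v₁ := by
      have h1 : ContMDiffAt 𝓘(ℝ, Space) 𝓘(ℝ, Fin r → Fiber r) ∞ a v₁.proj :=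
        contMDiffAt_pi_space.2 fun i => hs' i v₁.proj
      have h2 : ContMDiffAt (totalModel r) 𝓘(ℝ, Fin r → Fiber r) ∞
          (fun v : TotalSpace (Fiber r) E => a v.proj) v₁ := h1.comp v₁ (contMDiffAt_proj E)
      have h3 : ContMDiffAt (totalModel r) 𝓘(ℝ, Fiber r) ∞
          (fun v : TotalSpace (Fiber r) E => (e v).2) v₁ := by
        have h := contMDiffAt_id (I := totalModel r) (n := ∞) (x := v₁)
        rw [contMDiffAt_totalSpace] at h
        exact h.2
      have h4 : ContDiffAt ℝ ∞ (fun p : (Fin r → Fiber r) × Fiber r =>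
          (columnsL r p.1).inverse p.2) (a v₁.proj, (e v₁).2) := by
        -- `columnsL` and inversion are smooth over `ℂ`, since the maps involved are complex linear;
        -- the scalars are restricted to `ℝ` afterwards.
        have h5 : ContDiffAt ℂ ∞ (fun p : (Fin r → Fiber r) × Fiber r =>
          (columnsL r p.1).inverse p.2) (a v₁.proj, (e v₁).2) := by
          refine ContDiffAt.clm_apply ?_ contDiffAt_snd
          refine ContDiffAt.comp (g := ContinuousLinearMap.inverse)
            (f := fun p : (Fin r → Fiber r) × Fiber r => columnsL r p.1) _ ?_ ?_
          · rw [hkey _ hk₁]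
            exact contDiffAt_map_inverse _
          · exact ((columnsL r).contDiff.comp contDiff_fst).contDiffAt
        exact h5.restrict_scalars ℝ
      exact h4.contMDiffAt.comp v₁ (h2.prodMk_space h3)
    refine hsm.congr_of_eventuallyEq ?_
    have hopen : IsOpen e.source := e.open_source
    filter_upwards [hopen.mem_nhds (FiberBundle.mem_trivializationAt_proj_source)] with v hv
    have hk : v.proj ∈ e.baseSet := e.mem_source.1 hv
    rw [hkey _ hk, ContinuousLinearMap.inverse_equiv]
    change _ = (frameEquiv (hli v.proj)).symm ((e.linearEquivAt ℂ v.proj hk).symm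
      (e.linearEquivAt ℂ v.proj hk v.2))
    rw [LinearEquiv.symm_apply_apply]
  · intro p₁
    rw [contMDiffAt_totalSpace]
    refine ⟨contMDiffAt_fst, ?_⟩
    let e := trivializationAt (Fiber r) E p₁.1
    have hsm : ContMDiffAt (𝓘(ℝ, Space).prod 𝓘(ℝ, Fiber r)) 𝓘(ℝ, Fiber r) ∞
        (fun p : LightCone × Fiber r => ∑ i, p.2 i • (e ⟨p.1, s i p.1⟩).2) p₁ := by
      have h1 : ContMDiffAt (𝓘(ℝ, Space).prod 𝓘(ℝ, Fiber r)) 𝓘(ℝ, Fin r → Fiber r) ∞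
          (fun p : LightCone × Fiber r => fun i => (e ⟨p.1, s i p.1⟩).2) p₁ :=
        contMDiffAt_pi_space.2 fun i => (hs' i p₁.1).comp p₁ contMDiffAt_fst
      have h2 : ContMDiffAt (𝓘(ℝ, Space).prod 𝓘(ℝ, Fiber r)) 𝓘(ℝ, Fiber r) ∞
          (fun p : LightCone × Fiber r => p.2) p₁ := contMDiffAt_snd
      have h4 : ContDiff ℝ ∞ (fun q : (Fin r → Fiber r) × Fiber r =>
          columnsL r q.1 q.2) := by
        have h5 : ContDiff ℂ ∞ (fun q : (Fin r → Fiber r) × Fiber r =>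
          columnsL r q.1 q.2) :=
          ((columnsL r).contDiff.comp contDiff_fst).clm_apply contDiff_snd
        exact h5.restrict_scalars ℝ
      have h6 := h4.contMDiff.contMDiffAt.comp p₁ (h1.prodMk_space h2)
      refine h6.congr_of_eventuallyEq (Filter.Eventually.of_forall fun p => ?_)
      exact (columnsL_apply _ _).symm
    refine hsm.congr_of_eventuallyEq ?_
    have hopen : IsOpen (Prod.fst ⁻¹' e.baseSet : Set (LightCone × Fiber r)) :=
      e.open_baseSet.preimage continuous_fst
    filter_upwards [hopen.mem_nhds (mem_baseSet_trivializationAt (Fiber r) E p₁.1)] with p hp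
    change (e ⟨p.1, frameEquiv (hli p.1) p.2⟩).2 = _
    rw [frameEquiv_apply]
    exact trivialization_sum hp _ _ _

end BundleLemmas

section FramesAlongCurves

universe u

variable {r : ℕ} {E : LightCone → Type u}
  [∀ k, AddCommGroup (E k)] [∀ k, Module ℂ (E k)] [∀ k, TopologicalSpace (E k)]
  [TopologicalSpace (TotalSpace (Fiber r) E)] [FiberBundle (Fiber r) E]

/-! ### Frames along curves -/

/-- The family `F` of sections restricts to a smooth frame along the curve `ρ` near `t`. -/
def IsFrameNear (ρ : ℝ → LightCone) (F : Fin r → ∀ k, E k) (t : ℝ) : Prop :=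
  ∀ᶠ s in nhds t, (∀ i, ContMDiffAt 𝓘(ℝ, ℝ) (totalModel r) ∞
    (fun s => (⟨ρ s, F i (ρ s)⟩ : TotalSpace (Fiber r) E)) s) ∧
    LinearIndependent ℂ (fun i => F i (ρ s))

/-- Agreement only along the curve near `t` suffices, so families may be altered elsewhere freely.
-/
theorem IsFrameNear.congr {ρ : ℝ → LightCone} {F F' : Fin r → ∀ k, E k} {t : ℝ}
    (h : IsFrameNear ρ F t) (hF : ∀ᶠ s in nhds t, ∀ i, F' i (ρ s) = F i (ρ s)) :
    IsFrameNear ρ F' t := by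
  filter_upwards [h, hF.eventually_nhds] with s hs hFs
  refine ⟨fun i => (hs.1 i).congr_of_eventuallyEq ?_, ?_⟩
  · filter_upwards [hFs] with s' hs'
    rw [hs' i]
  · have := hFs.self_of_nhds
    simp only [this]
    exact hs.2

theorem IsFrameNear.neg {ρ : ℝ → LightCone} {F : Fin r → ∀ k, E k} {t : ℝ}
    (h : IsFrameNear ρ F t) : IsFrameNear (fun s => ρ (-s)) F (-t) := by
  have hc : Filter.Tendsto (fun s : ℝ => -s) (nhds (-t)) (nhds t) := by
    have := (continuous_neg (G := ℝ)).tendsto (-t)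
    rwa [neg_neg] at this
  filter_upwards [hc.eventually h] with s hs
  refine ⟨fun i => ?_, hs.2⟩
  exact (hs.1 i).comp s (contDiff_neg.contMDiff.contMDiffAt)

variable [VectorBundle ℂ (Fiber r) E] [VectorBundle ℝ (Fiber r) E]
  [ContMDiffVectorBundle ∞ (Fiber r) E 𝓘(ℝ, Space)]

theorem isFrameNear_of_coordinates {ρ : ℝ → LightCone}
    (hρ : ContMDiff 𝓘(ℝ, ℝ) 𝓘(ℝ, Space) ∞ ρ) {k₁ : LightCone} {F : Fin r → ∀ k, E k} {t : ℝ}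
    (ht : ρ t ∈ (trivializationAt (Fiber r) E k₁).baseSet) (h : ℝ → Fin r → Fiber r)
    (hsm : ∀ i, ContDiff ℝ ∞ fun s => h s i) (hli : ∀ s, LinearIndependent ℂ (h s))
    (hF : ∀ᶠ s in nhds t, ∀ i, F i (ρ s) = (trivializationAt (Fiber r) E k₁).symm (ρ s) (h s i)) :
    IsFrameNear ρ F t := by
  let e := trivializationAt (Fiber r) E k₁
  have hopen : ∀ᶠ s in nhds t, ρ s ∈ e.baseSet :=
    (e.open_baseSet.preimage hρ.continuous).mem_nhds ht
  filter_upwards [hopen.eventually_nhds, hF.eventually_nhds] with s hs hFs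
  refine ⟨fun i => ?_, ?_⟩
  · rw [e.contMDiffAt_iff (e.mem_source.2 hs.self_of_nhds)]
    refine ⟨hρ s, ((hsm i).contMDiff s).congr_of_eventuallyEq ?_⟩
    filter_upwards [hs, hFs] with s' hs' hFs'
    rw [hFs' i]
    exact congrArg Prod.snd (e.apply_mk_symm hs' (h s' i))
  · have h1 := hFs.self_of_nhds
    simp only [h1]
    exact (hli s).map' _ (LinearEquiv.ker (e.linearEquivAt ℂ (ρ s) hs.self_of_nhds).symm)

/-- A smooth family of bases near `b` can be modified away from `b` to be defined everywhere. -/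
theorem exists_global_bases {g : ℝ → Fin r → Fiber r} {b : ℝ}
    (hg : ∀ᶠ s in nhds b, ∀ i, ContDiffAt ℝ ∞ (fun s => g s i) s)
    (hgb : LinearIndependent ℂ (g b)) :
    ∃ h : ℝ → Fin r → Fiber r, (∀ i, ContDiff ℝ ∞ fun s => h s i) ∧
      (∀ t, LinearIndependent ℂ (h t)) ∧ ∀ᶠ s in nhds b, h s = g s := by
  obtain ⟨ε, hε, hball⟩ := Metric.eventually_nhds_iff_ball.1 hgb.eventually
  have hgc : ContinuousAt g b := continuousAt_pi.2 fun i => (hg.self_of_nhds i).continuousAt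
  obtain ⟨δ, hδ, hδg⟩ := Metric.eventually_nhds_iff_ball.1
    (hg.and (hgc.eventually (Metric.ball_mem_nhds (g b) hε)))
  -- The family is contracted towards the constant `g b` by a cutoff with values in `[0, 1]`. It
  -- thus never leaves the `ε`-ball around `g b`, in which all families are linearly independent.
  let χ : ContDiffBump b := ⟨δ / 4, δ / 2, by positivity, by linarith⟩
  refine ⟨fun t => g b + χ t • (g t - g b), fun i => ?_, fun t => ?_, ?_⟩
  · rw [contDiff_iff_contDiffAt]
    intro t
    by_cases ht : t ∈ Metric.ball b δ
    · exact contDiffAt_const.add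
        (χ.contDiffAt.smul (((hδg t ht).1 i).sub contDiffAt_const))
    · have h0 : (fun s => (g b + χ s • (g s - g b)) i) =ᶠ[nhds t] fun _ => g b i := by
        have ht' : t ∈ (Metric.closedBall b (δ / 2))ᶜ := fun ht' =>
          ht (Metric.closedBall_subset_ball (by linarith) ht')
        filter_upwards [Metric.isClosed_closedBall.isOpen_compl.mem_nhds ht'] with s hs
        have : χ s = 0 := χ.zero_of_le_dist (by
          have : ¬ dist s b ≤ δ / 2 := hs
          exact (not_le.1 this).le)
        simp [this]
      exact contDiffAt_const.congr_of_eventuallyEq h0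
  · apply hball
    by_cases ht : t ∈ Metric.ball b δ
    · have h1 := (hδg t ht).2
      rw [dist_eq_norm] at h1
      rw [mem_ball_iff_norm]
      refine lt_of_le_of_lt ?_ h1
      rw [add_sub_cancel_left, norm_smul]
      refine mul_le_of_le_one_left (norm_nonneg _) ?_
      rw [Real.norm_eq_abs, abs_of_nonneg χ.nonneg]
      exact χ.le_one
    · have : χ t = 0 := χ.zero_of_le_dist (by
        have : ¬ dist t b < δ := ht
        exact le_trans (by change δ / 2 ≤ δ; linarith) (not_lt.1 this))
      simp [this, hε]
  · filter_upwards [Metric.ball_mem_nhds b (show 0 < δ / 4 by positivity)] with s hs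
    have h1 : χ s = 1 := χ.one_of_mem_closedBall (Metric.ball_subset_closedBall hs)
    simp [h1]

theorem linearIndependent_coordinates {k₁ k : LightCone}
    (hk : k ∈ (trivializationAt (Fiber r) E k₁).baseSet) {s : Fin r → E k}
    (hs : LinearIndependent ℂ s) :
    LinearIndependent ℂ fun i => (trivializationAt (Fiber r) E k₁ ⟨k, s i⟩).2 :=
  hs.map' ((trivializationAt (Fiber r) E k₁).linearEquivAt ℂ k hk).toLinearMap
    (LinearEquiv.ker _)

theorem contDiffAt_coordinates {ρ : ℝ → LightCone} {k₁ : LightCone} {s : ∀ k, E k} {t : ℝ}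
    (ht : ρ t ∈ (trivializationAt (Fiber r) E k₁).baseSet)
    (h : ContMDiffAt 𝓘(ℝ, ℝ) (totalModel r) ∞
      (fun t => (⟨ρ t, s (ρ t)⟩ : TotalSpace (Fiber r) E)) t) :
    ContDiffAt ℝ ∞ (fun t => (trivializationAt (Fiber r) E k₁ ⟨ρ t, s (ρ t)⟩).2) t := by
  rw [(trivializationAt (Fiber r) E k₁).contMDiffAt_iff (Trivialization.mem_source _ |>.2 ht)] at h
  exact h.2.contDiffAt

/-- A frame along `ρ` near `b` can be continued to `[b, c]` if the bundle is trivialized there. -/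
theorem IsFrameNear.extend_of_trivialization {ρ : ℝ → LightCone} {τ : LightCone → ℝ}
    (hρ : ContMDiff 𝓘(ℝ, ℝ) 𝓘(ℝ, Space) ∞ ρ) (hτ : ∀ t, τ (ρ t) = t) {k₁ : LightCone} {b c : ℝ}
    (hbc : b ≤ c)
    (hbase : ∀ t ∈ Set.Icc b c, ρ t ∈ (trivializationAt (Fiber r) E k₁).baseSet)
    {F : Fin r → ∀ k, E k} (hF : IsFrameNear ρ F b) :
    ∃ F' : Fin r → ∀ k, E k, (∃ b' > b, ∀ t < b', ∀ i, F' i (ρ t) = F i (ρ t)) ∧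
      ∀ t ∈ Set.Icc b c, IsFrameNear ρ F' t := by
  let e := trivializationAt (Fiber r) E k₁
  have hb : ρ b ∈ e.baseSet := hbase b ⟨le_rfl, hbc⟩
  have hopen : ∀ᶠ s in nhds b, ρ s ∈ e.baseSet :=
    (e.open_baseSet.preimage hρ.continuous).mem_nhds hb
  have hg : ∀ᶠ s in nhds b, ∀ i, ContDiffAt ℝ ∞ (fun s => (e ⟨ρ s, F i (ρ s)⟩).2) s := by
    filter_upwards [hopen, hF] with s hs hFs i
    exact contDiffAt_coordinates hs (hFs.1 i)
  have hgb : LinearIndependent ℂ fun i => (e ⟨ρ b, F i (ρ b)⟩).2 :=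
    linearIndependent_coordinates hb hF.self_of_nhds.2
  obtain ⟨h, hsm, hli, hhg⟩ := exists_global_bases hg hgb
  obtain ⟨δ, hδ, hδg⟩ := Metric.eventually_nhds_iff_ball.1 (hhg.and hopen)
  -- The function `τ` recovers the parameter from the point and so allows data along the curve to
  -- define families on the cone. The old and new frames agree up to `b + δ`, so the switch at `b`
  -- is invisible to smoothness.
  let F' : Fin r → ∀ k, E k := fun i k => if τ k ≤ b then F i k else e.symm k (h (τ k) i)
  have hagree : ∀ t < b + δ, ∀ i, F' i (ρ t) = F i (ρ t) := by
    intro t ht i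
    by_cases htb : t ≤ b
    · simp only [F', hτ, htb, if_true]
    · have hd : t ∈ Metric.ball b δ := by
        rw [Metric.mem_ball, Real.dist_eq, abs_of_pos (by linarith)]
        linarith
      simp only [F', hτ, htb, if_false]
      rw [(hδg t hd).1]
      exact e.symm_apply_apply_mk (hδg t hd).2 _
  refine ⟨F', ⟨b + δ, by linarith, hagree⟩, fun t ht => ?_⟩
  rcases eq_or_lt_of_le ht.1 with rfl | hlt
  · refine hF.congr ?_
    filter_upwards [Iio_mem_nhds (show b < b + δ by linarith)] with s hs
    exact hagree s hs
  · refine isFrameNear_of_coordinates hρ (hbase t ht) h hsm hli ?_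
    filter_upwards [Ioi_mem_nhds hlt] with s hs i
    have : ¬ s ≤ b := not_le.2 hs
    simp only [F', hτ, this, if_false]
    rfl

/-- By compactness `[b, c]` is cut into finitely many intervals, each lying over one trivialization,
and the frame is continued across them one at a time. Agreement slightly past the starting point is
what keeps smoothness at the junctions. -/
theorem IsFrameNear.extend {ρ : ℝ → LightCone} {τ : LightCone → ℝ}
    (hρ : ContMDiff 𝓘(ℝ, ℝ) 𝓘(ℝ, Space) ∞ ρ) (hτ : ∀ t, τ (ρ t) = t) {b c : ℝ} (hbc : b ≤ c)
    {F : Fin r → ∀ k, E k} (hF : IsFrameNear ρ F b) :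
    ∃ F' : Fin r → ∀ k, E k, (∃ b' > b, ∀ t < b', ∀ i, F' i (ρ t) = F i (ρ t)) ∧
      ∀ t ∈ Set.Icc b c, IsFrameNear ρ F' t := by
  obtain ⟨x, hx0, hmono, ⟨n, hn⟩, hcov⟩ := exists_monotone_Icc_subset_open_cover_Icc hbc
    (c := fun k₁ : LightCone => {t : Set.Icc b c |
      ρ t ∈ (trivializationAt (Fiber r) E k₁).baseSet})
    (fun k₁ => (trivializationAt (Fiber r) E k₁).open_baseSet.preimage
      (hρ.continuous.comp continuous_subtype_val))
    (fun t _ => Set.mem_iUnion.2 ⟨ρ t, mem_baseSet_trivializationAt _ _ _⟩)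
  have key : ∀ m, ∃ F' : Fin r → ∀ k, E k,
      (∃ b' > b, ∀ t < b', ∀ i, F' i (ρ t) = F i (ρ t)) ∧
      ∀ t ∈ Set.Icc b (x m : ℝ), IsFrameNear ρ F' t := by
    intro m
    induction m with
    | zero =>
      refine ⟨F, ⟨b + 1, by simp, fun t _ i => rfl⟩, fun t ht => ?_⟩
      rw [hx0] at ht
      rw [le_antisymm ht.2 ht.1]
      exact hF
    | succ m ih =>
      obtain ⟨F₁, ⟨b₁, hb₁, h₁⟩, hg₁⟩ := ih
      obtain ⟨k₁, hk₁⟩ := hcov m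
      have hbm : b ≤ x m := (x m).2.1
      obtain ⟨F₂, ⟨b₂, hb₂, h₂⟩, hg₂⟩ := (hg₁ (x m) ⟨hbm, le_rfl⟩).extend_of_trivialization hρ hτ
        (k₁ := k₁) (c := x (m + 1)) (hmono (Nat.le_succ m))
        (fun t ht => hk₁ (show (⟨t, hbm.trans ht.1, ht.2.trans (x (m + 1)).2.2⟩ : Set.Icc b c) ∈ _
          from ht))
      refine ⟨F₂, ⟨min b₁ b₂, lt_min hb₁ (hbm.trans_lt hb₂), fun t ht i => ?_⟩, fun t ht => ?_⟩
      · rw [h₂ t (ht.trans_le (min_le_right _ _)), h₁ t (ht.trans_le (min_le_left _ _))]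
      · rcases le_total (x m : ℝ) t with h | h
        · exact hg₂ t ⟨h, ht.2⟩
        · refine (hg₁ t ⟨ht.1, h⟩).congr ?_
          filter_upwards [Iio_mem_nhds (h.trans_lt hb₂)] with s hs
          exact h₂ s hs
  obtain ⟨F', h1, h2⟩ := key n
  refine ⟨F', h1, ?_⟩
  rwa [hn n le_rfl] at h2

/-- Continuation by unit intervals; later stages never change the frame up to slightly past the end
of earlier ones, so the stages have a limit. -/
theorem IsFrameNear.extend_Ici {ρ : ℝ → LightCone} {τ : LightCone → ℝ}
    (hρ : ContMDiff 𝓘(ℝ, ℝ) 𝓘(ℝ, Space) ∞ ρ) (hτ : ∀ t, τ (ρ t) = t) {b : ℝ}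
    {F : Fin r → ∀ k, E k} (hF : IsFrameNear ρ F b) :
    ∃ F' : Fin r → ∀ k, E k, (∃ b' > b, ∀ t < b', ∀ i, F' i (ρ t) = F i (ρ t)) ∧
      ∀ t, b ≤ t → IsFrameNear ρ F' t := by
  have hstep : ∀ (n : ℕ) (F : Fin r → ∀ k, E k), ∃ F' : Fin r → ∀ k, E k,
      IsFrameNear ρ F (b + n) → (∃ b' > b + n, ∀ t < b', ∀ i, F' i (ρ t) = F i (ρ t)) ∧
        ∀ t ∈ Set.Icc (b + n) (b + (n + 1 : ℕ)), IsFrameNear ρ F' t := by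
    intro n F
    by_cases h : IsFrameNear ρ F (b + n)
    · obtain ⟨F', hF'⟩ := h.extend hρ hτ (c := b + (n + 1 : ℕ)) (by push_cast; linarith)
      exact ⟨F', fun _ => hF'⟩
    -- A default value, which makes `ext` total; the recursion only meets frames.
    · exact ⟨F, fun h' => absurd h' h⟩
  choose ext hext using hstep
  let Fs : ℕ → Fin r → ∀ k, E k := fun n => Nat.rec F (fun n F => ext n F) n
  have hgood : ∀ n, IsFrameNear ρ (Fs n) (b + n) := by
    intro n
    induction n with
    | zero => simpa [Fs] using hF
    | succ n ih => exact (hext n (Fs n) ih).2 _ ⟨by push_cast; linarith, le_rfl⟩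
  have hagree : ∀ n m : ℕ, n ≤ m → ∃ b' > b + n, ∀ t < b', ∀ i, Fs m i (ρ t) = Fs n i (ρ t) := by
    intro n m hnm
    induction m, hnm using Nat.le_induction with
    | base => exact ⟨b + n + 1, by simp, fun _ _ _ => rfl⟩
    | succ m hnm ih =>
      obtain ⟨b₁, hb₁, h₁⟩ := ih
      obtain ⟨b₂, hb₂, h₂⟩ := (hext m (Fs m) (hgood m)).1
      have hc : (n : ℝ) ≤ m := Nat.cast_le.2 hnm
      refine ⟨min b₁ b₂, lt_min hb₁ (by linarith), fun t ht i => ?_⟩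
      exact (h₂ t (ht.trans_le (min_le_right _ _)) i).trans
        (h₁ t (ht.trans_le (min_le_left _ _)) i)
  have hgood' : ∀ n : ℕ, ∀ t ∈ Set.Icc b (b + n), IsFrameNear ρ (Fs n) t := by
    intro n
    induction n with
    | zero =>
      intro t ht
      have : t = b := le_antisymm (by simpa using ht.2) ht.1
      rw [this]
      exact hF
    | succ n ih =>
      intro t ht
      rcases le_total (b + n) t with h | h
      · exact (hext n (Fs n) (hgood n)).2 t ⟨h, ht.2⟩
      · obtain ⟨b', hb', h'⟩ := hagree n (n + 1) (Nat.le_succ n)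
        refine (ih t ⟨ht.1, h⟩).congr ?_
        filter_upwards [Iio_mem_nhds (h.trans_lt hb')] with s hs
        exact h' s hs
  -- The limit family: the ceiling selects a stage after which the value at `k` is final.
  let F' : Fin r → ∀ k, E k := fun i k => Fs ⌈τ k - b⌉₊ i k
  have hF' : ∀ (n : ℕ) (t : ℝ), t ≤ b + n → ∀ i, F' i (ρ t) = Fs n i (ρ t) := by
    intro n t ht i
    have h1 : ⌈t - b⌉₊ ≤ n := Nat.ceil_le.2 (by linarith)
    obtain ⟨b', hb', h'⟩ := hagree _ _ h1
    have h2 : t < b' := by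
      have := Nat.le_ceil (t - b)
      linarith
    change Fs ⌈τ (ρ t) - b⌉₊ i (ρ t) = _
    rw [hτ]
    exact (h' t h2 i).symm
  refine ⟨F', ?_, ?_⟩
  · obtain ⟨b', hb', h'⟩ := hagree 0 1 zero_le_one
    refine ⟨min b' (b + 1), lt_min (by simpa using hb') (by simp), fun t ht i => ?_⟩
    rw [hF' 1 t (by simpa using (ht.trans_le (min_le_right _ _)).le)]
    exact h' t (ht.trans_le (min_le_left _ _)) i
  · intro t ht
    obtain ⟨n, hn⟩ := exists_nat_gt (t - b)
    refine (hgood' n t ⟨ht, by linarith⟩).congr ?_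
    filter_upwards [Iio_mem_nhds (show t < b + n by linarith)] with s hs
    exact hF' n s (le_of_lt hs)

/-- There is a global smooth frame along a curve with a left inverse. -/
theorem exists_frame_along {ρ : ℝ → LightCone} {τ : LightCone → ℝ}
    (hρ : ContMDiff 𝓘(ℝ, ℝ) 𝓘(ℝ, Space) ∞ ρ) (hτ : ∀ t, τ (ρ t) = t) :
    ∃ F : Fin r → ∀ k, E k, ∀ t, IsFrameNear ρ F t := by
  have h0 : IsFrameNear ρ (fun i k => (trivializationAt (Fiber r) E (ρ 0)).symm k
      (EuclideanSpace.single i (1 : ℂ))) 0 := by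
    refine isFrameNear_of_coordinates hρ (mem_baseSet_trivializationAt _ _ _)
      (fun _ i => EuclideanSpace.single i (1 : ℂ)) (fun i => contDiff_const) (fun _ => ?_)
      (Filter.Eventually.of_forall fun s i => rfl)
    rw [Fintype.linearIndependent_iff]
    intro c hc i
    simpa [Pi.single_apply] using congrArg (fun v : Fiber r => v i) hc
  obtain ⟨F₁, -, h₁⟩ := h0.extend_Ici hρ hτ
  -- The negative half-line is reached by reversing the curve. The extension agrees with `F₁` also
  -- slightly beyond `0`, so the two halves fit together.
  have h2 : IsFrameNear (fun s => ρ (-s)) F₁ 0 := by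
    simpa using (h₁ 0 le_rfl).neg
  have hρ' : ContMDiff 𝓘(ℝ, ℝ) 𝓘(ℝ, Space) ∞ (fun s => ρ (-s)) :=
    hρ.comp contDiff_neg.contMDiff
  obtain ⟨F₂, ⟨b', hb', hag⟩, h₂⟩ := h2.extend_Ici hρ' (τ := fun k => - τ k)
    (fun t => by rw [hτ, neg_neg])
  refine ⟨F₂, fun t => ?_⟩
  rcases le_or_gt t 0 with ht | ht
  · simpa using (h₂ (-t) (by linarith)).neg
  · refine (h₁ t ht.le).congr ?_
    filter_upwards [Ioi_mem_nhds ht] with s hs i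
    have h3 : F₂ i (ρ (- -s)) = F₁ i (ρ (- -s)) :=
      hag (-s) (by have : 0 < s := hs; linarith) i
    rwa [neg_neg] at h3

end FramesAlongCurves

section ExternalActions

universe u

variable {r : ℕ} {E : LightCone → Type u}
  [∀ k, AddCommGroup (E k)] [∀ k, Module ℂ (E k)] [∀ k, TopologicalSpace (E k)]
  [TopologicalSpace (TotalSpace (Fiber r) E)] [FiberBundle (Fiber r) E]

/-! ### External rotation actions trivialize the bundle -/

theorem log_norm_axisRay (t : ℝ) : Real.log ‖(axisRay t : Space)‖ = t := by
  change Real.log ‖Real.exp t • (axis 2 : Space)‖ = t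
  rw [norm_smul, norm_axis, mul_one, Real.norm_eq_abs, abs_of_pos (Real.exp_pos t), Real.log_exp]

theorem exists_rotation_axisRay (k : LightCone) :
    ∃ R : SO3, R • axisRay (Real.log ‖(k : Space)‖) = k := by
  obtain ⟨U, γ, -, hk, -, h⟩ := exists_smooth_rotation k
  exact ⟨γ k, h k hk⟩

variable [VectorBundle ℂ (Fiber r) E] [VectorBundle ℝ (Fiber r) E]
  [ContMDiffVectorBundle ∞ (Fiber r) E 𝓘(ℝ, Space)]

/-- The frame along the third axis is rotated to every point. Any choice of rotations `R k` defines
it, and externality makes the choice immaterial. -/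
theorem BundleAction.IsExternal.isTrivialBundle {A : BundleAction r E SO3} (hA : A.IsExternal) :
    IsTrivialBundle r E := by
  obtain ⟨F, hF⟩ := exists_frame_along (r := r) (E := E)
    (τ := fun k => Real.log ‖(k : Space)‖) contMDiff_axisRay log_norm_axisRay
  choose R hR using exists_rotation_axisRay
  refine isTrivialBundle_of_frame
    (fun i k => A.tr (R k) (hR k) (F i (axisRay (Real.log ‖(k : Space)‖)))) (fun i => ?_)
    (fun k => ?_)
  · intro k₁ _
    obtain ⟨U, γ, hU, hk₁, hγ, h⟩ := exists_smooth_rotation k₁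
    have hopen : IsOpen {k : LightCone | (k : Space) ∈ U} := hU.preimage continuous_subtype_val
    have h1 : ContMDiffOn 𝓘(ℝ, Space) (totalModel r) ∞
        (fun k : LightCone => (⟨axisRay (Real.log ‖(k : Space)‖),
          F i (axisRay (Real.log ‖(k : Space)‖))⟩ : TotalSpace (Fiber r) E))
        {k : LightCone | (k : Space) ∈ U} := by
      have h2 : ContMDiff 𝓘(ℝ, ℝ) (totalModel r) ∞
          (fun t => (⟨axisRay t, F i (axisRay t)⟩ : TotalSpace (Fiber r) E)) :=
        fun t => (hF t).self_of_nhds.1 i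
      exact (h2.comp contMDiff_log_norm).contMDiffOn
    have h2 := A.contMDiffOn_act hU hγ contMDiff_lightCone_coe.contMDiffOn h1 (fun k hk => hk)
    refine ((h2.contMDiffAt (hopen.mem_nhds hk₁)).congr_of_eventuallyEq ?_).contMDiffWithinAt
    filter_upwards [hopen.mem_nhds hk₁] with k hk
    -- Externality replaces the arbitrary rotation `R k` by the locally smooth `γ k`, which has the
    -- same effect on the base point.
    rw [← A.act_mk, hA (R k) (γ k) _ ((hR k).trans (h k hk).symm)]
  · exact (hF _).self_of_nhds.2.map' (A.trEquiv (R k) (hR k)).toLinearMap (LinearEquiv.ker _)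

end ExternalActions

section LittleGroup

universe u

variable {r : ℕ} {E : LightCone → Type u}
  [∀ k, AddCommGroup (E k)] [∀ k, Module ℂ (E k)] [∀ k, TopologicalSpace (E k)]
  [TopologicalSpace (TotalSpace (Fiber r) E)] [FiberBundle (Fiber r) E]

/-! ### Invariant subspaces of a fibre generate invariant subbundles -/

/-- Near every point, there is a smooth choice of a Poincaré transformation that carries the third
axis to `k`. -/
theorem exists_smooth_poincare (k₁ : LightCone) :
    ∃ (U : Set Space) (γ : Space → Poincare), IsOpen U ∧ (k₁ : Space) ∈ U ∧ SmoothInto γ U ∧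
      ∀ k : LightCone, (k : Space) ∈ U → γ k • axis 2 = k := by
  obtain ⟨U, γ, hU, hk₁, hγ, h⟩ := exists_smooth_rotation k₁
  refine ⟨U ∩ {k | k ≠ 0}, fun k => rotationHom (γ k) * ⟨0, boost (Real.log ‖k‖)⟩,
    hU.inter isOpen_ne, ⟨hk₁, k₁.ne_zero⟩,
    SmoothInto.mul_poincare (δ := fun k => ⟨0, boost (Real.log ‖k‖)⟩)
      (hγ.mono Set.inter_subset_left).rotationHom (smoothInto_boost ?_), ?_⟩
  · intro x hx
    exact ((contDiffAt_norm ℝ hx.2).log (norm_ne_zero_iff.2 hx.2)).contDiffWithinAt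
  · intro k hk
    rw [mul_smul, boost_smul_axis, rotationHom_smul]
    exact h k hk.1

theorem exists_poincare_smul (k : LightCone) : ∃ g : Poincare, g • axis 2 = k := by
  obtain ⟨U, γ, -, hk, -, h⟩ := exists_smooth_poincare k
  exact ⟨γ k, h k hk⟩

/-- The representation of the stabilizer of `k` on the fibre at `k`. -/
def BundleAction.stabilizerRep {G : Type} [Group G] [MulAction G LightCone] [LieCoordinates G]
    (A : BundleAction r E G) (k : LightCone) :
    MulAction.stabilizer G k →* Module.End ℂ (E k) where
  toFun g := A.tr g.1 g.2
  map_one' := by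
    ext v
    exact A.tr_one _ v
  map_mul' g h := by
    ext v
    exact A.tr_mul h.2 g.2 v

/-- Two transformations carrying the third axis to `k` differ by an element of the stabilizer, so
the transport of an invariant subspace depends on `k` only. -/
theorem BundleAction.map_tr_le (A : BundleAction r E Poincare) {W : Submodule ℂ (E (axis 2))}
    (hW : ∀ g, W ≤ W.comap (A.stabilizerRep (axis 2) g)) {g g' : Poincare} {k : LightCone}
    (h : g • axis 2 = k) (h' : g' • axis 2 = k) : W.map (A.tr g h) ≤ W.map (A.tr g' h') := by
  rintro _ ⟨w, hw, rfl⟩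
  have h1 : (g'⁻¹ * g) • axis 2 = axis 2 := by rw [mul_smul, h, ← h', inv_smul_smul]
  refine ⟨A.tr (g'⁻¹ * g) h1 w, hW ⟨_, h1⟩ hw, ?_⟩
  rw [← A.tr_mul h1 h']
  exact A.tr_congr (mul_inv_cancel_left _ _) _ _ _

/-- The transports of `W` form an invariant subbundle, with local frames obtained by moving a basis
of `W` smoothly. Irreducibility applies to it, and its fibre over the third axis is `W`. -/
theorem MasslessParticle.eq_bot_or_top [VectorBundle ℂ (Fiber r) E] (P : MasslessParticle r E)
    {W : Submodule ℂ (E (axis 2))}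
    (hW : ∀ g, W ≤ W.comap (P.stabilizerRep (axis 2) g)) : W = ⊥ ∨ W = ⊤ := by
  choose g hg using exists_poincare_smul
  have hfin : FiniteDimensional ℂ (E (axis 2)) := Module.Finite.equiv (coordAt r E _).symm
  let V : ∀ k, Submodule ℂ (E k) := fun k => W.map (P.tr (g k) (hg k))
  have hV : ∀ k (g' : Poincare) (h : g' • axis 2 = k), V k = W.map (P.tr g' h) := fun k g' h =>
    le_antisymm (P.map_tr_le hW _ _) (P.map_tr_le hW _ _)
  have hsub : IsSubbundle r E V := by
    refine ⟨Module.finrank ℂ W, fun k₁ => ?_⟩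
    obtain ⟨U, γ, hU, hk₁, hγ, h⟩ := exists_smooth_poincare k₁
    let b := Module.finBasis ℂ W
    classical
    refine ⟨{k | (k : Space) ∈ U}, hU.preimage continuous_subtype_val, hk₁,
      fun i k => if hk : γ k • axis 2 = k then P.tr (γ k) hk (b i) else 0, fun i => ?_,
      fun k hk => ⟨?_, ?_⟩⟩
    · refine (P.contMDiffOn_act hU hγ contMDiff_lightCone_coe.contMDiffOn
        (contMDiffOn_const (c := (⟨axis 2, b i⟩ : TotalSpace (Fiber r) E)))
        (fun k hk => hk)).congr fun k hk => ?_
      simp only [dif_pos (h k hk)]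
      rw [← P.act_mk]
    · simp only [dif_pos (h k hk)]
      exact (b.linearIndependent.map' W.subtype W.ker_subtype).map'
        (P.trEquiv (γ k) (h k hk)).toLinearMap (LinearEquiv.ker _)
    · simp only [dif_pos (h k hk)]
      rw [hV k (γ k) (h k hk)]
      have h1 : Submodule.span ℂ (Set.range fun i => (b i : E (axis 2))) = W := by
        have h2 := congrArg (Submodule.map W.subtype) b.span_eq
        rw [Submodule.map_span, ← Set.range_comp, Submodule.map_top, Submodule.range_subtype] at h2
        exact h2
      conv_rhs => rw [← h1]
      rw [Submodule.map_span, ← Set.range_comp]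
      rfl
  have hW0 : V (axis 2) = W := by
    rw [hV (axis 2) 1 (one_smul _ _)]
    have : P.tr 1 (one_smul Poincare (axis 2)) = LinearMap.id := LinearMap.ext (P.tr_one _)
    rw [this, Submodule.map_id]
  rcases P.irreducible V hsub (by
    rintro g' k _ ⟨w, hw, rfl⟩
    rw [P.act_mk g' rfl, ← P.tr_mul (hg k) rfl]
    change _ ∈ V (g' • k)
    rw [hV (g' • k) (g' * g k) (by rw [mul_smul, hg])]
    exact ⟨w, hw, rfl⟩) with h | h
  · exact Or.inl (hW0 ▸ h (axis 2))
  · exact Or.inr (hW0 ▸ h (axis 2))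

/-! ### The little group acts by scalars -/

/-- Translations, as elements of the stabilizer of the momentum along the third axis. -/
def translationStab (a : SpacetimeIndex → ℝ) : MulAction.stabilizer Poincare (axis 2) :=
  ⟨⟨a, 1⟩, fourMomentum_injective (by
    rw [Poincare.fourMomentum_smul, Lorentz.mat_one, one_mulVec])⟩

/-- Elements of the little group of the momentum along the third axis. -/
def lorentzStab (Λ : Lorentz) (h : Λ.mat *ᵥ fourMomentum (axis 2) = fourMomentum (axis 2)) :
    MulAction.stabilizer Poincare (axis 2) :=
  ⟨⟨0, Λ⟩, fourMomentum_injective (by rw [Poincare.fourMomentum_smul]; exact h)⟩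

theorem rotationAbout_smul_self (k : LightCone) (θ : ℝ) : rotationAbout k θ • k = k := by
  apply Subtype.ext
  apply WithLp.ofLp_injective
  rw [SO3.ofLp_smul, ← k.norm_smul_dir, Matrix.mulVec_smul]
  congr 1
  change rodrigues k.dir θ *ᵥ k.dir = k.dir
  have h := k.dir_dotProduct
  have hc : crossMatrix k.dir *ᵥ k.dir = 0 := by
    ext i
    fin_cases i <;> simp [crossMatrix, Matrix.mulVec, dotProduct, Fin.sum_univ_three] <;> ring
  have hr : rodrigues k.dir θ = Real.cos θ • (1 : Matrix (Fin 3) (Fin 3) ℝ)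
    + Real.sin θ • crossMatrix k.dir + (1 - Real.cos θ) • vecMulVec k.dir k.dir := rfl
  rw [hr, Matrix.add_mulVec, Matrix.add_mulVec, Matrix.smul_mulVec, Matrix.smul_mulVec,
    Matrix.smul_mulVec, hc, Matrix.vecMulVec_mulVec, h, Matrix.one_mulVec]
  ext i
  simp
  ring

theorem rotationAbout_smul_self' (k : LightCone) (θ : ℝ) :
    rotationHom (rotationAbout k θ) • k = k := by
  rw [rotationHom_smul, rotationAbout_smul_self]

/-- Rotations about the third axis, as elements of its stabilizer. -/
def rotationStab (θ : ℝ) : MulAction.stabilizer Poincare (axis 2) :=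
  ⟨rotationHom (rotationAbout (axis 2) θ), rotationAbout_smul_self' _ _⟩

theorem translationStab_add (a b : SpacetimeIndex → ℝ) :
    translationStab (a + b) = translationStab a * translationStab b := by
  apply Subtype.ext
  apply Poincare.ext
  · change a + b = a + (1 : Lorentz).mat *ᵥ b
    rw [Lorentz.mat_one, one_mulVec]
  · change (1 : Lorentz) = 1 * 1
    rw [one_mul]

theorem translationStab_zero : translationStab 0 = 1 := rfl

theorem lorentzStab_mul_translationStab (Λ : Lorentz)
    (h : Λ.mat *ᵥ fourMomentum (axis 2) = fourMomentum (axis 2)) (a : SpacetimeIndex → ℝ) :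
    lorentzStab Λ h * translationStab a = translationStab (Λ.mat *ᵥ a) * lorentzStab Λ h := by
  apply Subtype.ext
  apply Poincare.ext
  · change (0 : SpacetimeIndex → ℝ) + Λ.mat *ᵥ a = Λ.mat *ᵥ a + (1 : Lorentz).mat *ᵥ 0
    rw [mulVec_zero, zero_add, add_zero]
  · change Λ * 1 = 1 * Λ
    rw [one_mul, mul_one]

theorem rotation_mat_mulVec (θ : ℝ) :
    (rotationHom (rotationAbout (axis 2) θ)).lor.mat *ᵥ fourMomentum (axis 2) =
      fourMomentum (axis 2) := by
  rw [← Poincare.fourMomentum_smul, rotationAbout_smul_self']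

theorem rotationStab_eq (θ : ℝ) : rotationStab θ = lorentzStab _ (rotation_mat_mulVec θ) := rfl

theorem exists_stab_decomposition (g : MulAction.stabilizer Poincare (axis 2)) :
    ∃ (a : SpacetimeIndex → ℝ) (N : Lorentz) (hN : N.IsNullRotation (axis 2)) (θ : ℝ),
      g = translationStab a * lorentzStab N hN.1 * rotationStab θ := by
  have hg : g.1.lor.mat *ᵥ fourMomentum (axis 2) = fourMomentum (axis 2) := by
    rw [← Poincare.fourMomentum_smul]
    exact congrArg fourMomentum g.2
  obtain ⟨θ, N, h, hN⟩ := Lorentz.exists_decomposition hg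
  refine ⟨g.1.trans, N, hN, θ, ?_⟩
  apply Subtype.ext
  apply Poincare.ext
  · change _ = (g.1.trans + (1 : Lorentz).mat *ᵥ 0) + _ *ᵥ 0
    rw [mulVec_zero, mulVec_zero, add_zero, add_zero]
  · change _ = 1 * N * (rotationHom (rotationAbout (axis 2) θ)).lor
    rw [one_mul, h]

theorem rotationStab_comm (θ θ' : ℝ) : Commute (rotationStab θ) (rotationStab θ') := by
  apply Subtype.ext
  change rotationHom _ * rotationHom _ = rotationHom _ * rotationHom _
  rw [← map_mul, ← map_mul]
  congr 1
  have h := rotationAbout_conj (rotationAbout (axis 2) θ) (axis 2) θ'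
  rw [rotationAbout_smul_self] at h
  exact mul_inv_eq_iff_eq_mul.1 h

section Scalars

variable (P : MasslessParticle r E)

theorem MasslessParticle.stabilizerRep_nullRotation {N : Lorentz}
    (hN : N.IsNullRotation (axis 2)) : P.stabilizerRep (axis 2) (lorentzStab N hN.1) = 1 := by
  ext v
  exact P.tr_eq_of_act _ (P.inhomogeneous_trivial (axis 2) N hN.1 hN.2 v)

/-- Conjugation by `N` turns the translation by `a` into the translation by `N a`, while `N` itself
acts trivially. -/
theorem MasslessParticle.stabilizerRep_translation_sub {N : Lorentz}
    (hN : N.IsNullRotation (axis 2)) (a : SpacetimeIndex → ℝ) :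
    P.stabilizerRep (axis 2) (translationStab (N.mat *ᵥ a - a)) = 1 := by
  have h := congrArg (P.stabilizerRep (axis 2)) (lorentzStab_mul_translationStab N hN.1 a)
  rw [map_mul, map_mul, P.stabilizerRep_nullRotation hN, one_mul, mul_one] at h
  rw [sub_eq_add_neg, translationStab_add, map_mul, ← h, ← map_mul, ← translationStab_add,
    add_neg_cancel, translationStab_zero, map_one]

theorem MasslessParticle.stabilizerRep_transverse (u v : ℝ) :
    P.stabilizerRep (axis 2) (translationStab (Sum.elim (fun _ => 0) ![u, v, 0])) = 1 := by
  have h1 := P.stabilizerRep_translation_sub (nullRotation_isNullRotation (u / 2) (v / 2))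
    (Sum.elim (fun _ => 1) ![0, 0, 0])
  have h2 := P.stabilizerRep_translation_sub (nullRotation_isNullRotation (-(u / 2)) (-(v / 2)))
    (Sum.elim (fun _ => 1) ![0, 0, 0])
  rw [nullRotation_mulVec_time] at h1 h2
  -- The null rotations with parameters `±(u/2, v/2)` displace the time vector by amounts with equal
  -- quadratic parts, so the difference is the transverse vector `(u, v)`.
  have h3 : (Sum.elim (fun _ => ((u / 2) ^ 2 + (v / 2) ^ 2) / 2)
      ![u / 2, v / 2, ((u / 2) ^ 2 + (v / 2) ^ 2) / 2] : SpacetimeIndex → ℝ) =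
      Sum.elim (fun _ => 0) ![u, v, 0] + Sum.elim (fun _ => ((-(u / 2)) ^ 2 + (-(v / 2)) ^ 2) / 2)
      ![-(u / 2), -(v / 2), ((-(u / 2)) ^ 2 + (-(v / 2)) ^ 2) / 2] := by
    apply spacetime_funext <;> simp <;> ring
  rw [h3, translationStab_add, map_mul, h2, mul_one] at h1
  exact h1

/-- A rotation about the third axis changes `a` by a transverse vector only, and transverse
translations act trivially. -/
theorem MasslessParticle.commute_translation_rotation (a : SpacetimeIndex → ℝ) (θ : ℝ) :
    Commute (P.stabilizerRep (axis 2) (translationStab a))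
      (P.stabilizerRep (axis 2) (rotationStab θ)) := by
  have h := congrArg (P.stabilizerRep (axis 2))
    (lorentzStab_mul_translationStab _ (rotation_mat_mulVec θ) a)
  rw [map_mul, map_mul, ← rotationStab_eq] at h
  have h1 : (rotationHom (rotationAbout (axis 2) θ)).lor.mat *ᵥ a =
      Sum.elim (fun _ => 0)
        ![Real.cos θ * a (Sum.inr 0) - Real.sin θ * a (Sum.inr 1) - a (Sum.inr 0),
        Real.sin θ * a (Sum.inr 0) + Real.cos θ * a (Sum.inr 1) - a (Sum.inr 1), 0] + a := by
    rw [rotation_mat]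
    apply spacetime_funext <;> rw [mulVec_spacetime]
    · change 1 * _ + 0 * _ + 0 * _ + 0 * _ = 0 + a (Sum.inl ())
      ring
    · change 0 * _ + Real.cos θ * _ + -Real.sin θ * _ + 0 * _ = Real.cos θ * a (Sum.inr 0) -
        Real.sin θ * a (Sum.inr 1) - a (Sum.inr 0) + a (Sum.inr 0)
      ring
    · change 0 * _ + Real.sin θ * _ + Real.cos θ * _ + 0 * _ = Real.sin θ * a (Sum.inr 0) +
        Real.cos θ * a (Sum.inr 1) - a (Sum.inr 1) + a (Sum.inr 1)
      ring
    · change 0 * _ + 0 * _ + 0 * _ + 1 * _ = 0 + a (Sum.inr 2)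
      ring
  rw [h1, translationStab_add, map_mul, P.stabilizerRep_transverse, one_mul] at h
  exact h.symm

theorem MasslessParticle.stabilizerRep_commute (g g' : MulAction.stabilizer Poincare (axis 2)) :
    Commute (P.stabilizerRep (axis 2) g) (P.stabilizerRep (axis 2) g') := by
  obtain ⟨a, N, hN, θ, rfl⟩ := exists_stab_decomposition g
  obtain ⟨a', N', hN', θ', rfl⟩ := exists_stab_decomposition g'
  rw [map_mul, map_mul, map_mul, map_mul, P.stabilizerRep_nullRotation hN,
    P.stabilizerRep_nullRotation hN', mul_one, mul_one]
  have h1 : Commute (translationStab a) (translationStab a') := by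
    rw [commute_iff_eq, ← translationStab_add, ← translationStab_add, add_comm]
  have h2 := h1.map (P.stabilizerRep (axis 2))
  have h3 := (rotationStab_comm θ θ').map (P.stabilizerRep (axis 2))
  exact (h2.mul_right (P.commute_translation_rotation a θ')).mul_left
    ((P.commute_translation_rotation a' θ).symm.mul_right h3)

variable [VectorBundle ℂ (Fiber r) E]

theorem MasslessParticle.nontrivial_fiber (P : MasslessParticle r E) (k : LightCone) : Nontrivial (E k) := by
  have h := finrank_fiber (r := r) (E := E) k
  exact Module.nontrivial_of_finrank_pos (R := ℂ) (by rw [h]; exact P.rank_pos)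

/-- Schur's argument: by commutativity an eigenspace is invariant under the stabilizer, so it is the
whole fibre. -/
theorem MasslessParticle.stabilizerRep_scalar (g : MulAction.stabilizer Poincare (axis 2)) :
    ∃ c : ℂ, ∀ v, P.stabilizerRep (axis 2) g v = c • v := by
  have hfin : FiniteDimensional ℂ (E (axis 2)) := Module.Finite.equiv (coordAt r E _).symm
  have := P.nontrivial_fiber (axis 2)
  obtain ⟨c, hc⟩ := Module.End.exists_eigenvalue (P.stabilizerRep (axis 2) g)
  refine ⟨c, fun v => ?_⟩
  rcases P.eq_bot_or_top (W := Module.End.eigenspace (P.stabilizerRep (axis 2) g) c)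
    (fun g' v hv => by
      rw [Module.End.mem_eigenspace_iff] at hv
      rw [Submodule.mem_comap, Module.End.mem_eigenspace_iff]
      have h := LinearMap.congr_fun (P.stabilizerRep_commute g g') v
      rw [Module.End.mul_apply, Module.End.mul_apply, hv, map_smul] at h
      exact h) with h | h
  · exact absurd h hc
  · rw [← Module.End.mem_eigenspace_iff, h]
    trivial

theorem MasslessParticle.rank_eq_one (P : MasslessParticle r E) : r = 1 := by
  have := P.nontrivial_fiber (axis 2)
  obtain ⟨v, hv⟩ := exists_ne (0 : E (axis 2))
  have h := P.eq_bot_or_top (W := Submodule.span ℂ {v}) (fun g w hw => by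
    obtain ⟨c, hc⟩ := P.stabilizerRep_scalar g
    rw [Submodule.mem_comap, hc]
    exact Submodule.smul_mem _ _ hw)
  rcases h with h | h
  · exact absurd (Submodule.span_singleton_eq_bot.1 h) hv
  · rw [← finrank_fiber (r := r) (E := E) (axis 2), ← finrank_top, ← h, finrank_span_singleton hv]

end Scalars

end LittleGroup

/-! ### Characters of the circle group -/

/-- Multiplicativity spreads the derivative `κ` at `0` to the equation `c' = κ c`, whose solution is
`exp(κ θ)`; the period forces `κ` to be an integer multiple of `i`. -/
theorem exists_int_of_character {c : ℝ → ℂ} (hd : DifferentiableAt ℝ c 0)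
    (hadd : ∀ a b, c (a + b) = c a * c b) (h0 : c 0 = 1) (hper : c (2 * Real.pi) = 1) :
    ∃ h : ℤ, ∀ θ : ℝ, c θ = Complex.exp (-(Complex.I * h * θ)) := by
  obtain ⟨κ, hκ⟩ : ∃ κ, HasDerivAt c κ 0 := ⟨_, hd.hasDerivAt⟩
  have hc : ∀ θ, HasDerivAt c (c θ * κ) θ := by
    intro θ
    have h1 : HasDerivAt (fun s => c (s - θ)) κ θ := by
      have h2 := HasDerivAt.comp_sub_const (f := c) (f' := κ) θ θ (by rwa [sub_self])
      exact h2
    have h2 := h1.const_mul (c θ)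
    refine h2.congr_of_eventuallyEq (Filter.Eventually.of_forall fun s => ?_)
    change c s = c θ * c (s - θ)
    rw [← hadd, add_sub_cancel]
  have hexp : ∀ θ : ℝ, HasDerivAt (fun s : ℝ => Complex.exp (-κ * s))
      (Complex.exp (-κ * θ) * -κ) θ := by
    intro θ
    have h1 : HasDerivAt (fun s : ℝ => -κ * (s : ℂ)) (-κ * 1) θ :=
      (Complex.ofRealCLM.hasDerivAt (x := θ)).const_mul (-κ)
    rw [mul_one] at h1
    exact h1.cexp
  have hprod : ∀ θ, HasDerivAt (fun s : ℝ => c s * Complex.exp (-κ * s)) 0 θ := by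
    intro θ
    exact ((hc θ).mul (hexp θ)).congr_deriv (by ring)
  have hconst : ∀ θ : ℝ, c θ * Complex.exp (-κ * θ) = 1 := by
    intro θ
    have h := is_const_of_deriv_eq_zero (fun x => (hprod x).differentiableAt)
      (fun x => (hprod x).deriv) θ 0
    simpa [h0] using h
  have hcexp : ∀ θ : ℝ, c θ = Complex.exp (κ * θ) := by
    intro θ
    have h := hconst θ
    rw [neg_mul, Complex.exp_neg] at h
    exact (mul_inv_eq_one₀ (Complex.exp_ne_zero _)).1 h
  rw [hcexp, Complex.exp_eq_one_iff] at hper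
  obtain ⟨n, hn⟩ := hper
  have hκn : κ = n * Complex.I := by
    have hpi : (2 * Real.pi : ℂ) ≠ 0 := by
      exact_mod_cast Real.two_pi_pos.ne'
    apply mul_right_cancel₀ hpi
    push_cast at hn
    rw [hn]
    ring
  -- The minus sign comes from the convention `exp(-i h θ)` for the helicity.
  refine ⟨-n, fun θ => ?_⟩
  rw [hcexp, hκn]
  congr 1
  push_cast
  ring

theorem int_eq_of_exp_eq {h h' : ℤ} (H : ∀ θ : ℝ, Complex.exp (-(Complex.I * h * θ)) =
    Complex.exp (-(Complex.I * h' * θ))) : h = h' := by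
  -- The angle `1` alone suffices: it makes `h - h'` an integer multiple of `2π`, and `π` is
  -- irrational.
  obtain ⟨n, hn⟩ := Complex.exp_eq_exp_iff_exists_int.1 (H 1)
  have h1 : (h : ℂ) - h' = -(n * (2 * Real.pi)) := by
    apply mul_left_cancel₀ Complex.I_ne_zero
    push_cast at hn
    linear_combination -hn
  have h2 : ((h - h' : ℤ) : ℝ) = -((n : ℝ) * (2 * Real.pi)) := by
    exact_mod_cast h1
  by_cases hn0 : n = 0
  · rw [hn0] at h2
    simp only [Int.cast_zero, zero_mul, neg_zero] at h2
    exact sub_eq_zero.1 (Int.cast_eq_zero.1 h2)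
  · exfalso
    apply irrational_pi
    refine ⟨((h - h' : ℤ) : ℚ) / (-(2 * n)), ?_⟩
    have : (n : ℝ) ≠ 0 := Int.cast_ne_zero.2 hn0
    rw [Rat.cast_div, Rat.cast_intCast, h2]
    push_cast
    field_simp

/-! ### The circle of rotations about a momentum -/

theorem rotationAbout_axis_add (a b : ℝ) : rotationAbout (axis 2) (a + b) =
    rotationAbout (axis 2) a * rotationAbout (axis 2) b := by
  apply SO3.ext
  change _ = (rotationAbout (axis 2) a).1 * (rotationAbout (axis 2) b).1
  rw [rotationAbout_axis_two, rotationAbout_axis_two, rotationAbout_axis_two, Real.cos_add,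
    Real.sin_add]
  ext i j
  fin_cases i <;> fin_cases j <;> simp [Matrix.mul_apply, Fin.sum_univ_three] <;> ring

theorem rotationAbout_axis_eq_one {θ : ℝ} (hc : Real.cos θ = 1) (hs : Real.sin θ = 0) :
    rotationAbout (axis 2) θ = 1 := by
  apply SO3.ext
  rw [rotationAbout_axis_two, hc, hs]
  ext i j
  fin_cases i <;> fin_cases j <;> simp

theorem dir_axisRay (t : ℝ) : (axisRay t).dir = (axis 2).dir := by
  have h : ‖(axisRay t : Space)‖ = Real.exp t := by
    change ‖Real.exp t • (axis 2 : Space)‖ = _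
    rw [norm_smul, norm_axis, mul_one, Real.norm_eq_abs, abs_of_pos (Real.exp_pos t)]
  rw [LightCone.dir_eq, LightCone.dir_eq, h, norm_axis]
  change (Real.exp t)⁻¹ • Real.exp t • WithLp.ofLp (axis 2 : Space) = _
  rw [smul_smul, inv_mul_cancel₀ (Real.exp_ne_zero t), inv_one]

/-- All rotations about a momentum are conjugate to the rotations about the third axis. -/
theorem exists_conj_rotationAbout (k : LightCone) : ∃ g : Poincare, g • axis 2 = k ∧
    ∀ θ, rotationHom (rotationAbout k θ) * g = g * rotationHom (rotationAbout (axis 2) θ) := by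
  obtain ⟨R, hR⟩ := exists_rotation_axisRay k
  -- The boost along the third axis commutes with the rotations about it; `R` then conjugates these
  -- into rotations about `k`.
  refine ⟨rotationHom R * ⟨0, boost (Real.log ‖(k : Space)‖)⟩, ?_, fun θ => ?_⟩
  · rw [mul_smul, boost_smul_axis, rotationHom_smul, hR]
  · have h1 := rotationAbout_conj R (axisRay (Real.log ‖(k : Space)‖)) θ
    rw [hR] at h1
    have h2 : rotationAbout (axisRay (Real.log ‖(k : Space)‖)) θ = rotationAbout (axis 2) θ := by
      rw [rotationAbout_eq, rotationAbout_eq, dir_axisRay]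
    rw [h2] at h1
    have h3 := boost_comm_rotation (Real.log ‖(k : Space)‖) θ
    rw [← h1, map_mul, map_mul, map_inv]
    simp only [mul_assoc]
    rw [inv_mul_cancel_left, h3]

section Helicity

universe u

variable {r : ℕ} {E : LightCone → Type u}
  [∀ k, AddCommGroup (E k)] [∀ k, Module ℂ (E k)] [∀ k, TopologicalSpace (E k)]
  [TopologicalSpace (TotalSpace (Fiber r) E)] [FiberBundle (Fiber r) E]
  [VectorBundle ℂ (Fiber r) E] [VectorBundle ℝ (Fiber r) E]
  [ContMDiffVectorBundle ∞ (Fiber r) E 𝓘(ℝ, Space)]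

/-! ### The helicity -/

theorem BundleAction.contDiff_rotation_coord (A : BundleAction r E SO3) (k : LightCone)
    (v : E k) : ContDiff ℝ ∞ fun θ : ℝ => coordAt r E k
      (A.tr (rotationAbout k θ) (rotationAbout_smul_self k θ) v) := by
  have h1 : ContMDiffOn 𝓘(ℝ, ℝ) (totalModel r) ∞
      (fun θ : ℝ => A.act (rotationAbout k θ) (⟨k, v⟩ : TotalSpace (Fiber r) E)) Set.univ := by
    refine A.contMDiffOn_act (m := 1) (γ := fun u => rotationAbout k (u 0)) isOpen_univ
      (smoothInto_rotationAbout k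
        (EuclideanSpace.proj 0 : EuclideanSpace ℝ (Fin 1) →L[ℝ] ℝ).contDiff.contDiffOn)
      (f := fun θ => EuclideanSpace.single 0 θ)
      (s := fun _ => ⟨k, v⟩) ?_ contMDiffOn_const (fun _ _ => Set.mem_univ _) |>.congr ?_
    · refine ContMDiff.contMDiffOn (ContDiff.contMDiff ?_)
      rw [contDiff_euclidean]
      intro i
      fin_cases i
      simp only [EuclideanSpace.single, Fin.zero_eta]
      exact contDiff_id
    · intro θ _
      simp
  rw [contDiff_iff_contDiffAt]
  intro θ
  have h2 := (contMDiffOn_univ.1 h1) θ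
  rw [contMDiffAt_totalSpace] at h2
  have h3 := h2.2.contDiffAt
  simp only [A.act_mk _ (rotationAbout_smul_self k _)] at h3
  exact h3

theorem MasslessParticle.rotations_tr (P : MasslessParticle r E) (R : SO3) {k k' : LightCone}
    (h : R • k = k') (v : E k) :
    P.toBundleAction.rotations.tr R h v =
      P.tr (rotationHom R) (by rw [rotationHom_smul, h]) v := by
  apply BundleAction.tr_eq_of_act
  exact P.act_mk _ _ v

theorem MasslessParticle.hasHelicity_of_axis (P : MasslessParticle r E) {h : ℤ}
    (hh : ∀ (θ : ℝ) (v : E (axis 2)), P.stabilizerRep (axis 2) (rotationStab θ) v =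
      Complex.exp (-(Complex.I * h * θ)) • v) : P.HasHelicity h := by
  intro k θ v
  obtain ⟨g, hg, hconj⟩ := exists_conj_rotationAbout k
  obtain ⟨w, rfl⟩ := (P.trEquiv g hg).surjective v
  rw [P.trEquiv_apply, ← P.act_mk g hg, ← P.act_mul, hconj, P.act_mul,
    P.act_mk _ (rotationAbout_smul_self' (axis 2) θ)]
  have h1 : P.tr (rotationHom (rotationAbout (axis 2) θ)) (rotationAbout_smul_self' (axis 2) θ) w =
      Complex.exp (-(Complex.I * h * θ)) • w := hh θ w
  rw [h1, P.act_mk g hg, map_smul]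

theorem MasslessParticle.exists_helicity (P : MasslessParticle r E) : ∃ h, P.HasHelicity h := by
  choose c hc using fun θ : ℝ => P.stabilizerRep_scalar (rotationStab θ)
  have := P.nontrivial_fiber (axis 2)
  obtain ⟨v, hv⟩ := exists_ne (0 : E (axis 2))
  have hinj : ∀ {a b : ℂ}, a • v = b • v → a = b := fun h => smul_left_injective ℂ hv h
  -- The scalar `c θ` is recovered as the quotient of a nonvanishing coordinate of the rotated
  -- vector by that of `v`, so it inherits the smoothness of the action.
  have hd : DifferentiableAt ℝ c 0 := by
    have hw : coordAt r E (axis 2) v ≠ 0 := by simpa using hv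
    obtain ⟨j, hj⟩ : ∃ j, coordAt r E (axis 2) v j ≠ 0 := by
      by_contra! hcon
      exact hw (by ext j; exact hcon j)
    have h1 := P.toBundleAction.rotations.contDiff_rotation_coord (axis 2) v
    have h2 : ∀ θ, coordAt r E (axis 2) (P.toBundleAction.rotations.tr (rotationAbout (axis 2) θ)
        (rotationAbout_smul_self (axis 2) θ) v) = c θ • coordAt r E (axis 2) v := by
      intro θ
      rw [← map_smul, ← hc θ v, P.rotations_tr]
      rfl
    simp only [h2] at h1
    have h3 := ((EuclideanSpace.proj j : Fiber r →L[ℂ] ℂ).restrictScalars ℝ).contDiff.comp h1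
    have h4 : c = fun θ => (c θ • coordAt r E (axis 2) v) j / coordAt r E (axis 2) v j := by
      funext θ
      simp [hj]
    rw [h4]
    exact ((h3.differentiable (by simp)).div_const _).differentiableAt
  obtain ⟨h, hh⟩ := exists_int_of_character hd (fun a b => hinj (by
      have : rotationStab (a + b) = rotationStab a * rotationStab b := Subtype.ext (by
        change rotationHom _ = rotationHom _ * rotationHom _
        rw [← map_mul, rotationAbout_axis_add])
      rw [← hc, this, map_mul, Module.End.mul_apply, hc b, hc a, smul_smul]))
    (hinj (by
      rw [← hc, one_smul]
      have : rotationStab 0 = 1 := Subtype.ext (by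
        change rotationHom _ = 1
        rw [rotationAbout_axis_eq_one Real.cos_zero Real.sin_zero, map_one])
      rw [this, map_one, Module.End.one_apply]))
    (hinj (by
      rw [← hc, one_smul]
      have : rotationStab (2 * Real.pi) = 1 := Subtype.ext (by
        change rotationHom _ = 1
        rw [rotationAbout_axis_eq_one Real.cos_two_pi Real.sin_two_pi, map_one])
      rw [this, map_one, Module.End.one_apply]))
  exact ⟨h, P.hasHelicity_of_axis fun θ w => by rw [hc, hh]⟩

theorem MasslessParticle.HasHelicity.unique {P : MasslessParticle r E} {h h' : ℤ}
    (H : P.HasHelicity h) (H' : P.HasHelicity h') : h = h' := by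
  have := P.nontrivial_fiber (axis 2)
  obtain ⟨v, hv⟩ := exists_ne (0 : E (axis 2))
  refine int_eq_of_exp_eq fun θ => smul_left_injective ℂ hv ?_
  exact TotalSpace.mk_inj.1 ((H (axis 2) θ v).symm.trans (H' (axis 2) θ v))

/-! ### Helicity zero makes the rotations external -/

/-- The inclusion of the Lorentz group into the Poincaré group. -/
def lorentzHom : Lorentz →* Poincare where
  toFun Λ := ⟨0, Λ⟩
  map_one' := rfl
  map_mul' Λ Λ' := by
    apply Poincare.ext
    · change (0 : SpacetimeIndex → ℝ) = 0 + Λ.mat *ᵥ 0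
      rw [mulVec_zero, add_zero]
    · rfl

theorem rotationHom_eq (R : SO3) : rotationHom R = lorentzHom (rotationHom R).lor := rfl

theorem MasslessParticle.HasHelicity.tr_lorentzHom {P : MasslessParticle r E}
    (H : P.HasHelicity 0) {Λ : Lorentz} (hΛ : lorentzHom Λ • axis 2 = axis 2) (v : E (axis 2)) :
    P.act (lorentzHom Λ) ⟨axis 2, v⟩ = ⟨axis 2, v⟩ := by
  have hfix : Λ.mat *ᵥ fourMomentum (axis 2) = fourMomentum (axis 2) := by
    have h := Poincare.fourMomentum_smul (lorentzHom Λ) (axis 2)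
    rw [hΛ] at h
    exact h.symm
  obtain ⟨θ, N, rfl, hN⟩ := Lorentz.exists_decomposition hfix
  rw [map_mul, P.act_mul, ← rotationHom_eq, H (axis 2) θ v]
  simp only [Int.cast_zero, mul_zero, zero_mul, neg_zero, Complex.exp_zero, one_smul]
  exact P.inhomogeneous_trivial (axis 2) N hN.1 hN.2 v

/-- The rotations of a particle of helicity zero act externally. -/
theorem MasslessParticle.HasHelicity.isExternal {P : MasslessParticle r E}
    (H : P.HasHelicity 0) : P.toBundleAction.rotations.IsExternal := by
  intro R₁ R₂ k hk v
  obtain ⟨R, hR⟩ := exists_rotation_axisRay k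
  -- The momentum is reached by a Lorentz transformation without translation part. Staying inside
  -- the Lorentz group matters, because translations may act on the fibres by nontrivial scalars.
  obtain ⟨G, hG⟩ : ∃ G : Lorentz, lorentzHom G • axis 2 = k := by
    refine ⟨(rotationHom R).lor * boost (Real.log ‖(k : Space)‖), ?_⟩
    rw [map_mul, mul_smul, ← rotationHom_eq, rotationHom_smul]
    refine Eq.trans (congrArg (R • ·) (boost_smul_axis _)) hR
  obtain ⟨w, rfl⟩ := (P.trEquiv _ hG).surjective v
  change P.act (rotationHom R₁) _ = P.act (rotationHom R₂) _
  rw [← rotationHom_smul, ← rotationHom_smul] at hk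
  rw [P.trEquiv_apply, ← P.act_mk _ hG, ← P.act_mul, ← P.act_mul]
  generalize rotationHom_eq R₁ = h₁, rotationHom_eq R₂ = h₂
  rw [h₁, h₂] at hk ⊢
  generalize (rotationHom R₁).lor = Λ₁ at hk ⊢
  generalize (rotationHom R₂).lor = Λ₂ at hk ⊢
  -- The discrepancy between the two rotations, pulled back by `G`, fixes the third axis, so it acts
  -- trivially at helicity zero.
  have h : lorentzHom Λ₁ * lorentzHom G =
      lorentzHom Λ₂ * lorentzHom G * lorentzHom (G⁻¹ * Λ₂⁻¹ * Λ₁ * G) := by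
    rw [← map_mul, ← map_mul, ← map_mul]
    congr 1
    group
  rw [h, P.act_mul, H.tr_lorentzHom]
  rw [map_mul, map_mul, map_mul, map_inv, map_inv, mul_smul, mul_smul, mul_smul, hG, hk,
    inv_smul_smul, ← hG, inv_smul_smul]

end Helicity

/-! ### A winding number obstruction -/

/-- Two logarithms of `w` differ by an integer multiple of `2πi`, and a continuous integer-valued
function on the line is constant. -/
theorem constant_of_exp_const {φ : ℝ → ℂ} (hφ : Continuous φ) {w : ℂ}
    (h : ∀ α, Complex.exp (φ α) = w) (α : ℝ) : φ α = φ 0 := by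
  have h1 : ∀ α, ∃ n : ℤ, φ α = φ 0 + n * (2 * Real.pi * Complex.I) := fun α =>
    Complex.exp_eq_exp_iff_exists_int.1 ((h α).trans (h 0).symm)
  choose m hm using h1
  have hpi : (2 * Real.pi * Complex.I : ℂ) ≠ 0 := by
    simp [Real.pi_ne_zero]
  have hmc : Continuous m := by
    rw [Int.isClosedEmbedding_coe_real.isInducing.continuous_iff]
    have h2 : (fun α => ((m α : ℤ) : ℝ)) = fun α => ((φ α - φ 0) / (2 * Real.pi * Complex.I)).re := by
      funext α
      rw [hm α, add_sub_cancel_left, mul_div_cancel_right₀ _ hpi, Complex.intCast_re]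
    change Continuous fun α => ((m α : ℤ) : ℝ)
    rw [h2]
    fun_prop
  have h3 : m α = m 0 := PreconnectedSpace.constant inferInstance hmc
  rw [hm α, h3, ← hm 0]

/-- The plane is simply connected, so `g` has a continuous logarithm `L`. On the circle `L - i n α`
is constant; comparing `α = 0` with `α = 2π`, where `L` takes the same value, gives `n = 0`. -/
theorem winding_eq_zero {g : EuclideanSpace ℝ (Fin 2) → ℂ} (hg : Continuous g)
    (hg0 : ∀ u, g u ≠ 0) {n : ℤ} {w : ℂ}
    (h : ∀ α : ℝ, g !₂[Real.cos α, Real.sin α] = Complex.exp (Complex.I * n * α) * w) : n = 0 := by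
  obtain ⟨L, hL, hexp⟩ := Complex.exists_continuousOn_eqOn_exp_comp
    (U := (Set.univ : Set (EuclideanSpace ℝ (Fin 2)))) (by
      have : ContractibleSpace (Set.univ : Set (EuclideanSpace ℝ (Fin 2))) :=
        (convex_univ (𝕜 := ℝ)).contractibleSpace Set.univ_nonempty
      exact SimplyConnectedSpace.ofContractible _) isOpen_univ
    hg.continuousOn (by simpa using hg0)
  rw [continuousOn_univ] at hL
  let φ : ℝ → ℂ := fun α => L !₂[Real.cos α, Real.sin α] - Complex.I * n * α
  have hφ : Continuous φ := by
    have h1 : Continuous fun α : ℝ => (!₂[Real.cos α, Real.sin α] : EuclideanSpace ℝ (Fin 2)) := by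
      refine (PiLp.continuous_toLp 2 _).comp (continuous_pi fun i => ?_)
      fin_cases i
      exacts [Real.continuous_cos, Real.continuous_sin]
    exact (hL.comp h1).sub (by fun_prop)
  have hw : ∀ α, Complex.exp (φ α) = w := by
    intro α
    have h1 : Complex.exp (L !₂[Real.cos α, Real.sin α]) = g !₂[Real.cos α, Real.sin α] :=
      hexp (Set.mem_univ _)
    simp only [φ]
    rw [Complex.exp_sub, h1, h α]
    field_simp [Complex.exp_ne_zero]
  have h2 := constant_of_exp_const hφ hw (2 * Real.pi)
  simp only [φ, Real.cos_two_pi, Real.sin_two_pi, Real.cos_zero, Real.sin_zero] at h2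
  have h3 : (n : ℂ) * (2 * Real.pi * Complex.I) = 0 := by
    push_cast at h2
    linear_combination -h2
  have hpi : (2 * Real.pi * Complex.I : ℂ) ≠ 0 := by
    simp [Real.pi_ne_zero]
  exact_mod_cast (mul_eq_zero.1 h3).resolve_right hpi

/-- A family of rotations over the plane which on the unit circle is twice the loop of rotations
about the third axis. -/
def planeRotation (u : EuclideanSpace ℝ (Fin 2)) : SO3 :=
  quatRotation (u 0) ![1 - u 0 ^ 2 - u 1 ^ 2, 0, u 1]

/-- The defining quaternion never vanishes: if both plane coordinates are `0`, its first vector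
component is `1`. -/
theorem smoothInto_planeRotation : SmoothInto planeRotation Set.univ := by
  have h0 : ContDiff ℝ ∞ fun u : EuclideanSpace ℝ (Fin 2) => u 0 :=
    (EuclideanSpace.proj 0 : EuclideanSpace ℝ (Fin 2) →L[ℝ] ℝ).contDiff
  have h1 : ContDiff ℝ ∞ fun u : EuclideanSpace ℝ (Fin 2) => u 1 :=
    (EuclideanSpace.proj 1 : EuclideanSpace ℝ (Fin 2) →L[ℝ] ℝ).contDiff
  refine smoothInto_quatRotation h0.contDiffOn ?_ ?_
  · intro i
    fin_cases i
    · exact ((contDiff_const.sub (h0.pow 2)).sub (h1.pow 2)).contDiffOn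
    · exact contDiffOn_const
    · exact h1.contDiffOn
  · intro u _ h
    simp [quatNormSq] at h
    have e0 : u 0 ^ 2 = 0 := by nlinarith [sq_nonneg (u 0), sq_nonneg (u 1), sq_nonneg (1 - u 0 ^ 2 - u 1 ^ 2)]
    have e1 : u 1 ^ 2 = 0 := by nlinarith [sq_nonneg (u 0), sq_nonneg (u 1), sq_nonneg (1 - u 0 ^ 2 - u 1 ^ 2)]
    rw [e0, e1] at h
    norm_num at h

/-- On the unit circle the quaternion is `(cos α, 0, 0, sin α)`, which stands for the angle `2 α`.
The doubling is what makes the loop contractible in `SO(3)`. -/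
theorem planeRotation_circle (α : ℝ) :
    planeRotation !₂[Real.cos α, Real.sin α] = rotationAbout (axis 2) (2 * α) := by
  rw [rotationAbout_eq, axis_two_dir, mul_div_cancel_left₀ _ two_ne_zero, planeRotation]
  congr 1
  have h := Real.sin_sq_add_cos_sq α
  ext i
  fin_cases i <;> simp
  linarith

theorem rotationAbout_axis_neg (θ : ℝ) :
    rotationAbout (axis 2) (-θ) = (rotationAbout (axis 2) θ)⁻¹ := by
  rw [eq_inv_iff_mul_eq_one, ← rotationAbout_axis_add, neg_add_cancel,
    rotationAbout_axis_eq_one Real.cos_zero Real.sin_zero]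

section Obstruction

universe u

variable {r : ℕ} {E : LightCone → Type u}
  [∀ k, AddCommGroup (E k)] [∀ k, Module ℂ (E k)] [∀ k, TopologicalSpace (E k)]
  [TopologicalSpace (TotalSpace (Fiber r) E)] [FiberBundle (Fiber r) E]
  [VectorBundle ℂ (Fiber r) E] [VectorBundle ℝ (Fiber r) E]
  [ContMDiffVectorBundle ∞ (Fiber r) E 𝓘(ℝ, Space)]

/-- A bundle with an external rotation action only carries particles of helicity zero. -/
theorem MasslessParticle.HasHelicity.eq_zero_of_isExternal {P : MasslessParticle r E} {h : ℤ}
    (H : P.HasHelicity h) {A : BundleAction r E SO3} (hA : A.IsExternal) : h = 0 := by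
  have := P.nontrivial_fiber (axis 2)
  obtain ⟨v, hv⟩ := exists_ne (0 : E (axis 2))
  have hr := P.rank_eq_one
  let j : Fin r := ⟨0, P.rank_pos⟩
  have hj : ∀ x : Fiber r, x j = 0 → x = 0 := by
    intro x hx
    ext i
    have : i = j := Fin.ext (by have := i.2; change (i : ℕ) = 0; omega)
    rw [this]
    exact hx
  let B := P.toBundleAction.rotations
  have hinv : ∀ R : SO3, R⁻¹ • R • axis 2 = axis 2 := fun R => inv_smul_smul R _
  -- The external action carries `v` away from the third axis and the action of the particle brings
  -- it back, so all values lie in one fibre, which is a complex line.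
  let f : SO3 → E (axis 2) := fun R => B.tr R⁻¹ (hinv R) (A.tr R rfl v)
  have hf : ∀ R, B.act R⁻¹ (A.act R ⟨axis 2, v⟩) = ⟨axis 2, f R⟩ := by
    intro R
    rw [A.act_mk R rfl, B.act_mk R⁻¹ (hinv R)]
  have hf0 : ∀ R, f R ≠ 0 := by
    intro R h0
    have h1 : B.trEquiv R⁻¹ (hinv R) (A.trEquiv R rfl v) = 0 := h0
    rw [LinearEquiv.map_eq_zero_iff, LinearEquiv.map_eq_zero_iff] at h1
    exact hv h1
  let g : EuclideanSpace ℝ (Fin 2) → ℂ := fun u => coordAt r E (axis 2) (f (planeRotation u)) j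
  have hg0 : ∀ u, g u ≠ 0 := by
    intro u h0
    have h1 := hj _ h0
    rw [LinearEquiv.map_eq_zero_iff] at h1
    exact hf0 _ h1
  have hg : Continuous g := by
    have h1 := A.contMDiffOn_act isOpen_univ smoothInto_planeRotation (S := Set.univ)
      (f := id) (s := fun _ => (⟨axis 2, v⟩ : TotalSpace (Fiber r) E)) contMDiffOn_id
      contMDiffOn_const (fun _ _ => Set.mem_univ _)
    have h2 := B.contMDiffOn_act isOpen_univ smoothInto_planeRotation.inv_SO3 (S := Set.univ)
      (f := id) contMDiffOn_id h1 (fun _ _ => Set.mem_univ _)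
    simp only [id, hf] at h2
    rw [continuous_iff_continuousAt]
    intro u
    have h3 := contMDiffOn_univ.1 h2 u
    rw [contMDiffAt_totalSpace] at h3
    exact (EuclideanSpace.proj j : Fiber r →L[ℂ] ℂ).continuous.continuousAt.comp
      h3.2.continuousAt
  have hcirc : ∀ α : ℝ, g !₂[Real.cos α, Real.sin α] =
      Complex.exp (Complex.I * (2 * h : ℤ) * α) * coordAt r E (axis 2) v j := by
    intro α
    have h1 : f (planeRotation !₂[Real.cos α, Real.sin α]) =
        Complex.exp (Complex.I * (2 * h : ℤ) * α) • v := by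
      rw [planeRotation_circle]
      apply (TotalSpace.mk_inj (F := Fiber r)).1
      refine (hf _).symm.trans ?_
      -- Externality makes a rotation about the axis act as `1` through `A`; only the helicity phase
      -- of the inverse rotation remains.
      rw [hA _ 1 (axis 2) (by rw [rotationAbout_smul_self, one_smul]), A.act_one,
        ← rotationAbout_axis_neg]
      refine (H (axis 2) (-(2 * α)) v).trans ?_
      congr 3
      push_cast
      ring
    change coordAt r E (axis 2) (f _) j = _
    rw [h1, map_smul]
    rfl
  have := winding_eq_zero hg hg0 hcirc
  omega

end Obstruction

/-! ### Commutators of infinitesimal rotations -/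

theorem hasDerivAt_tan_half_smul {F : Type*} [NormedAddCommGroup F] [NormedSpace ℝ F] (x : F) :
    HasDerivAt (fun t : ℝ => Real.tan (t / 2) • x) ((1 / 2 : ℝ) • x) 0 := by
  have h1 : HasDerivAt (fun t : ℝ => t / 2) (1 / 2) 0 := (hasDerivAt_id _).div_const 2
  have h2 : HasDerivAt Real.tan (1 / Real.cos (0 / 2) ^ 2) (0 / 2 : ℝ) :=
    Real.hasDerivAt_tan (by simp)
  have h3 := (h2.comp (0 : ℝ) h1).smul_const x
  simpa using h3

section Mixed

variable {F V : Type*} [NormedAddCommGroup F] [NormedSpace ℝ F] [NormedAddCommGroup V]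
  [NormedSpace ℝ V]

theorem deriv_tan_half_smul {G : ℝ × F → V} (hG : Differentiable ℝ G) (s : ℝ) (x : F) :
    deriv (fun t => G (s, Real.tan (t / 2) • x)) 0 = fderiv ℝ G (s, 0) (0, (1 / 2 : ℝ) • x) := by
  have h := (hasDerivAt_const (0 : ℝ) s).prodMk (hasDerivAt_tan_half_smul x)
  have h0 : (s, Real.tan ((0 : ℝ) / 2) • x) = (s, (0 : F)) := by simp
  have h1 : HasFDerivAt G (fderiv ℝ G (s, 0)) (s, Real.tan ((0 : ℝ) / 2) • x) := by
    rw [h0]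
    exact (hG (s, 0)).hasFDerivAt
  exact (h1.comp_hasDerivAt (0 : ℝ) h).deriv

theorem deriv_fst_zero {G : ℝ × F → V} (hG : Differentiable ℝ G) (x : F) :
    deriv (fun s => G (s, x)) 0 = fderiv ℝ G (0, x) (1, 0) := by
  have h := (hasDerivAt_id (0 : ℝ)).prodMk (hasDerivAt_const (0 : ℝ) x)
  exact ((hG (0, x)).hasFDerivAt.comp_hasDerivAt (0 : ℝ) h).deriv

theorem hasDerivAt_clm_apply_fst {D : ℝ × F → (ℝ × F →L[ℝ] V)} (hD : Differentiable ℝ D)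
    {c : ℝ → F} {c' : F} (hc : HasDerivAt c c' 0) :
    HasDerivAt (fun s => D (s, 0) (0, (1 / 2 : ℝ) • c s))
      (fderiv ℝ D (0, 0) (1, 0) (0, (1 / 2 : ℝ) • c 0) + D (0, 0) (0, (1 / 2 : ℝ) • c')) 0 := by
  have h := (hasDerivAt_id (0 : ℝ)).prodMk (hasDerivAt_const (0 : ℝ) (0 : F))
  have h4 : HasDerivAt (fun s : ℝ => D (s, 0)) (fderiv ℝ D (0, 0) (1, 0)) 0 :=
    HasFDerivAt.comp_hasDerivAt (0 : ℝ) (hD (0, 0)).hasFDerivAt h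
  have h5 : HasDerivAt (fun s : ℝ => ((0 : ℝ), (1 / 2 : ℝ) • c s)) (0, (1 / 2 : ℝ) • c') 0 :=
    (hasDerivAt_const (0 : ℝ) (0 : ℝ)).prodMk (hc.const_smul (1 / 2 : ℝ))
  exact HasDerivAt.clm_apply h4 h5

theorem hasDerivAt_clm_apply_snd {D : ℝ × F → (ℝ × F →L[ℝ] V)} (hD : Differentiable ℝ D)
    (x : F) (v : ℝ × F) :
    HasDerivAt (fun t : ℝ => D (0, Real.tan (t / 2) • x) v)
      (fderiv ℝ D (0, 0) (0, (1 / 2 : ℝ) • x) v) 0 := by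
  have h := (hasDerivAt_const (0 : ℝ) (0 : ℝ)).prodMk (hasDerivAt_tan_half_smul x)
  have h0 : ((0 : ℝ), Real.tan ((0 : ℝ) / 2) • x) = (0, (0 : F)) := by simp
  have h1 : HasFDerivAt D (fderiv ℝ D (0, 0)) (0, Real.tan ((0 : ℝ) / 2) • x) := by
    rw [h0]
    exact (hD (0, 0)).hasFDerivAt
  have h2 : HasDerivAt (fun t : ℝ => D (0, Real.tan (t / 2) • x))
      (fderiv ℝ D (0, 0) (0, (1 / 2 : ℝ) • x)) 0 := h1.comp_hasDerivAt (0 : ℝ) h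
  exact ((ContinuousLinearMap.apply ℝ V v).hasFDerivAt.comp_hasDerivAt (0 : ℝ) h2)

/-- The commutator of two derivatives of `G` along a moving and a fixed direction. -/
theorem deriv_commutator {G : ℝ × F → V} (hG : ContDiff ℝ ∞ G) {c : ℝ → F}
    {c' : F} (hc : HasDerivAt c c' 0) :
    deriv (fun s => deriv (fun t => G (s, Real.tan (t / 2) • c s)) 0) 0
      - deriv (fun t => deriv (fun s => G (s, Real.tan (t / 2) • c 0)) 0) 0 =
      fderiv ℝ G (0, 0) (0, (1 / 2 : ℝ) • c') := by
  have hG1 : Differentiable ℝ G := hG.differentiable (by simp)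
  have hG2 : Differentiable ℝ (fderiv ℝ G) :=
    (hG.fderiv_right (m := 1) (by norm_cast)).differentiable (by simp)
  simp only [deriv_tan_half_smul hG1, deriv_fst_zero hG1]
  -- The mixed second derivatives cancel by symmetry, leaving only the motion of the direction `c`.
  have hsymm : IsSymmSndFDerivAt ℝ G (0, 0) :=
    hG.contDiffAt.isSymmSndFDerivAt (by
      rw [minSmoothness_of_isRCLikeNormedField]
      norm_cast)
  rw [(hasDerivAt_clm_apply_fst hG2 hc).deriv, (hasDerivAt_clm_apply_snd hG2 (c 0) (1, 0)).deriv,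
    hsymm.eq (1, 0) (0, (1 / 2 : ℝ) • c 0), add_sub_cancel_left]

end Mixed

theorem axis_dir (n : Fin 3) : (axis n).dir = Pi.single n 1 := by
  rw [LightCone.dir_eq, norm_axis]
  ext i
  simp [axis]

theorem rotationAbout_zero (k : LightCone) : rotationAbout k 0 = 1 := by
  apply SO3.ext
  change rodrigues _ 0 = 1
  simp [rodrigues]

theorem rotationAbout_neg (k : LightCone) (θ : ℝ) :
    rotationAbout k (-θ) = (rotationAbout k θ)⁻¹ := by
  apply SO3.ext
  rw [SO3.coe_inv]
  change rodrigues k.dir (-θ) = (rodrigues k.dir θ)ᵀ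
  ext i j
  fin_cases i <;> fin_cases j <;> simp [rodrigues, vecMulVec_apply, mul_comm]

/-- Moving `R` to the right conjugates the other factor, which only rotates its axis. Dividing the
half-angle quaternion by its cosine gives real part `1`, a chart near the identity that is linear
along each axis. -/
theorem mul_rotationAbout_eq (R : SO3) (k : LightCone) {t : ℝ} (ht : Real.cos (t / 2) ≠ 0) :
    R * rotationAbout k t = quatRotation 1 (Real.tan (t / 2) • (R.1 *ᵥ k.dir)) * R := by
  have h := quatRotation_conj R (Real.cos (t / 2)) (Real.sin (t / 2) • k.dir)
  rw [← rotationAbout_eq] at h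
  rw [← mul_inv_eq_iff_eq_mul, h,
    ← quatRotation_smul (w := 1) (x := Real.tan (t / 2) • (R.1 *ᵥ k.dir)) ht, mul_one,
    Matrix.mulVec_smul, smul_smul, mul_comm (Real.cos (t / 2)), Real.tan_mul_cos ht]

theorem eventually_cos_half_ne_zero : ∀ᶠ t in nhds (0 : ℝ), Real.cos (t / 2) ≠ 0 := by
  have h : ContinuousAt (fun t : ℝ => Real.cos (t / 2)) 0 := by fun_prop
  exact h.eventually_ne (by simp)

theorem hasDerivAt_rotationAbout_mulVec (k : LightCone) (x : Fin 3 → ℝ) :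
    HasDerivAt (fun s => (rotationAbout k s).1 *ᵥ x) (crossProduct k.dir x) 0 := by
  have h1 : ∀ s, (rotationAbout k s).1 *ᵥ x = Real.cos s • x + Real.sin s • crossProduct k.dir x
      + (1 - Real.cos s) • ((k.dir ⬝ᵥ x) • k.dir) := by
    intro s
    change rodrigues k.dir s *ᵥ x = _
    rw [rodrigues, Matrix.add_mulVec, Matrix.add_mulVec, Matrix.smul_mulVec, Matrix.smul_mulVec,
      Matrix.smul_mulVec, Matrix.one_mulVec, Matrix.vecMulVec_mulVec]
    ext i
    fin_cases i <;> simp [crossProduct, dotProduct, Fin.sum_univ_three] <;> ring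
  simp only [h1]
  have hcos := Real.hasDerivAt_cos 0
  have hsin := Real.hasDerivAt_sin 0
  have h := ((hcos.smul_const x).add (hsin.smul_const (crossProduct k.dir x))).add
    ((hcos.const_sub 1).smul_const ((k.dir ⬝ᵥ x) • k.dir))
  refine h.congr_deriv ?_
  simp

/-- A function on the rotation group is smooth if it is smooth along all smooth families. -/
def SmoothOnSO3 {V : Type*} [NormedAddCommGroup V] [NormedSpace ℝ V] (Ψ : SO3 → V) : Prop :=
  ∀ (m : ℕ) (γ : EuclideanSpace ℝ (Fin m) → SO3), SmoothInto γ Set.univ →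
    ContDiff ℝ ∞ fun u => Ψ (γ u)

section Commutator

variable {V : Type*} [NormedAddCommGroup V] [NormedSpace ℝ V]

theorem SmoothOnSO3.contDiff_rotationAbout {Ψ : SO3 → V} (hΨ : SmoothOnSO3 Ψ) (k : LightCone) :
    ContDiff ℝ ∞ fun t => Ψ (rotationAbout k t) := by
  have h := hΨ 1 (fun u => rotationAbout k (u 0)) (smoothInto_rotationAbout k
    (EuclideanSpace.proj 0 : EuclideanSpace ℝ (Fin 1) →L[ℝ] ℝ).contDiff.contDiffOn)
  have h1 : ContDiff ℝ ∞ fun t : ℝ => (EuclideanSpace.single 0 t : EuclideanSpace ℝ (Fin 1)) := by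
    rw [contDiff_euclidean]
    intro i
    fin_cases i
    simp only [EuclideanSpace.single, Fin.zero_eta]
    exact contDiff_id
  have h2 := h.comp h1
  simpa [Function.comp_def] using h2

theorem SmoothOnSO3.contDiff_quatRotation_mul {Ψ : SO3 → V} (hΨ : SmoothOnSO3 Ψ) (k : LightCone) :
    ContDiff ℝ ∞ fun p : ℝ × (Fin 3 → ℝ) => Ψ (quatRotation 1 p.2 * rotationAbout k p.1) := by
  have hp : ∀ i : Fin 4, ContDiff ℝ ∞ fun u : EuclideanSpace ℝ (Fin 4) => u i := fun i =>
    (EuclideanSpace.proj i : EuclideanSpace ℝ (Fin 4) →L[ℝ] ℝ).contDiff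
  have h := hΨ 4 (fun u => quatRotation 1 ![u 1, u 2, u 3] * rotationAbout k (u 0))
    (SmoothInto.mul_SO3 (smoothInto_quatRotation contDiffOn_const (by
      intro i
      fin_cases i
      exacts [(hp 1).contDiffOn, (hp 2).contDiffOn, (hp 3).contDiffOn]) (by
      intro u _
      simp only [quatNormSq]
      positivity)) (smoothInto_rotationAbout k (hp 0).contDiffOn))
  have h1 : ContDiff ℝ ∞ fun p : ℝ × (Fin 3 → ℝ) =>
      (!₂[p.1, p.2 0, p.2 1, p.2 2] : EuclideanSpace ℝ (Fin 4)) := by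
    have hi : ∀ i : Fin 3, ContDiff ℝ ∞ fun p : ℝ × (Fin 3 → ℝ) => p.2 i := fun i =>
      (contDiff_apply ℝ ℝ i).comp contDiff_snd
    rw [contDiff_euclidean]
    intro i
    fin_cases i
    exacts [contDiff_fst, hi 0, hi 1, hi 2]
  have h2 := h.comp h1
  have h3 : ∀ x : Fin 3 → ℝ, ![x 0, x 1, x 2] = x := by
    intro x
    ext i
    fin_cases i <;> rfl
  simpa [Function.comp_def, h3] using h2

/-- In the coordinates `G` both orders of the product have the same right factor `R_m(s)`. The left
factor is about the moving direction `R_m(s) e_n` in one order and about the fixed `e_n` in the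
other. Symmetry of second derivatives removes everything but the velocity `e_m × e_n` of the moving
direction. -/
theorem SmoothOnSO3.commutator {Ψ : SO3 → V} (hΨ : SmoothOnSO3 Ψ) (m n : Fin 3) :
    deriv (fun s => deriv (fun t => Ψ (rotationAbout (axis m) s * rotationAbout (axis n) t)) 0) 0
      - deriv (fun t => deriv (fun s => Ψ (rotationAbout (axis n) t * rotationAbout (axis m) s)) 0)
        0 =
    ∑ p : Fin 3, (crossProduct (Pi.single m 1) (Pi.single n 1) : Fin 3 → ℝ) p •
      deriv (fun t => Ψ (rotationAbout (axis p) t)) 0 := by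
  let G : ℝ × (Fin 3 → ℝ) → V := fun p => Ψ (quatRotation 1 p.2 * rotationAbout (axis m) p.1)
  have hG : ContDiff ℝ ∞ G := hΨ.contDiff_quatRotation_mul (axis m)
  let c : ℝ → Fin 3 → ℝ := fun s => (rotationAbout (axis m) s).1 *ᵥ Pi.single n 1
  have hc : HasDerivAt c (crossProduct (Pi.single m 1) (Pi.single n 1)) 0 := by
    have h := hasDerivAt_rotationAbout_mulVec (axis m) (Pi.single n 1)
    rwa [axis_dir] at h
  have hc0 : c 0 = Pi.single n 1 := by
    simp only [c, rotationAbout_zero]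
    exact Matrix.one_mulVec _
  have e1 : ∀ s, deriv (fun t => Ψ (rotationAbout (axis m) s * rotationAbout (axis n) t)) 0 =
      deriv (fun t => G (s, Real.tan (t / 2) • c s)) 0 := by
    intro s
    apply Filter.EventuallyEq.deriv_eq
    filter_upwards [eventually_cos_half_ne_zero] with t ht
    rw [mul_rotationAbout_eq _ _ ht, axis_dir]
  have e2 : ∀ p : Fin 3, ∀ᶠ t in nhds (0 : ℝ), ∀ s,
      Ψ (rotationAbout (axis p) t * rotationAbout (axis m) s) =
        G (s, Real.tan (t / 2) • Pi.single p 1) := by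
    intro p
    filter_upwards [eventually_cos_half_ne_zero] with t ht s
    have h := mul_rotationAbout_eq 1 (axis p) ht
    rw [one_mul, mul_one, axis_dir] at h
    rw [h]
    change Ψ (quatRotation 1 (_ • ((1 : Matrix (Fin 3) (Fin 3) ℝ) *ᵥ _)) * _) = _
    rw [Matrix.one_mulVec]
  have e3 : deriv (fun t => deriv
      (fun s => Ψ (rotationAbout (axis n) t * rotationAbout (axis m) s)) 0) 0 =
      deriv (fun t => deriv (fun s => G (s, Real.tan (t / 2) • c 0)) 0) 0 := by
    apply Filter.EventuallyEq.deriv_eq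
    filter_upwards [e2 n] with t ht
    simp only [ht, hc0]
  have e4 : ∀ p : Fin 3, deriv (fun t => Ψ (rotationAbout (axis p) t)) 0 =
      fderiv ℝ G (0, 0) (0, (1 / 2 : ℝ) • Pi.single p 1) := by
    intro p
    have h1 : (fun t => Ψ (rotationAbout (axis p) t)) =ᶠ[nhds 0]
        fun t => G (0, Real.tan (t / 2) • Pi.single p 1) := by
      filter_upwards [e2 p] with t ht
      rw [← ht 0, rotationAbout_zero, mul_one]
    rw [h1.deriv_eq]
    exact deriv_tan_half_smul (hG.differentiable (by simp)) 0 _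
  simp only [e1, e4]
  rw [e3, deriv_commutator hG hc]
  generalize (crossProduct (Pi.single m 1) (Pi.single n 1) : Fin 3 → ℝ) = w
  simp only [← map_smul]
  rw [← map_sum]
  congr 1
  ext i
  · simp [Prod.fst_sum]
  · simp [Prod.snd_sum, Finset.sum_apply, Pi.single_apply]
    ring

end Commutator

/-! ### Generators as derivatives on the rotation group -/

section VectorOperator

universe u

variable {r : ℕ} {E : LightCone → Type u}
  [∀ k, AddCommGroup (E k)] [∀ k, Module ℂ (E k)] [∀ k, TopologicalSpace (E k)]
  [TopologicalSpace (TotalSpace (Fiber r) E)] [FiberBundle (Fiber r) E]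

/-- The rotated section `Σ_R ψ(R⁻¹ k)` at the point `k`, in the coordinates of the fibre at `k`. -/
def BundleAction.rotatedCoord (A : BundleAction r E SO3) (ψ : ∀ k, E k) (k : LightCone) (R : SO3) :
    Fiber r :=
  (trivializationAt (Fiber r) E k (A.act R ⟨R⁻¹ • k, ψ (R⁻¹ • k)⟩)).2

variable [VectorBundle ℂ (Fiber r) E] [VectorBundle ℝ (Fiber r) E]
  [ContMDiffVectorBundle ∞ (Fiber r) E 𝓘(ℝ, Space)]

theorem BundleAction.rotatedCoord_eq (A : BundleAction r E SO3) (ψ : ∀ k, E k) (k : LightCone)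
    (R : SO3) : A.rotatedCoord ψ k R =
      coordAt r E k (A.tr R (smul_inv_smul R k) (ψ (R⁻¹ • k))) := by
  rw [BundleAction.rotatedCoord, A.act_mk R (smul_inv_smul R k), coordAt_apply]

theorem BundleAction.smoothOnSO3_rotatedCoord (A : BundleAction r E SO3) {ψ : ∀ k, E k}
    (hψ : SmoothSectionOn r E ψ Set.univ) (k : LightCone) :
    SmoothOnSO3 (A.rotatedCoord ψ k) := by
  intro m γ hγ
  have h1 : ContMDiffOn 𝓘(ℝ, EuclideanSpace ℝ (Fin m)) 𝓘(ℝ, Space) ∞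
      (fun u => (γ u)⁻¹ • k) Set.univ := by
    -- Acting on a zero vector and projecting yields the smoothness of the action on the base.
    have h2 := A.contMDiffOn_act isOpen_univ hγ.inv_SO3 (S := Set.univ) (f := id)
      (s := fun _ => (⟨k, 0⟩ : TotalSpace (Fiber r) E)) contMDiffOn_id contMDiffOn_const
      (fun _ _ => Set.mem_univ _)
    refine ((contMDiff_proj E).comp_contMDiffOn h2).congr fun u _ => ?_
    exact (A.act_proj (γ u)⁻¹ (⟨k, 0⟩ : TotalSpace (Fiber r) E)).symm
  have h3 := A.contMDiffOn_act isOpen_univ hγ (S := Set.univ) (f := id)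
    (s := fun u => (⟨(γ u)⁻¹ • k, ψ ((γ u)⁻¹ • k)⟩ : TotalSpace (Fiber r) E)) contMDiffOn_id
    ((contMDiffOn_univ.1 hψ).comp_contMDiffOn h1) (fun _ _ => Set.mem_univ _)
  rw [contDiff_iff_contDiffAt]
  intro u
  have h4 := contMDiffOn_univ.1 h3 u
  rw [contMDiffAt_totalSpace] at h4
  have h5 := h4.2.contDiffAt
  have h6 : (A.act (γ (id u)) ⟨(γ u)⁻¹ • k, ψ ((γ u)⁻¹ • k)⟩).proj = k := by
    rw [A.act_proj]
    exact smul_inv_smul (γ u) k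
  rw [h6] at h5
  exact h5

theorem BundleAction.coordAt_generator (A : BundleAction r E SO3) (m : Fin 3) (ψ : ∀ k, E k)
    (k : LightCone) : coordAt r E k (A.generator m ψ k) =
      Complex.I • deriv (fun t => A.rotatedCoord ψ k (rotationAbout (axis m) t)) 0 := by
  rw [BundleAction.generator, ← coordAt_symm_apply, map_smul, LinearEquiv.apply_symm_apply]
  congr 2
  funext t
  rw [BundleAction.rotatedCoord, rotationAbout_neg]

/-- A generator acts on the functions `rotatedCoord` by differentiation on the right, because the
transport by `R` is a fixed linear map and passes through the derivative. Iterated generators thus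
become iterated derivatives of one function on `SO(3)`. -/
theorem BundleAction.rotatedCoord_generator (A : BundleAction r E SO3) (n : Fin 3) {ψ : ∀ k, E k}
    (hψ : SmoothSectionOn r E ψ Set.univ) (k : LightCone) (R : SO3) :
    A.rotatedCoord (A.generator n ψ) k R =
      Complex.I • deriv (fun t => A.rotatedCoord ψ k (R * rotationAbout (axis n) t)) 0 := by
  let M : Fiber r →L[ℂ] Fiber r := LinearMap.toContinuousLinearMap
    ((coordAt r E k).toLinearMap ∘ₗ A.tr R (smul_inv_smul R k) ∘ₗ
      (coordAt r E (R⁻¹ • k)).symm.toLinearMap)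
  have hM : ∀ v : E (R⁻¹ • k), M (coordAt r E (R⁻¹ • k) v) =
      coordAt r E k (A.tr R (smul_inv_smul R k) v) := by
    intro v
    change coordAt r E k (A.tr R _ ((coordAt r E (R⁻¹ • k)).symm (coordAt r E (R⁻¹ • k) v))) = _
    rw [LinearEquiv.symm_apply_apply]
  have hMQ : ∀ Q : SO3, A.rotatedCoord ψ k (R * Q) = M (A.rotatedCoord ψ (R⁻¹ • k) Q) := by
    intro Q
    rw [A.rotatedCoord_eq ψ (R⁻¹ • k), hM, ← A.tr_mul]
    rw [BundleAction.rotatedCoord, coordAt_apply, ← A.act_mk]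
    have : (R * Q)⁻¹ • k = Q⁻¹ • R⁻¹ • k := by rw [_root_.mul_inv_rev, mul_smul]
    rw [this]
  have hd : DifferentiableAt ℝ
      (fun t => A.rotatedCoord ψ (R⁻¹ • k) (rotationAbout (axis n) t)) 0 :=
    ((A.smoothOnSO3_rotatedCoord hψ (R⁻¹ • k)).contDiff_rotationAbout (axis n)).differentiable
      (by simp) 0
  have hder := (M.restrictScalars ℝ).hasFDerivAt.comp_hasDerivAt (0 : ℝ) hd.hasDerivAt
  have hder' : deriv (fun t => A.rotatedCoord ψ k (R * rotationAbout (axis n) t)) 0 =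
      M (deriv (fun t => A.rotatedCoord ψ (R⁻¹ • k) (rotationAbout (axis n) t)) 0) := by
    simp only [hMQ]
    exact hder.deriv
  rw [hder', ← map_smul, ← A.coordAt_generator, hM, A.rotatedCoord_eq]

/-- The angular momentum operators form a vector operator. -/
theorem MasslessParticle.isVectorOperator_angularMomentum (P : MasslessParticle r E) :
    P.IsVectorOperator P.angularMomentum := by
  intro m n ψ hψ k
  apply (coordAt r E k).injective
  let A := P.toBundleAction.rotations
  have hJ : ∀ m, P.angularMomentum m = A.generator m := fun _ => rfl
  simp only [hJ, map_sub, map_smul, map_sum, A.coordAt_generator, A.rotatedCoord_generator _ hψ]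
  have h := (A.smoothOnSO3_rotatedCoord hψ k).commutator m n
  rw [deriv_fun_const_smul_field, deriv_fun_const_smul_field, ← smul_sub, ← smul_sub, h,
    Finset.smul_sum]
  congr 1
  refine Finset.sum_congr rfl fun p _ => ?_
  rw [smul_comm Complex.I, ← Complex.coe_smul]

end VectorOperator

end MasslessParticles

end

theorem mainTheorem2 {r : ℕ} {E : LightCone → Type*}
    [∀ k, AddCommGroup (E k)] [∀ k, Module ℂ (E k)] [∀ k, TopologicalSpace (E k)]
    [TopologicalSpace (TotalSpace (Fiber r) E)] [FiberBundle (Fiber r) E]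
    [VectorBundle ℂ (Fiber r) E] [VectorBundle ℝ (Fiber r) E]
    [ContMDiffVectorBundle ∞ (Fiber r) E 𝓘(ℝ, Space)] :
    (∀ A : BundleAction r E SO3, A.IsExternal → IsTrivialBundle r E) ∧
    (∀ P : MasslessParticle r E, ∃ h : ℤ,
      (∀ h' : ℤ, P.HasHelicity h' ↔ h' = h) ∧
      ((∃ L, P.IsExternalOAM L) ↔ h = 0) ∧
      ((∃ A : BundleAction r E SO3, A.IsExternal) ↔ h = 0)) := by
  refine ⟨fun A hA => hA.isTrivialBundle, fun P => ?_⟩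
  obtain ⟨h, H⟩ := P.exists_helicity
  refine ⟨h, fun h' => ⟨fun H' => H'.unique H, fun e => e ▸ H⟩, ⟨?_, ?_⟩, ⟨?_, ?_⟩⟩
  · rintro ⟨L, ⟨A, hA, -⟩, -⟩
    exact H.eq_zero_of_isExternal hA
  · rintro rfl
    -- At helicity zero the total angular momentum is itself an external orbital angular momentum.
    exact ⟨P.angularMomentum, ⟨P.toBundleAction.rotations, H.isExternal, fun _ => rfl⟩,
      P.isVectorOperator_angularMomentum⟩
  · rintro ⟨A, hA⟩
    exact H.eq_zero_of_isExternal hA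
  · rintro rfl
    exact ⟨P.toBundleAction.rotations, H.isExternal⟩
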